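/- **Theorem (Lower Extrapolation).** Let $d\ge 1$. Cubes in $\mathbb R^d$ are axis-parallel and nondegenerate; a weight is a locally integrable function on $\mathbb R^d$ that is positive a.e.; $\langle f\rangle_Q=\frac1{|Q|}\int_Q f$ denotes the average over $Q$. Let $Mf(x)=\sup_{Q\ni x}\langle |f|\rangle_Q$ be the (uncentered) Hardy–Littlewood maximal function. For a weight $w$ and $1<p<\infty$ put $$[w]_{A_p}=\sup_Q\langle w\rangle_Q\,\langle w^{-1/(p-1)}\rangle_Q^{\,p-1},\qquad [w]_{A_\infty}=\sup_Q\langle w\rangle_Q\exp\big(\langle\log w^{-1}\rangle_Q\big),\qquad [w]'_{A_\infty}=\sup_Q\frac1{w(Q)}\int_Q M(w\chi_Q),$$ where $w(Q)=\int_Q w$; write $w\in A_p$ if $[w]_{A_p}<\infty$, and let $$\|M\|_{\mathscr B(L^p(w))}=\sup_{f\in L^p(w),\,f\neq0}\frac{\|Mf\|_{L^p(w)}}{\|f\|_{L^p(w)}}.$$ There is a constant $c_d>0$ depending only on $d$ with the following property. Let $1<r<\infty$, let $\varphi:[1,\infty)^3\to[0,\infty)$ be increasing (in the weak sense) in each variable,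 and let $T$ be an operator, not necessarily linear, that maps each $f\in\bigcup_{w\in A_r}L^r(w)$ to a measurable function $Tf$ and satisfies, for every $w\in A_r$ and every $f\in L^r(w)$, $$\|Tf\|_{L^r(w)}\le\varphi\big([w]_{A_r},\,[w]_{A_\infty},\,[w^{-1/(r-1)}]_{A_\infty}^{r-1}\big)\,\|f\|_{L^r(w)}.$$ Then for every $p\in(1,r)$, every $w\in A_p$ with dual weight $\sigma=w^{-1/(p-1)}$, and every $f\in L^p(w)$: the quantities $\|M\|_{\mathscr B(L^p(w))}$, $[w]_{A_\infty}$, $[\sigma]_{A_\infty}$, $[\sigma]'_{A_\infty}$ are finite, $Tf$ is defined and measurable, and $$\begin{aligned}\|Tf\|_{L^p(w)}&\le 2\,\varphi\Big(\big(2\|M\|_{\mathscr B(L^p(w))}\big)^{r-p}\cdot\big([w]_{A_p},\,[w]_{A_\infty},\,[\sigma]_{A_\infty}^{p-1}\big)\Big)\,\|f\|_{L^p(w)}\\&\le 2\,\varphi\Big(\big(c_d\,p'\,([w]_{A_p}[\sigma]'_{A_\infty})^{1/p}\big)^{r-p}\cdot\big([w]_{A_p},\,[w]_{A_\infty},\,[\sigma]_{A_\infty}^{p-1}\big)\Big)\,\|f\|_{L^p(w)},\end{aligned}$$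 where $p'=p/(p-1)$ and the scalar multiplies each of the three entries. -/

import Mathlib

open MeasureTheory
open scoped ENNReal NNReal

noncomputable section

namespace Muckenhoupt

/-- A (closed, nondegenerate, axis-parallel) cube in `ℝ^d`, given by its lower corner and its
side length. -/
structure Cube (d : ℕ) where
  corner : Fin d → ℝ
  side : ℝ
  side_pos : 0 < side

/-- The point set of a cube. -/
def Cube.set {d : ℕ} (Q : Cube d) : Set (Fin d → ℝ) :=
  Set.Icc Q.corner (fun i => Q.corner i + Q.side)

/-- A weight on `ℝ^d`: a locally integrable function that is positive almost everywhere. -/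
def IsWeight {d : ℕ} (w : (Fin d → ℝ) → ℝ) : Prop :=
  LocallyIntegrable w volume ∧ ∀ᵐ x ∂(volume : Measure (Fin d → ℝ)), 0 < w x

/-- The measure `w dx`; the space `L^p(w)` is `L^p` of this measure. -/
def weightMeasure {d : ℕ} (w : (Fin d → ℝ) → ℝ) : Measure (Fin d → ℝ) :=
  volume.withDensity (fun x => ENNReal.ofReal (w x))

/-- The dual weight `w^{-1/(p-1)}`. -/
def dualWeight {d : ℕ} (p : ℝ) (w : (Fin d → ℝ) → ℝ) : (Fin d → ℝ) → ℝ :=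
  fun x => (w x) ^ (-1 / (p - 1))

/-- The constant `[w]_{A_p} = sup_Q (⨍_Q w) (⨍_Q w^{-1/(p-1)})^{p-1}`. -/
def apConst {d : ℕ} (p : ℝ) (w : (Fin d → ℝ) → ℝ) : ℝ≥0∞ :=
  ⨆ Q : Cube d, (⨍⁻ x in Q.set, ENNReal.ofReal (w x) ∂volume) *
    (⨍⁻ x in Q.set, ENNReal.ofReal (dualWeight p w x) ∂volume) ^ (p - 1)

/-- The class `A_p`. -/
def IsAp {d : ℕ} (p : ℝ) (w : (Fin d → ℝ) → ℝ) : Prop :=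
  IsWeight w ∧ apConst p w < ∞

open Classical in
/-- The extended number `exp (⨍_Q log w⁻¹)`. For a weight the positive part of `log w` is
integrable on `Q`, so that `⨍_Q log w⁻¹` is a well defined element of `(-∞, ∞]`, equal to `∞`
exactly if `log w⁻¹` is not integrable on `Q`. -/
def expMeanLogInv {d : ℕ} (w : (Fin d → ℝ) → ℝ) (Q : Cube d) : ℝ≥0∞ :=
  if IntegrableOn (fun x => Real.log (w x)⁻¹) Q.set volume then
    ENNReal.ofReal (Real.exp (⨍ x in Q.set, Real.log (w x)⁻¹ ∂volume))
  else ∞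

/-- Hruščev's constant `[w]_{A_∞} = sup_Q (⨍_Q w) exp (⨍_Q log w⁻¹)`. -/
def aInftyConst {d : ℕ} (w : (Fin d → ℝ) → ℝ) : ℝ≥0∞ :=
  ⨆ Q : Cube d, (⨍⁻ x in Q.set, ENNReal.ofReal (w x) ∂volume) * expMeanLogInv w Q

/-- The (uncentered) Hardy–Littlewood maximal function
`M f (x) = sup_{Q ∋ x} ⨍_Q |f|`. -/
def maximalFn {d : ℕ} {E : Type*} [NormedAddCommGroup E] (f : (Fin d → ℝ) → E) :
    (Fin d → ℝ) → ℝ≥0∞ :=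
  fun x => ⨆ (Q : Cube d) (_ : x ∈ Q.set), ⨍⁻ y in Q.set, ‖f y‖ₑ ∂volume

/-- Wilson's constant `[w]'_{A_∞} = sup_Q w(Q)⁻¹ ∫_Q M (w χ_Q)`. -/
def aInftyConst' {d : ℕ} (w : (Fin d → ℝ) → ℝ) : ℝ≥0∞ :=
  ⨆ Q : Cube d, (∫⁻ x in Q.set, maximalFn (Q.set.indicator w) x ∂volume) / weightMeasure w Q.set

/-- The operator norm `‖M‖_{B(L^p(w))} = sup_{f ≠ 0} ‖M f‖_{L^p(w)} / ‖f‖_{L^p(w)}`. -/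
def maximalNorm {d : ℕ} (p : ℝ) (w : (Fin d → ℝ) → ℝ) : ℝ≥0∞ :=
  ⨆ (f : (Fin d → ℝ) → ℂ) (_ : MemLp f (ENNReal.ofReal p) (weightMeasure w))
    (_ : eLpNorm f (ENNReal.ofReal p) (weightMeasure w) ≠ 0),
    eLpNorm (maximalFn f) (ENNReal.ofReal p) (weightMeasure w) /
      eLpNorm f (ENNReal.ofReal p) (weightMeasure w)

end Muckenhoupt

end

open Muckenhoupt

/-! This is Rubio de Francia's extrapolation. Let `M` be the maximal operator, `‖M‖` its norm on
`L^p(w)` and `c = 2‖M‖`. For nonzero `f ∈ L^p(w)` the series `R = ∑ c^{-n} M^n|f|` satisfies `|f| ≤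
R`, `M R ≤ c R` and `‖R‖_{L^p(w)} ≤ 2‖f‖_{L^p(w)}` (`exists_maxOp_le_mul`). Put `W = w R^{p-r}`.

The bound `M R ≤ c R` says that `R ≥ ⟨R⟩_Q / c` on every cube `Q`. Negative powers of `R` are thus
controlled by powers of `⟨R⟩_Q / c`, positive powers by Hölder or Jensen, and in each of the three
weight constants of `W` the powers of `⟨R⟩_Q` cancel and leave the factor `c^{r-p}` (namespace
`IsAOne`). Since `|f| ≤ R`, the function `f` lies in `L^r(W)`, with `∫|f|^r W ≤ ∫|f|^p w`. The
hypothesis on `T` applies at `W`, and Hölder gives `‖Tf‖_{L^p(w)} ≤ ‖Tf‖_{L^r(W)}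
‖R‖_{L^p(w)}^{(r-p)/r}`. The powers of `‖f‖` recombine, and `2^{(r-p)/r} ≤ 2` is the leading factor
(`IsAp.eLpNorm_le_of_eLpNorm_le`).

What remains is the maximal theorem: `‖M‖` is finite and at most `c_d p'
([w]_{A_p}[σ]'_{A_∞})^{1/p}`. Every cube lies in a comparable cell of one of `2^d` shifted dyadic
grids, so it suffices to treat a nested sequence of partitions. There the maximal function is
dominated by its values on stopping cells, where the averages have more than doubled. The `A_p`
condition turns Lebesgue averages into averages with respect to `σ`. The stopping cells are sparse
for Lebesgue measure, and `[σ]'_{A_∞}` transfers this to a Carleson packing condition for `σ`.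
Carleson embedding and Doob's inequality for `σ` finish the mixed bound.

The mixed bound is vacuous unless `[σ]'_{A_∞}` is finite. Finiteness of `‖M‖` therefore comes from a
second argument: a pointwise bound by two composed maximal functions, with respect to `σ` and `w
dx`, each controlled by Doob. Testing on `σχ_Q` then gives `[σ]'_{A_∞} ≤ ‖M‖`. -/

/-! ### Nested partitions and the Carleson embedding. -/

/-- A sequence of countable measurable partitions, each refining the previous one. The cells of
the `n`-th partition are the fibres of `idx n`. -/
structure PartitionFiltration (X ι : Type*) [MeasurableSpace X] [MeasurableSpace ι] where
  idx : ℕ → X → ι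
  measurable_idx : ∀ n, Measurable (idx n)
  idx_eq_of_succ : ∀ n x y, idx (n + 1) x = idx (n + 1) y → idx n x = idx n y

namespace PartitionFiltration

variable {X ι : Type*} [MeasurableSpace X] [MeasurableSpace ι] (P : PartitionFiltration X ι)

/-- The cell of generation `n` that contains `x`. -/
def cell (n : ℕ) (x : X) : Set X := {y | P.idx n y = P.idx n x}

/-- Functions that are constant on the cells of generation `n`. -/
def CellConst {β : Type*} (n : ℕ) (h : X → β) : Prop := ∀ x y, P.idx n x = P.idx n y → h x = h y

/-- The ratio of two measures of the cell of generation `n` that contains `x`. -/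
noncomputable def ratio (F μ : Measure X) (n : ℕ) (x : X) : ℝ≥0∞ :=
  F (P.cell n x) / μ (P.cell n x)

variable {P}

lemma mem_cell {n : ℕ} {x y : X} : y ∈ P.cell n x ↔ P.idx n y = P.idx n x := Iff.rfl

lemma mem_cell_self (n : ℕ) (x : X) : x ∈ P.cell n x := rfl

lemma cell_congr {n : ℕ} {x y : X} (h : P.idx n x = P.idx n y) : P.cell n x = P.cell n y := by
  ext z; simp [mem_cell, h]

lemma idx_eq_of_le {m n : ℕ} (hmn : m ≤ n) {x y : X} (h : P.idx n x = P.idx n y) :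
    P.idx m x = P.idx m y := by
  induction n, hmn using Nat.le_induction with
  | base => exact h
  | succ n _ ih => exact ih (P.idx_eq_of_succ n x y h)

lemma CellConst.mono {β : Type*} {m n : ℕ} (hmn : m ≤ n) {h : X → β} (hh : P.CellConst m h) :
    P.CellConst n h := fun x y hxy => hh x y (idx_eq_of_le hmn hxy)

lemma CellConst.comp {β γ : Type*} {n : ℕ} {h : X → β} (hh : P.CellConst n h) (g : β → γ) :
    P.CellConst n (fun x => g (h x)) := fun x y hxy => congrArg g (hh x y hxy)

lemma CellConst.mul {n : ℕ} {g h : X → ℝ≥0∞} (hg : P.CellConst n g) (hh : P.CellConst n h) :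
    P.CellConst n (fun x => g x * h x) := fun x y hxy => congrArg₂ _ (hg x y hxy) (hh x y hxy)

lemma cellConst_ratio (F μ : Measure X) (n : ℕ) : P.CellConst n (P.ratio F μ n) := by
  intro x y h
  simp only [ratio, cell_congr h]

lemma cellConst_mem_cell (n : ℕ) (x : X) : P.CellConst n (fun y => y ∈ P.cell n x) := by
  intro y z h
  simp only [mem_cell, h]

section
variable [MeasurableSingletonClass ι]

lemma measurableSet_cell (n : ℕ) (x : X) : MeasurableSet (P.cell n x) :=
  P.measurable_idx n (measurableSet_singleton _)

variable [Countable ι]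

lemma CellConst.measurable {β : Type*} [MeasurableSpace β] {n : ℕ} {h : X → β}
    (hh : P.CellConst n h) : Measurable h := by
  rcases isEmpty_or_nonempty X with hX | ⟨⟨x₀⟩⟩
  · exact measurable_of_empty h
  classical
  have : h = (fun i => if hi : ∃ x, P.idx n x = i then h hi.choose else h x₀) ∘ P.idx n := by
    ext x
    have hx : ∃ y, P.idx n y = P.idx n x := ⟨x, rfl⟩
    simp only [Function.comp, dif_pos hx]
    exact hh _ _ hx.choose_spec.symm
  rw [this]
  exact (measurable_of_countable _).comp (P.measurable_idx n)

/-- Integrals of cellwise constant functions can be compared cell by cell. -/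
lemma lintegral_le_of_cell {n : ℕ} {h₁ h₂ : X → ℝ≥0∞} {ν₁ ν₂ : Measure X}
    (hc₁ : P.CellConst n h₁) (hc₂ : P.CellConst n h₂)
    (h : ∀ x, h₁ x * ν₁ (P.cell n x) ≤ h₂ x * ν₂ (P.cell n x)) :
    ∫⁻ x, h₁ x ∂ν₁ ≤ ∫⁻ x, h₂ x ∂ν₂ := by
  have key : ∀ (ν : Measure X) (u : X → ℝ≥0∞),
      ∫⁻ x, u x ∂ν = ∑' i, ∫⁻ x in P.idx n ⁻¹' {i}, u x ∂ν := by
    intro ν u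
    rw [← lintegral_iUnion (fun i => P.measurable_idx n (measurableSet_singleton i))]
    · rw [← Set.preimage_iUnion, Set.iUnion_of_singleton, Set.preimage_univ,
        Measure.restrict_univ]
    · intro i j hij
      exact Disjoint.preimage _ (by simpa using hij)
  rw [key, key]
  refine ENNReal.tsum_le_tsum fun i => ?_
  by_cases hi : ∃ x, P.idx n x = i
  · obtain ⟨x, rfl⟩ := hi
    have e : ∀ (ν : Measure X) (u : X → ℝ≥0∞), P.CellConst n u →
        ∫⁻ y in P.idx n ⁻¹' {P.idx n x}, u y ∂ν = u x * ν (P.cell n x) := by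
      intro ν u hu
      rw [setLIntegral_congr_fun (g := fun _ => u x)
        (P.measurable_idx n (measurableSet_singleton _)) (fun y hy => hu y x hy),
        setLIntegral_const]
      rfl
    rw [e _ _ hc₁, e _ _ hc₂]
    exact h x
  · have : P.idx n ⁻¹' {i} = ∅ := by
      ext y; simp only [Set.mem_preimage, Set.mem_singleton_iff, Set.mem_empty_iff_false, iff_false]
      exact fun hy => hi ⟨y, hy⟩
    simp [this]

/-- Abel summation against sets that satisfy a Carleson packing condition. -/
lemma sum_setLIntegral_le_of_carleson {σ : Measure X} {A : ℕ → Set X}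
    (hA : ∀ j, P.CellConst j (fun x => x ∈ A j)) {Λ : ℝ≥0∞} {n : ℕ}
    (hΛ : ∀ i ≤ n, ∀ x, ∑ j ∈ Finset.Icc i n, σ (A j ∩ P.cell i x) ≤ Λ * σ (P.cell i x))
    {v : ℕ → X → ℝ≥0∞} (hv : ∀ j, P.CellConst j (v j)) (hmono : ∀ x, Monotone (fun j => v j x)) :
    ∑ j ∈ Finset.range (n + 1), ∫⁻ x in A j, v j x ∂σ ≤ Λ * ∫⁻ x, v n x ∂σ := by
  have hAm : ∀ j, MeasurableSet (A j) := fun j => (hA j).measurable.setOf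
  -- The increments of `v`. After the order of summation is exchanged, `D i` meets exactly the sets
  -- `A j` with `j ≥ i`, and `D i` is constant on cells of generation `i`, where the packing
  -- condition applies.
  set D : ℕ → X → ℝ≥0∞ := fun i x => if i = 0 then v 0 x else v i x - v (i - 1) x with hD
  have hDc : ∀ i, P.CellConst i (D i) := by
    intro i x y h
    rcases i with _ | i
    · simpa [hD] using hv 0 x y h
    · simp only [hD, Nat.add_eq_zero_iff, one_ne_zero, and_false, if_false, Nat.add_sub_cancel]
      rw [hv (i + 1) x y h, hv i x y (P.idx_eq_of_succ i x y h)]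
  have htel : ∀ j x, v j x = ∑ i ∈ Finset.range (j + 1), D i x := by
    intro j x
    induction j with
    | zero => simp [hD]
    | succ j ih =>
      rw [Finset.sum_range_succ, ← ih]
      simp only [hD, Nat.add_eq_zero_iff, one_ne_zero, and_false, if_false, Nat.add_sub_cancel]
      rw [add_tsub_cancel_of_le (hmono x (Nat.le_succ j))]
  have hDm : ∀ i, Measurable (D i) := fun i => (hDc i).measurable
  calc ∑ j ∈ Finset.range (n + 1), ∫⁻ x in A j, v j x ∂σ
      = ∑ j ∈ Finset.range (n + 1), ∑ i ∈ Finset.range (j + 1), ∫⁻ x in A j, D i x ∂σ := by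
        refine Finset.sum_congr rfl fun j _ => ?_
        rw [← lintegral_finsetSum _ (fun i _ => hDm i)]
        simp_rw [htel j]
    _ = ∑ i ∈ Finset.range (n + 1), ∑ j ∈ Finset.Icc i n, ∫⁻ x in A j, D i x ∂σ := by
        refine Finset.sum_comm' ?_
        intro j i
        simp only [Finset.mem_range, Finset.mem_Icc]
        omega
    _ ≤ ∑ i ∈ Finset.range (n + 1), Λ * ∫⁻ x, D i x ∂σ := by
        refine Finset.sum_le_sum fun i hi => ?_
        have hin : i ≤ n := by simpa [Nat.lt_succ_iff] using hi
        rw [← lintegral_const_mul _ (hDm i),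
          ← lintegral_finsetSum_measure]
        refine lintegral_le_of_cell (hDc i) (fun x y h => by rw [hDc i x y h]) fun x => ?_
        rw [mul_comm Λ, mul_assoc]
        gcongr
        refine le_trans (le_of_eq ?_) (hΛ i hin x)
        rw [Measure.finsetSum_apply]
        refine Finset.sum_congr rfl fun j _ => ?_
        rw [Measure.restrict_apply (measurableSet_cell i x), Set.inter_comm]
    _ = Λ * ∫⁻ x, v n x ∂σ := by
        rw [← Finset.mul_sum, ← lintegral_finsetSum _ (fun i _ => hDm i)]
        simp_rw [htel n]

end
end PartitionFiltration

/-! ### Doob's maximal inequality. -/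

/-- Jensen's inequality for `t ↦ t ^ p`, without normalization. -/
lemma rpow_lintegral_le_lintegral_rpow_mul {X : Type*} [MeasurableSpace X] {ν : Measure X}
    {p : ℝ} (hp : 1 < p) {g : X → ℝ≥0∞} (hg : AEMeasurable g ν) :
    (∫⁻ x, g x ∂ν) ^ p ≤ (∫⁻ x, g x ^ p ∂ν) * ν Set.univ ^ (p - 1) := by
  have hpq := Real.HolderConjugate.conjExponent hp
  have h := ENNReal.lintegral_mul_le_Lp_mul_Lq ν hpq hg (aemeasurable_const (b := (1 : ℝ≥0∞)))
  simp only [Pi.mul_apply, mul_one, ENNReal.one_rpow, lintegral_const, one_mul] at h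
  have hp0 : 0 < p := by linarith
  calc (∫⁻ x, g x ∂ν) ^ p
      ≤ ((∫⁻ x, g x ^ p ∂ν) ^ (1 / p) * ν Set.univ ^ (1 / p.conjExponent)) ^ p := by gcongr
    _ = _ := by
        rw [ENNReal.mul_rpow_of_nonneg _ _ hp0.le, ← ENNReal.rpow_mul, ← ENNReal.rpow_mul,
          one_div_mul_cancel hp0.ne', ENNReal.rpow_one]
        congr 2
        rw [Real.conjExponent]
        field_simp

/-- Young's inequality `p b a^{p-1} ≤ b^p + (p-1) a^p`, rearranged to control one jump of a running
maximum from `a` to `b`. -/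
lemma rpow_le_rpow_add_mul_tsub {p : ℝ} (hp : 1 < p) {a b : ℝ≥0∞} (hab : a ≤ b) (hb : b ≠ ∞) :
    ENNReal.ofReal (p - 1) * b ^ p ≤
      ENNReal.ofReal (p - 1) * a ^ p + ENNReal.ofReal p * (b * (b ^ (p - 1) - a ^ (p - 1))) := by
  have ha : a ≠ ∞ := ne_top_of_le_ne_top hb hab
  have hp1 : 0 < p - 1 := by linarith
  have hp0 : 0 < p := by linarith
  obtain ⟨x, hx, rfl⟩ : ∃ x : ℝ, 0 ≤ x ∧ a = ENNReal.ofReal x :=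
    ⟨a.toReal, ENNReal.toReal_nonneg, (ENNReal.ofReal_toReal ha).symm⟩
  obtain ⟨y, hy, rfl⟩ : ∃ y : ℝ, 0 ≤ y ∧ b = ENNReal.ofReal y :=
    ⟨b.toReal, ENNReal.toReal_nonneg, (ENNReal.ofReal_toReal hb).symm⟩
  have hxy : x ≤ y := (ENNReal.ofReal_le_ofReal_iff hy).1 hab
  have hyoung := Real.young_inequality_of_nonneg hy
    (Real.rpow_nonneg hx (p - 1)) (Real.HolderConjugate.conjExponent hp)
  have hconj : (x ^ (p - 1)) ^ p.conjExponent = x ^ p := by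
    rw [← Real.rpow_mul hx, Real.conjExponent]
    congr 1; field_simp
  have hyp : y ^ p = y * y ^ (p - 1) := by
    rcases hy.eq_or_lt with h0 | h0
    · rw [← h0, Real.zero_rpow hp0.ne', zero_mul]
    · rw [← Real.rpow_one_add' h0.le (by linarith)]; congr 1; ring
  rw [hconj, Real.conjExponent] at hyoung
  have hyoung' : p * (y * x ^ (p - 1)) ≤ y ^ p + (p - 1) * x ^ p := by
    calc p * (y * x ^ (p - 1))
        ≤ p * (y ^ p / p + x ^ p / (p / (p - 1))) := by gcongr
      _ = _ := by field_simp
  have hmono : x ^ (p - 1) ≤ y ^ (p - 1) := Real.rpow_le_rpow hx hxy hp1.le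
  rw [ENNReal.ofReal_rpow_of_nonneg hy hp0.le, ENNReal.ofReal_rpow_of_nonneg hx hp0.le,
    ENNReal.ofReal_rpow_of_nonneg hy hp1.le, ENNReal.ofReal_rpow_of_nonneg hx hp1.le,
    ← ENNReal.ofReal_sub _ (Real.rpow_nonneg hx _),
    ← ENNReal.ofReal_mul hy, ← ENNReal.ofReal_mul hp0.le, ← ENNReal.ofReal_mul hp1.le,
    ← ENNReal.ofReal_mul hp1.le, ← ENNReal.ofReal_add
      (mul_nonneg hp1.le (Real.rpow_nonneg hx _))
      (mul_nonneg hp0.le (mul_nonneg hy (sub_nonneg.2 hmono)))]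
  apply ENNReal.ofReal_le_ofReal
  nlinarith

/-- The pathwise form of Doob's inequality. -/
lemma rpow_partialSups_le_sum {p : ℝ} (hp : 1 < p) {u : ℕ → ℝ≥0∞} (hu : ∀ i, u i ≠ ∞) (n : ℕ) :
    ENNReal.ofReal (p - 1) * partialSups u n ^ p ≤ ENNReal.ofReal p *
      ∑ i ∈ Finset.range (n + 1), u i * (if i = 0 then partialSups u 0 ^ (p - 1)
        else partialSups u i ^ (p - 1) - partialSups u (i - 1) ^ (p - 1)) := by
  have hp0 : 0 < p := by linarith
  induction n with
  | zero =>
    simp only [zero_add, Finset.range_one, Finset.sum_singleton, if_true, partialSups_zero]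
    have : u 0 * u 0 ^ (p - 1) = u 0 ^ p := by
      conv_lhs => enter [1]; rw [← ENNReal.rpow_one (u 0)]
      rw [← ENNReal.rpow_add_of_nonneg _ _ zero_le_one (by linarith)]
      congr 1; ring
    rw [this]
    gcongr
    linarith
  | succ n ih =>
    rw [Finset.sum_range_succ, mul_add]
    have hs : partialSups u (n + 1) = partialSups u n ⊔ u (n + 1) := partialSups_add_one u n
    simp only [Nat.add_eq_zero_iff, one_ne_zero, and_false, if_false, Nat.add_sub_cancel]
    rcases le_total (u (n + 1)) (partialSups u n) with h | h
    · rw [hs, sup_eq_left.2 h]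
      exact ih.trans le_self_add
    · rw [hs, sup_eq_right.2 h]
      refine (rpow_le_rpow_add_mul_tsub hp h (hu _)).trans ?_
      gcongr

namespace PartitionFiltration

variable {X ι : Type*} [MeasurableSpace X] [MeasurableSpace ι] {P : PartitionFiltration X ι}

lemma cellConst_partialSups {u : ℕ → X → ℝ≥0∞} (hu : ∀ j, P.CellConst j (u j)) (n : ℕ) :
    P.CellConst n (fun x => partialSups (fun j => u j x) n) := by
  intro x y h
  simp only [partialSups_apply]
  refine Finset.sup'_congr _ rfl fun j hj => ?_
  exact hu j x y (idx_eq_of_le (by simpa [Nat.lt_succ_iff] using hj) h)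

variable [MeasurableSingletonClass ι] [Countable ι]

lemma measurable_partialSups_ratio (F σ : Measure X) (n : ℕ) :
    Measurable (fun x => partialSups (fun j => P.ratio F σ j x) n) :=
  (cellConst_partialSups (fun j => cellConst_ratio F σ j) n).measurable

/-- The pathwise inequality integrated against `σ`. The increment of generation `i` is constant on
the cells of that generation, so there the factor `F/σ` converts integration against `σ` into
integration against `F`. -/
lemma mul_lintegral_rpow_partialSups_le {σ F : Measure X} (hF : ∀ n x, F (P.cell n x) ≠ ∞)
    (hσ : ∀ n x, σ (P.cell n x) ≠ 0) {p : ℝ} (hp : 1 < p) (n : ℕ) :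
    ENNReal.ofReal (p - 1) * ∫⁻ x, partialSups (fun j => P.ratio F σ j x) n ^ p ∂σ ≤
      ENNReal.ofReal p * ∫⁻ x, partialSups (fun j => P.ratio F σ j x) n ^ (p - 1) ∂F := by
  set G : ℕ → X → ℝ≥0∞ := fun j x => partialSups (fun j => P.ratio F σ j x) j with hG
  have hGc : ∀ j, P.CellConst j (G j) :=
    fun j => cellConst_partialSups (fun j => cellConst_ratio F σ j) j
  have hGm : ∀ j, Measurable (G j) := fun j => (hGc j).measurable
  set D : ℕ → X → ℝ≥0∞ := fun i x => if i = 0 then G 0 x ^ (p - 1)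
        else G i x ^ (p - 1) - G (i - 1) x ^ (p - 1) with hD
  have hDc : ∀ i, P.CellConst i (D i) := by
    intro i x y h
    rcases i with _ | i
    · simp only [hD, if_true, hGc 0 x y h]
    · simp only [hD, Nat.add_eq_zero_iff, one_ne_zero, and_false, if_false, Nat.add_sub_cancel]
      rw [hGc (i + 1) x y h, hGc i x y (P.idx_eq_of_succ i x y h)]
  have hDm : ∀ i, Measurable (D i) := fun i => (hDc i).measurable
  have htel : ∀ j x, G j x ^ (p - 1) = ∑ i ∈ Finset.range (j + 1), D i x := by
    intro j x
    induction j with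
    | zero => simp [hD]
    | succ j ih =>
      rw [Finset.sum_range_succ, ← ih]
      simp only [hD, Nat.add_eq_zero_iff, one_ne_zero, and_false, if_false, Nat.add_sub_cancel]
      rw [add_tsub_cancel_of_le]
      exact ENNReal.rpow_le_rpow ((partialSups _).monotone (Nat.le_succ j)) (by linarith)
  have hrm : ∀ i, Measurable (P.ratio F σ i) := fun i => (cellConst_ratio F σ i).measurable
  calc ENNReal.ofReal (p - 1) * ∫⁻ x, G n x ^ p ∂σ
      = ∫⁻ x, ENNReal.ofReal (p - 1) * G n x ^ p ∂σ :=
        (lintegral_const_mul _ ((hGm n).pow_const p)).symm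
    _ ≤ ∫⁻ x, ENNReal.ofReal p * ∑ i ∈ Finset.range (n + 1), P.ratio F σ i x * D i x ∂σ :=
        lintegral_mono fun x => rpow_partialSups_le_sum hp
          (fun i => (ENNReal.div_lt_top (hF i x) (hσ i x)).ne) n
    _ = ENNReal.ofReal p *
          ∑ i ∈ Finset.range (n + 1), ∫⁻ x, P.ratio F σ i x * D i x ∂σ := by
        rw [← lintegral_finsetSum _ fun i _ => (hrm i).fun_mul (hDm i),
          lintegral_const_mul _ (Finset.measurable_fun_sum _ fun i _ => (hrm i).fun_mul (hDm i))]
    _ ≤ ENNReal.ofReal p * ∑ i ∈ Finset.range (n + 1), ∫⁻ x, D i x ∂F := by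
        refine mul_le_mul_right (Finset.sum_le_sum fun i hi => ?_) _
        refine lintegral_le_of_cell (n := i) (fun x y h => ?_) (hDc i) fun x => ?_
        · rw [cellConst_ratio F σ i x y h, hDc i x y h]
        · rw [mul_right_comm, mul_comm (D i x)]
          gcongr
          rw [ratio, mul_comm]
          exact ENNReal.mul_div_le
    _ = ENNReal.ofReal p * ∫⁻ x, G n x ^ (p - 1) ∂F := by
        rw [← lintegral_finsetSum _ fun i _ => hDm i]
        simp_rw [htel n]

/-- Doob's maximal inequality for the averages with respect to `σ`. -/
theorem lintegral_rpow_partialSups_le {σ : Measure X} (hσ : ∀ n x, σ (P.cell n x) ≠ 0)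
    (hσ' : ∀ n x, σ (P.cell n x) ≠ ∞) {p : ℝ} (hp : 1 < p) {g : X → ℝ≥0∞} (hg : AEMeasurable g σ)
    (n : ℕ) :
    ∫⁻ x, partialSups (fun j => P.ratio (σ.withDensity g) σ j x) n ^ p ∂σ ≤
      ENNReal.ofReal (p / (p - 1)) ^ p * ∫⁻ x, g x ^ p ∂σ := by
  have hp0 : 0 < p := by linarith
  have hp1 : 0 < p - 1 := by linarith
  by_cases hfin : ∫⁻ x, g x ^ p ∂σ = ∞
  · rw [hfin, ENNReal.mul_top]
    · exact le_top
    · simp only [ne_eq, ENNReal.rpow_eq_zero_iff, ENNReal.ofReal_eq_zero, not_or, not_and,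
        ENNReal.ofReal_ne_top]
      exact ⟨fun h => absurd h (not_le.2 (by positivity)), fun h => h.elim⟩
  have hcell : ∀ i x, (σ.withDensity g (P.cell i x)) ^ p ≤
      (∫⁻ y in P.cell i x, g y ^ p ∂σ) * σ (P.cell i x) ^ (p - 1) := by
    intro i x
    rw [withDensity_apply _ (measurableSet_cell i x)]
    have := rpow_lintegral_le_lintegral_rpow_mul (ν := σ.restrict (P.cell i x)) hp hg.restrict
    rwa [Measure.restrict_apply_univ] at this
  have hF : ∀ i x, σ.withDensity g (P.cell i x) ≠ ∞ := by
    intro i x h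
    have := hcell i x
    rw [h, ENNReal.top_rpow_of_pos hp0, top_le_iff] at this
    refine ENNReal.mul_ne_top ?_ ?_ this
    · exact ne_top_of_le_ne_top hfin (setLIntegral_le_lintegral _ _)
    · exact ENNReal.rpow_ne_top_of_nonneg hp1.le (hσ' i x)
  set F := σ.withDensity g with hFdef
  set G : X → ℝ≥0∞ := fun x => partialSups (fun j => P.ratio F σ j x) n with hG
  have hGm : Measurable G := measurable_partialSups_ratio F σ n
  set I := ∫⁻ x, G x ^ p ∂σ with hI
  -- Finiteness is needed in order to divide by a power of `I` below. A maximum of finitely many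
  -- averages is at most their sum, and each average is a contraction of `L^p(σ)` by Jensen.
  have hIfin : I ≠ ∞ := by
    have h1 : I ≤ ∑ i ∈ Finset.range (n + 1), ∫⁻ x, P.ratio F σ i x ^ p ∂σ := by
      rw [← lintegral_finsetSum _ fun i _ => ((cellConst_ratio F σ i).measurable.pow_const p)]
      refine lintegral_mono fun x => ?_
      obtain ⟨i, hi, hi'⟩ := Finset.exists_mem_eq_sup' (s := Finset.Iic n) (by simp)
        (fun j => P.ratio F σ j x)
      have : G x = P.ratio F σ i x := by rw [hG]; simp only [partialSups_apply]; exact hi'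
      simp only [this]
      exact Finset.single_le_sum (f := fun i => P.ratio F σ i x ^ p) (fun _ _ => zero_le)
        (by simpa [Nat.lt_succ_iff] using hi)
    refine ne_top_of_le_ne_top ?_ h1
    refine ENNReal.sum_ne_top.2 fun i _ => ?_
    refine ne_top_of_le_ne_top hfin ?_
    calc ∫⁻ x, P.ratio F σ i x ^ p ∂σ
        ≤ ∫⁻ x, 1 ∂(σ.withDensity fun x => g x ^ p) := by
          refine lintegral_le_of_cell (n := i) (fun x y h => by rw [cellConst_ratio F σ i x y h])
            (fun _ _ _ => rfl) fun x => ?_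
          rw [one_mul, withDensity_apply _ (measurableSet_cell i x), ratio,
            ENNReal.div_rpow_of_nonneg _ _ hp0.le]
          calc F (P.cell i x) ^ p / σ (P.cell i x) ^ p * σ (P.cell i x)
              ≤ (∫⁻ y in P.cell i x, g y ^ p ∂σ) * σ (P.cell i x) ^ (p - 1) /
                σ (P.cell i x) ^ p * σ (P.cell i x) := by gcongr; exact hcell i x
            _ = (∫⁻ y in P.cell i x, g y ^ p ∂σ) * (σ (P.cell i x) ^ (p - 1) * σ (P.cell i x) /
                σ (P.cell i x) ^ p) := by simp only [div_eq_mul_inv]; ring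
            _ = _ := by
                have : σ (P.cell i x) ^ (p - 1) * σ (P.cell i x) = σ (P.cell i x) ^ p := by
                  conv_lhs => enter [2]; rw [← ENNReal.rpow_one (σ (P.cell i x))]
                  rw [← ENNReal.rpow_add_of_nonneg _ _ hp1.le zero_le_one]
                  congr 1; ring
                rw [this, ENNReal.div_self, mul_one]
                · simp [hσ i x, hp0.le]
                · exact ENNReal.rpow_ne_top_of_nonneg hp0.le (hσ' i x)
      _ = ∫⁻ x, g x ^ p ∂σ := by
          rw [lintegral_one, withDensity_apply _ MeasurableSet.univ, Measure.restrict_univ]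
  have hpq := Real.HolderConjugate.conjExponent hp
  have hq0 : 0 < p.conjExponent := hpq.symm.pos
  have hmain : I ≤ ENNReal.ofReal (p / (p - 1)) *
      ((∫⁻ x, g x ^ p ∂σ) ^ (1 / p) * I ^ (1 / p.conjExponent)) := by
    have h1 := mul_lintegral_rpow_partialSups_le hF hσ hp n
    have h2 : ∫⁻ x, G x ^ (p - 1) ∂F ≤
        (∫⁻ x, g x ^ p ∂σ) ^ (1 / p) * I ^ (1 / p.conjExponent) := by
      rw [hFdef, lintegral_withDensity_eq_lintegral_mul₀ hg (hGm.pow_const _).aemeasurable]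
      refine (ENNReal.lintegral_mul_le_Lp_mul_Lq σ hpq hg
        (hGm.pow_const _).aemeasurable).trans (le_of_eq ?_)
      congr 3
      ext x
      rw [← ENNReal.rpow_mul, Real.conjExponent]
      congr 1; field_simp
    have h3 : ENNReal.ofReal (p - 1) * I ≤ ENNReal.ofReal p *
        ((∫⁻ x, g x ^ p ∂σ) ^ (1 / p) * I ^ (1 / p.conjExponent)) := h1.trans (by gcongr)
    rw [ENNReal.ofReal_div_of_pos hp1, div_eq_mul_inv, mul_right_comm, ← div_eq_mul_inv,
      ENNReal.le_div_iff_mul_le (by simp [hp]) (by simp), mul_comm]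
    exact h3
  rcases eq_or_ne I 0 with h0 | h0
  · rw [h0]; exact zero_le
  have hI' : I ^ (1 / p) ≤ ENNReal.ofReal (p / (p - 1)) * (∫⁻ x, g x ^ p ∂σ) ^ (1 / p) := by
    have hs : I = I ^ (1 / p) * I ^ (1 / p.conjExponent) := by
      rw [← ENNReal.rpow_add _ _ h0 hIfin, one_div, one_div, hpq.inv_add_inv_eq_one,
        ENNReal.rpow_one]
    have hz : I ^ (1 / p.conjExponent) ≠ 0 := by
      simp [h0, hIfin]
    have ht : I ^ (1 / p.conjExponent) ≠ ∞ :=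
      ENNReal.rpow_ne_top_of_nonneg (by positivity) hIfin
    rw [← mul_assoc] at hmain
    conv_lhs at hmain => rw [hs]
    exact (ENNReal.mul_le_mul_iff_left hz ht).1 hmain
  calc I = (I ^ (1 / p)) ^ p := by
        rw [← ENNReal.rpow_mul, one_div_mul_cancel hp0.ne', ENNReal.rpow_one]
    _ ≤ (ENNReal.ofReal (p / (p - 1)) * (∫⁻ x, g x ^ p ∂σ) ^ (1 / p)) ^ p := by gcongr
    _ = _ := by
        rw [ENNReal.mul_rpow_of_nonneg _ _ hp0.le, ← ENNReal.rpow_mul,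
          one_div_mul_cancel hp0.ne', ENNReal.rpow_one]

end PartitionFiltration

/-! ### Stopping times for sequences that double. -/

/-- The last value at which the sequence `f` more than doubled its last recorded value. -/
noncomputable def stoppingValue (f : ℕ → ℝ≥0∞) : ℕ → ℝ≥0∞
  | 0 => f 0
  | n + 1 => if 2 * stoppingValue f n < f (n + 1) then f (n + 1) else stoppingValue f n

/-- The indices at which a new value is recorded. -/
def IsStoppingIndex (f : ℕ → ℝ≥0∞) : ℕ → Prop
  | 0 => True
  | n + 1 => 2 * stoppingValue f n < f (n + 1)

section stopping
variable (f : ℕ → ℝ≥0∞)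

lemma stoppingValue_eq_of_isStoppingIndex {n : ℕ} (h : IsStoppingIndex f n) :
    stoppingValue f n = f n := by
  cases n with
  | zero => rfl
  | succ n => exact if_pos h

lemma stoppingValue_succ_of_not {n : ℕ} (h : ¬IsStoppingIndex f (n + 1)) :
    stoppingValue f (n + 1) = stoppingValue f n := if_neg h

lemma le_two_mul_self (a : ℝ≥0∞) : a ≤ 2 * a := by
  rw [two_mul]; exact le_self_add

lemma le_two_mul_stoppingValue (n : ℕ) : f n ≤ 2 * stoppingValue f n := by
  by_cases h : IsStoppingIndex f n
  · rw [stoppingValue_eq_of_isStoppingIndex f h]; exact le_two_mul_self _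
  · cases n with
    | zero => exact absurd trivial h
    | succ n =>
      rw [stoppingValue_succ_of_not f h]
      exact not_lt.1 h

lemma monotone_stoppingValue : Monotone (stoppingValue f) := by
  refine monotone_nat_of_le_succ fun n => ?_
  by_cases h : IsStoppingIndex f (n + 1)
  · rw [stoppingValue_eq_of_isStoppingIndex f h]
    exact (le_two_mul_self _).trans (le_of_lt h)
  · rw [stoppingValue_succ_of_not f h]

lemma partialSups_le_two_mul_stoppingValue (n : ℕ) :
    partialSups f n ≤ 2 * stoppingValue f n := by
  refine partialSups_le _ _ _ fun i hi => (le_two_mul_stoppingValue f i).trans ?_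
  gcongr
  exact monotone_stoppingValue f hi

open Classical in
-- The recorded value is the value of `f` at the last stopping index, hence one of the summands.
lemma stoppingValue_rpow_le_sum (p : ℝ) (n : ℕ) :
    stoppingValue f n ^ p ≤
      ∑ j ∈ Finset.range (n + 1), if IsStoppingIndex f j then f j ^ p else 0 := by
  induction n with
  | zero => simp [IsStoppingIndex, stoppingValue]
  | succ n ih =>
    by_cases h : IsStoppingIndex f (n + 1)
    · rw [stoppingValue_eq_of_isStoppingIndex f h, Finset.sum_range_succ, if_pos h]
      exact le_add_self
    · rw [stoppingValue_succ_of_not f h, Finset.sum_range_succ]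
      exact ih.trans le_self_add

open Classical in
-- At a stopping index the quotient of `f` by the recorded value drops from at least `2` to at most
-- `1`, and this drop pays for the indicator. Summed over generations it gives the packing
-- condition.
lemma indicator_add_mul_inv_stoppingValue_succ_le (n : ℕ) :
    (if IsStoppingIndex f (n + 1) then (1 : ℝ≥0∞) else 0) +
      f (n + 1) * (stoppingValue f (n + 1))⁻¹ ≤ f (n + 1) * (stoppingValue f n)⁻¹ := by
  by_cases h : IsStoppingIndex f (n + 1)
  · rw [if_pos h, stoppingValue_eq_of_isStoppingIndex f h]
    have h' : 2 * stoppingValue f n < f (n + 1) := h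
    calc 1 + f (n + 1) * (f (n + 1))⁻¹ ≤ 1 + 1 := by gcongr; exact ENNReal.mul_inv_le_one _
      _ = 2 := one_add_one_eq_two
      _ ≤ f (n + 1) / stoppingValue f n := by
        rw [ENNReal.le_div_iff_mul_le (Or.inr (ne_bot_of_gt h')) (Or.inl fun ht => ?_)]
        · exact h'.le
        · simp [ht] at h'
      _ = _ := div_eq_mul_inv _ _
  · rw [if_neg h, stoppingValue_succ_of_not f h, zero_add]

open Classical in
lemma indicator_add_mul_inv_stoppingValue_le (n : ℕ) :
    (if IsStoppingIndex f n then (1 : ℝ≥0∞) else 0) + f n * (stoppingValue f n)⁻¹ ≤ 2 := by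
  by_cases h : IsStoppingIndex f n
  · rw [if_pos h, stoppingValue_eq_of_isStoppingIndex f h, ← one_add_one_eq_two]
    gcongr
    exact ENNReal.mul_inv_le_one _
  · rw [if_neg h, zero_add, ← div_eq_mul_inv]
    exact ENNReal.div_le_of_le_mul (le_two_mul_stoppingValue f n)

end stopping

/-! ### Sparse stopping cells and the maximal theorem for one filtration. -/

namespace PartitionFiltration

variable {X ι : Type*} [MeasurableSpace X] [MeasurableSpace ι] {P : PartitionFiltration X ι}

lemma cellConst_stoppingValue {u : ℕ → X → ℝ≥0∞} (hu : ∀ j, P.CellConst j (u j)) (n : ℕ) :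
    P.CellConst n (fun x => stoppingValue (fun j => u j x) n) := by
  induction n with
  | zero => exact hu 0
  | succ n ih =>
    intro x y h
    have := ih x y (P.idx_eq_of_succ n x y h)
    simp only [stoppingValue] at this ⊢
    rw [this, hu (n + 1) x y h]

lemma cellConst_isStoppingIndex {u : ℕ → X → ℝ≥0∞} (hu : ∀ j, P.CellConst j (u j)) (n : ℕ) :
    P.CellConst n (fun x => IsStoppingIndex (fun j => u j x) n) := by
  cases n with
  | zero => exact fun _ _ _ => rfl
  | succ n =>
    intro x y h
    have := cellConst_stoppingValue hu n x y (P.idx_eq_of_succ n x y h)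
    simp only [IsStoppingIndex] at this ⊢
    rw [this, hu (n + 1) x y h]

/-- `(F/μ)^p ω = (F/σ)^p σ · (ω σ^{p-1} / μ^p)` on a cell, and the last factor is what the `A_p`
condition bounds. -/
lemma ratio_rpow_mul_le {F μ σ ω : Measure X} {p : ℝ} (hp : 1 < p)
    (hμ : ∀ n x, μ (P.cell n x) ≠ 0) (hμ' : ∀ n x, μ (P.cell n x) ≠ ∞)
    (hσ : ∀ n x, σ (P.cell n x) ≠ 0) (hσ' : ∀ n x, σ (P.cell n x) ≠ ∞) {a : ℝ≥0∞}
    (hA : ∀ n x, ω (P.cell n x) * σ (P.cell n x) ^ (p - 1) ≤ a * μ (P.cell n x) ^ p)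
    (n : ℕ) (x : X) :
    P.ratio F μ n x ^ p * ω (P.cell n x) ≤ a * (P.ratio F σ n x ^ p * σ (P.cell n x)) := by
  have hp0 : 0 < p := by linarith
  simp only [ratio, ENNReal.div_rpow_of_nonneg _ _ hp0.le]
  specialize hμ n x; specialize hμ' n x; specialize hσ n x; specialize hσ' n x; specialize hA n x
  set s := σ (P.cell n x)
  set m := μ (P.cell n x)
  have hs : s ^ p = s ^ (p - 1) * s := by
    conv_rhs => enter [2]; rw [← ENNReal.rpow_one s]
    rw [← ENNReal.rpow_add _ _ hσ hσ']; congr 1; ring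
  have hs0 : s ^ p ≠ 0 := by simp [hσ, hσ']
  have hst : s ^ p ≠ ∞ := ENNReal.rpow_ne_top_of_nonneg hp0.le hσ'
  have hm0 : m ^ p ≠ 0 := by simp [hμ, hμ']
  have hmt : m ^ p ≠ ∞ := ENNReal.rpow_ne_top_of_nonneg hp0.le hμ'
  calc F (P.cell n x) ^ p / m ^ p * ω (P.cell n x)
      = F (P.cell n x) ^ p / m ^ p * ω (P.cell n x) * (s ^ p / s ^ p) := by
        rw [ENNReal.div_self hs0 hst, mul_one]
    _ = F (P.cell n x) ^ p / s ^ p * (ω (P.cell n x) * s ^ (p - 1)) / m ^ p * s := by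
        rw [hs]; simp only [div_eq_mul_inv]; ring
    _ ≤ F (P.cell n x) ^ p / s ^ p * (a * m ^ p) / m ^ p * s := by gcongr
    _ = F (P.cell n x) ^ p / s ^ p * a * (m ^ p / m ^ p) * s := by
        simp only [div_eq_mul_inv]; ring
    _ = _ := by rw [ENNReal.div_self hm0 hmt]; ring

variable [MeasurableSingletonClass ι] [Countable ι]

/-- The stopping cells of the averages of `F` satisfy a Carleson packing condition with respect
to the underlying measure. -/
lemma sum_measure_stopping_inter_cell_le (F μ : Measure X) (hμ : ∀ n x, μ (P.cell n x) ≠ 0)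
    (hμ' : ∀ n x, μ (P.cell n x) ≠ ∞) {i n : ℕ} (hin : i ≤ n) (x : X) :
    ∑ j ∈ Finset.Icc i n, μ ({y | IsStoppingIndex (fun j => P.ratio F μ j y) j} ∩ P.cell i x) ≤
      2 * μ (P.cell i x) := by
  classical
  set f : ℕ → X → ℝ≥0∞ := fun j y => P.ratio F μ j y with hf
  have hfc : ∀ j, P.CellConst j (f j) := fun j => cellConst_ratio F μ j
  set m : ℕ → X → ℝ≥0∞ := fun j y => stoppingValue (fun j => f j y) j with hm
  have hmc : ∀ j, P.CellConst j (m j) := fun j => cellConst_stoppingValue hfc j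
  set A : ℕ → Set X := fun j => {y | IsStoppingIndex (fun j => f j y) j} with hA
  have hAm : ∀ j, MeasurableSet (A j) := fun j =>
    (cellConst_isStoppingIndex hfc j).measurable.setOf
  have hfm : ∀ j, Measurable (f j) := fun j => (hfc j).measurable
  have hmm : ∀ j, Measurable (m j) := fun j => (hmc j).measurable
  have hYm : ∀ j, Measurable (fun y => f j y * (m j y)⁻¹) := fun j => (hfm j).fun_mul (hmm j).inv
  set R := P.cell i x with hR
  have hRm : MeasurableSet R := measurableSet_cell i x
  have hAR : ∀ j, μ (A j ∩ R) = ∫⁻ y in R, (if y ∈ A j then 1 else 0) ∂μ := by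
    intro j
    rw [← Measure.restrict_apply (hAm j), ← lintegral_indicator_one (hAm j)]
    rfl
  -- The integral of `f k / m k` over `R` is a potential that pays for the stopping cells of the
  -- next generation. Since `m k` is constant on cells of generations `k` and `k + 1`, the integrals
  -- of `f (k + 1) / m k` and `f k / m k` are compared through the integral of `1 / m k` against
  -- `F`.
  have hstep : ∀ k, i ≤ k → μ (A (k + 1) ∩ R) + ∫⁻ y in R, f (k + 1) y * (m (k + 1) y)⁻¹ ∂μ ≤
      ∫⁻ y in R, f k y * (m k y)⁻¹ ∂μ := by
    intro k hk
    have hRc : P.CellConst k (fun y => y ∈ R) := (cellConst_mem_cell i x).mono hk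
    have hind : ∀ (j : ℕ) (u : X → ℝ≥0∞), k ≤ j → P.CellConst j u →
        P.CellConst j (R.indicator u) := by
      intro j u hj hu y z h
      have := hRc.mono hj y z h
      simp only [eq_iff_iff] at this
      simp only [Set.indicator, this, hu y z h]
    calc _ = ∫⁻ y in R, ((if y ∈ A (k + 1) then 1 else 0) + f (k + 1) y * (m (k + 1) y)⁻¹) ∂μ := by
          rw [hAR, lintegral_add_right _ (hYm _)]
      _ ≤ ∫⁻ y in R, f (k + 1) y * (m k y)⁻¹ ∂μ :=
          lintegral_mono fun y => indicator_add_mul_inv_stoppingValue_succ_le (fun j => f j y) k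
      _ = ∫⁻ y, R.indicator (fun y => f (k + 1) y * (m k y)⁻¹) y ∂μ :=
          (lintegral_indicator hRm _).symm
      _ ≤ ∫⁻ y, R.indicator (fun y => (m k y)⁻¹) y ∂F := by
          have h1 : P.CellConst (k + 1) (fun y => (m k y)⁻¹) := 
            ((hmc k).comp _).mono (Nat.le_succ k)
          refine lintegral_le_of_cell (hind (k + 1) _ (Nat.le_succ k) ((hfc (k + 1)).mul h1))
            (hind (k + 1) _ (Nat.le_succ k) h1) fun y => ?_
          simp only [Set.indicator]
          split_ifs
          · rw [mul_right_comm, mul_comm]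
            gcongr
            rw [mul_comm]
            exact ENNReal.mul_div_le
          · simp
      _ ≤ ∫⁻ y, R.indicator (fun y => f k y * (m k y)⁻¹) y ∂μ := by
          have h1 : P.CellConst k (fun y => (m k y)⁻¹) := (hmc k).comp _
          refine lintegral_le_of_cell (hind k _ le_rfl h1)
            (hind k _ le_rfl ((hfc k).mul h1)) fun y => ?_
          simp only [Set.indicator]
          split_ifs
          · rw [mul_right_comm, mul_comm]
            gcongr
            rw [hf]
            simp only [ratio]
            rw [ENNReal.div_mul_cancel (hμ k y) (hμ' k y)]
          · simp
      _ = _ := lintegral_indicator hRm _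
  have hsum : ∀ n, i ≤ n → ∑ j ∈ Finset.Icc i n, μ (A j ∩ R) + ∫⁻ y in R, f n y * (m n y)⁻¹ ∂μ ≤
      2 * μ R := by
    intro n hn
    induction n, hn using Nat.le_induction with
    | base =>
      rw [Finset.Icc_self, Finset.sum_singleton, hAR,
        ← lintegral_add_right _ (hYm _)]
      refine (lintegral_mono fun y =>
        indicator_add_mul_inv_stoppingValue_le (fun j => f j y) i).trans (le_of_eq ?_)
      rw [setLIntegral_const]
    | succ n hn ih =>
      rw [← Finset.insert_Icc_right_eq_Icc_add_one (by omega), Finset.sum_insert (by simp)]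
      refine le_trans ?_ ih
      rw [add_right_comm, add_comm]
      gcongr
      exact hstep n hn
  exact le_self_add.trans (hsum n hin)

/-- A bound for the integral of the truncated maximal function of `σ` on cells gives a Carleson
packing condition with respect to `σ`. -/
lemma sum_measure_stopping_inter_cell_le_of_maximal (F μ σ : Measure X)
    (hμ : ∀ n x, μ (P.cell n x) ≠ 0) (hμ' : ∀ n x, μ (P.cell n x) ≠ ∞) {K : ℝ≥0∞} {n : ℕ}
    (hK : ∀ i ≤ n, ∀ x, ∫⁻ y in P.cell i x, (Finset.Icc i n).sup (fun l => P.ratio σ μ l y) ∂μ ≤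
      K * σ (P.cell i x)) {i : ℕ} (hin : i ≤ n) (x : X) :
    ∑ j ∈ Finset.Icc i n, σ ({y | IsStoppingIndex (fun j => P.ratio F μ j y) j} ∩ P.cell i x) ≤
      2 * K * σ (P.cell i x) := by
  classical
  set A : ℕ → Set X := fun j => {y | IsStoppingIndex (fun j => P.ratio F μ j y) j} with hA
  have hAc : ∀ j, P.CellConst j (fun x => x ∈ A j) :=
    fun j => cellConst_isStoppingIndex (fun j => cellConst_ratio F μ j) j
  have hAm : ∀ j, MeasurableSet (A j) := fun j => (hAc j).measurable.setOf
  set R := P.cell i x with hR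
  have hRm : MeasurableSet R := measurableSet_cell i x
  -- The truncated maximal function of `σ` localized to `R`; it vanishes for `j < i`, where the
  -- supremum is over an empty set. Each stopping cell `C` of generation `j` in `R` has `σ(C) ≤ v j
  -- · μ(C)`, so packing for `μ` with constant `2` and Carleson embedding bound the `σ`-mass.
  set v : ℕ → X → ℝ≥0∞ := fun j => R.indicator
    (fun y => (Finset.Icc i j).sup (fun l => P.ratio σ μ l y)) with hv
  have hvc : ∀ j, P.CellConst j (v j) := by
    intro j y z h
    rcases lt_or_ge j i with hj | hj
    · simp only [hv, Finset.Icc_eq_empty_of_lt hj, Finset.sup_empty]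
      simp [Set.indicator]
    · have h1 := (cellConst_mem_cell i x).mono hj y z h
      simp only [eq_iff_iff] at h1
      simp only [hv, hR, Set.indicator, h1]
      congr 1
      refine Finset.sup_congr rfl fun l hl => ?_
      exact (cellConst_ratio σ μ l).mono (Finset.mem_Icc.1 hl).2 y z h
  have hvmono : ∀ y, Monotone (fun j => v j y) := by
    intro y j k hjk
    refine Set.indicator_le_indicator ?_
    exact Finset.sup_mono (Finset.Icc_subset_Icc_right hjk)
  have hcar := sum_setLIntegral_le_of_carleson (P := P) hAc (n := n) (σ := μ) (Λ := 2)
    (fun i hi x => sum_measure_stopping_inter_cell_le F μ hμ hμ' hi x) hvc hvmono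
  calc ∑ j ∈ Finset.Icc i n, σ (A j ∩ R)
      ≤ ∑ j ∈ Finset.Icc i n, ∫⁻ x in A j, v j x ∂μ := by
        refine Finset.sum_le_sum fun j hj => ?_
        have hij := (Finset.mem_Icc.1 hj).1
        have hRc : P.CellConst j (fun y => y ∈ R) := (cellConst_mem_cell i x).mono hij
        rw [← lintegral_indicator_one ((hAm j).inter hRm), ← lintegral_indicator (hAm j)]
        refine lintegral_le_of_cell (P := P) (n := j) (fun y z h => ?_) (fun y z h => ?_) fun y => ?_
        · have h1 := hRc y z h
          have h2 := hAc j y z h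
          simp only [eq_iff_iff] at h1 h2
          simp only [Set.indicator, Set.mem_inter_iff, h1, h2, Pi.one_apply]
        · have h2 := hAc j y z h
          simp only [eq_iff_iff] at h2
          simp only [Set.indicator_apply (A j), h2, hvc j y z h]
        · by_cases hyA : y ∈ A j
          · by_cases hyR : y ∈ R
            · simp only [Set.indicator_of_mem (Set.mem_inter hyA hyR), Pi.one_apply, one_mul,
                Set.indicator_of_mem hyA, hv, Set.indicator_of_mem hyR]
              calc σ (P.cell j y) = P.ratio σ μ j y * μ (P.cell j y) := by
                    rw [ratio, ENNReal.div_mul_cancel (hμ j y) (hμ' j y)]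
                _ ≤ _ := by
                    gcongr
                    exact Finset.le_sup (f := fun l => P.ratio σ μ l y)
                      (Finset.mem_Icc.2 ⟨hij, le_rfl⟩)
            · rw [Set.indicator_of_notMem (fun h => hyR h.2), zero_mul]; exact zero_le
          · rw [Set.indicator_of_notMem (fun h => hyA h.1), zero_mul]; exact zero_le
    _ ≤ ∑ j ∈ Finset.range (n + 1), ∫⁻ x in A j, v j x ∂μ := by
        refine Finset.sum_le_sum_of_subset fun j hj => ?_
        simp only [Finset.mem_Icc, Finset.mem_range] at hj ⊢
        omega
    _ ≤ 2 * ∫⁻ x, v n x ∂μ := hcar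
    _ ≤ 2 * K * σ R := by
        rw [mul_assoc, hv, lintegral_indicator hRm]
        gcongr
        exact hK i hin x

/-- The maximal theorem with the mixed bound, for one filtration. -/
theorem lintegral_rpow_partialSups_ratio_le {μ σ ω : Measure X} {p : ℝ} (hp : 1 < p)
    (hμ : ∀ n x, μ (P.cell n x) ≠ 0) (hμ' : ∀ n x, μ (P.cell n x) ≠ ∞)
    (hσ : ∀ n x, σ (P.cell n x) ≠ 0) (hσ' : ∀ n x, σ (P.cell n x) ≠ ∞) {a K : ℝ≥0∞} {n : ℕ}
    (hA : ∀ n x, ω (P.cell n x) * σ (P.cell n x) ^ (p - 1) ≤ a * μ (P.cell n x) ^ p)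
    (hK : ∀ i ≤ n, ∀ x, ∫⁻ y in P.cell i x, (Finset.Icc i n).sup (fun l => P.ratio σ μ l y) ∂μ ≤
      K * σ (P.cell i x)) {g : X → ℝ≥0∞} (hg : AEMeasurable g σ) :
    ∫⁻ x, partialSups (fun j => P.ratio (σ.withDensity g) μ j x) n ^ p ∂ω ≤
      2 ^ p * (a * (2 * K) * (ENNReal.ofReal (p / (p - 1)) ^ p * ∫⁻ x, g x ^ p ∂σ)) := by
  classical
  have hp0 : 0 < p := by linarith
  set F := σ.withDensity g
  set A : ℕ → Set X := fun j => {y | IsStoppingIndex (fun j => P.ratio F μ j y) j} with hA'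
  have hAc : ∀ j, P.CellConst j (fun x => x ∈ A j) :=
    fun j => cellConst_isStoppingIndex (fun j => cellConst_ratio F μ j) j
  have hAm : ∀ j, MeasurableSet (A j) := fun j => (hAc j).measurable.setOf
  have hind : ∀ (j : ℕ) (u : X → ℝ≥0∞), P.CellConst j u → P.CellConst j ((A j).indicator u) := by
    intro j u hu y z h
    have := hAc j y z h
    simp only [eq_iff_iff] at this
    simp only [Set.indicator, this, hu y z h]
  have hrp : ∀ (ν : Measure X) j, P.CellConst j (fun x => P.ratio F ν j x ^ p) :=
    fun ν j => (cellConst_ratio (P := P) F ν j).comp (· ^ p)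
  -- On stopping cells the `σ`-average is replaced by its running maximum: monotonicity in `j` is
  -- what Carleson embedding needs, and the final term is a Doob maximal function.
  set v : ℕ → X → ℝ≥0∞ := fun j x => partialSups (fun j => P.ratio F σ j x) j ^ p with hv
  have hvc : ∀ j, P.CellConst j (v j) := fun j x y h => by
    rw [hv]
    simp only [cellConst_partialSups (fun j => cellConst_ratio F σ j) j x y h]
  calc ∫⁻ x, partialSups (fun j => P.ratio F μ j x) n ^ p ∂ω
      ≤ ∫⁻ x, 2 ^ p * ∑ j ∈ Finset.range (n + 1),
          (A j).indicator (fun x => P.ratio F μ j x ^ p) x ∂ω := by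
        refine lintegral_mono fun x => ?_
        calc partialSups (fun j => P.ratio F μ j x) n ^ p
            ≤ (2 * stoppingValue (fun j => P.ratio F μ j x) n) ^ p := by
              gcongr
              exact partialSups_le_two_mul_stoppingValue _ n
          _ = 2 ^ p * stoppingValue (fun j => P.ratio F μ j x) n ^ p :=
              ENNReal.mul_rpow_of_nonneg _ _ hp0.le
          _ ≤ _ := by
              gcongr
              exact stoppingValue_rpow_le_sum _ p n
    _ = 2 ^ p * ∑ j ∈ Finset.range (n + 1),
          ∫⁻ x, (A j).indicator (fun x => P.ratio F μ j x ^ p) x ∂ω := by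
        rw [← lintegral_finsetSum _ fun j _ => (hind j _ (hrp μ j)).measurable,
          lintegral_const_mul _
          (Finset.measurable_fun_sum _ fun j _ => (hind j _ (hrp μ j)).measurable)]
    _ ≤ 2 ^ p * ∑ j ∈ Finset.range (n + 1), a * ∫⁻ x in A j, v j x ∂σ := by
        refine mul_le_mul_right (Finset.sum_le_sum fun j hj => ?_) _
        rw [← lintegral_indicator (hAm j),
          ← lintegral_const_mul _ ((hvc j).measurable.indicator (hAm j))]
        refine lintegral_le_of_cell (hind j _ (hrp μ j))
          ((hind j _ (hvc j)).comp _) fun x => ?_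
        simp only [Set.indicator]
        split_ifs
        · refine (ratio_rpow_mul_le hp hμ hμ' hσ hσ' hA j x).trans ?_
          rw [mul_assoc]
          gcongr
          exact ENNReal.rpow_le_rpow (le_partialSups (fun j => P.ratio F σ j x) j) hp0.le
        · simp
    _ = 2 ^ p * (a * ∑ j ∈ Finset.range (n + 1), ∫⁻ x in A j, v j x ∂σ) := by
        rw [← Finset.mul_sum]
    _ ≤ 2 ^ p * (a * (2 * K * ∫⁻ x, v n x ∂σ)) := by
        gcongr
        refine sum_setLIntegral_le_of_carleson hAc (fun i hi x =>
          sum_measure_stopping_inter_cell_le_of_maximal F μ σ hμ hμ' hK hi x) hvc fun x j k hjk => ?_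
        exact ENNReal.rpow_le_rpow ((partialSups _).monotone hjk) hp0.le
    _ ≤ _ := by
        rw [mul_assoc a]
        gcongr
        exact lintegral_rpow_partialSups_le hσ hσ' hp hg n

/-- The maximal theorem with the bound that uses the `A_p` constant only, for one filtration. -/
theorem lintegral_rpow_partialSups_ratio_le_of_density {μ σ ω : Measure X} {p : ℝ} (hp : 1 < p)
    (hμ : ∀ n x, μ (P.cell n x) ≠ 0) (hμ' : ∀ n x, μ (P.cell n x) ≠ ∞)
    (hσ : ∀ n x, σ (P.cell n x) ≠ 0) (hσ' : ∀ n x, σ (P.cell n x) ≠ ∞)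
    (hω : ∀ n x, ω (P.cell n x) ≠ 0) (hω' : ∀ n x, ω (P.cell n x) ≠ ∞) {a : ℝ≥0∞}
    (hA : ∀ n x, ω (P.cell n x) * σ (P.cell n x) ^ (p - 1) ≤ a * μ (P.cell n x) ^ p)
    {h : X → ℝ≥0∞} (hh : AEMeasurable h ω) (hμh : μ = ω.withDensity h)
    (hσh : σ = ω.withDensity fun x => h x ^ (p / (p - 1)))
    {g : X → ℝ≥0∞} (hg : AEMeasurable g σ) (n : ℕ) :
    ∫⁻ x, partialSups (fun j => P.ratio (σ.withDensity g) μ j x) n ^ p ∂ω ≤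
      a ^ (p / (p - 1)) * (ENNReal.ofReal p ^ (p / (p - 1)) *
        (ENNReal.ofReal (p / (p - 1)) ^ p * ∫⁻ x, g x ^ p ∂σ)) := by
  have hp0 : 0 < p := by linarith
  have hp1 : 0 < p - 1 := by linarith
  set q := p / (p - 1) with hq
  have hq1 : 1 < q := by rw [hq, lt_div_iff₀ hp1]; linarith
  have hqq : q / (q - 1) = p := by rw [hq]; field_simp; ring
  set F := σ.withDensity g
  set G : X → ℝ≥0∞ := fun x => partialSups (fun j => P.ratio F σ j x) n with hG
  have hGm : Measurable G := measurable_partialSups_ratio F σ n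
  -- Two maximal functions are composed: `G` for `σ`, then that of `h G^{p-1}` for `ω`, where `h =
  -- dμ/dω`.
  set H := ω.withDensity (fun x => h x * G x ^ (p - 1)) with hH
  have hHm : AEMeasurable (fun x => h x * G x ^ (p - 1)) ω :=
    hh.mul (hGm.pow_const _).aemeasurable
  -- On the cell of generation `j` the function `G` is at least the `σ`-average of that cell. Hence
  -- `H(cell) ≥ (F/σ)^{p-1} μ(cell)`, and the `A_p` condition exchanges `σ^{p-1}` for `μ^{p-1}`.
  have hpt : ∀ x, ∀ j ≤ n, P.ratio F μ j x ^ (p - 1) ≤ a * P.ratio H ω j x := by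
    intro x j hj
    have hHge : P.ratio F σ j x ^ (p - 1) * μ (P.cell j x) ≤ H (P.cell j x) := by
      rw [hH, withDensity_apply _ (measurableSet_cell j x), hμh,
        withDensity_apply _ (measurableSet_cell j x), ← lintegral_const_mul'' _ hh.restrict]
      refine setLIntegral_mono_ae hHm.restrict (Filter.Eventually.of_forall fun y hy => ?_)
      rw [mul_comm]
      gcongr
      rw [cellConst_ratio F σ j x y (mem_cell.1 hy).symm]
      exact (le_partialSups (fun j => P.ratio F σ j y) j).trans ((partialSups _).monotone hj)
    simp only [ratio] at hHge ⊢
    rw [← mul_div_assoc, ENNReal.le_div_iff_mul_le (Or.inl (hω j x)) (Or.inl (hω' j x))]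
    refine le_trans ?_ (mul_le_mul_right hHge a)
    specialize hμ j x; specialize hμ' j x; specialize hσ j x; specialize hσ' j x
    specialize hA j x
    set s := σ (P.cell j x)
    set m := μ (P.cell j x)
    have hs0 : s ^ (p - 1) ≠ 0 := by simp [hσ, hσ']
    have hst : s ^ (p - 1) ≠ ∞ := ENNReal.rpow_ne_top_of_nonneg hp1.le hσ'
    have hm0 : m ^ (p - 1) ≠ 0 := by simp [hμ, hμ']
    have hmt : m ^ (p - 1) ≠ ∞ := ENNReal.rpow_ne_top_of_nonneg hp1.le hμ'
    have hm : m ^ p = m ^ (p - 1) * m := by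
      conv_rhs => enter [2]; rw [← ENNReal.rpow_one m]
      rw [← ENNReal.rpow_add _ _ hμ hμ']; congr 1; ring
    rw [ENNReal.div_rpow_of_nonneg _ _ hp1.le, ENNReal.div_rpow_of_nonneg _ _ hp1.le]
    set c := F (P.cell j x) ^ (p - 1)
    calc c / m ^ (p - 1) * ω (P.cell j x)
        = c / m ^ (p - 1) * ω (P.cell j x) * (s ^ (p - 1) / s ^ (p - 1)) := by
          rw [ENNReal.div_self hs0 hst, mul_one]
      _ = c / s ^ (p - 1) * (ω (P.cell j x) * s ^ (p - 1)) / m ^ (p - 1) := by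
          simp only [div_eq_mul_inv]; ring
      _ ≤ c / s ^ (p - 1) * (a * m ^ p) / m ^ (p - 1) := by gcongr
      _ = c / s ^ (p - 1) * a * (m ^ (p - 1) / m ^ (p - 1)) * m := by
          rw [hm]; simp only [div_eq_mul_inv]; ring
      _ = _ := by rw [ENNReal.div_self hm0 hmt]; ring
  have hsup : ∀ x, partialSups (fun j => P.ratio F μ j x) n ^ p ≤
      a ^ q * partialSups (fun j => P.ratio H ω j x) n ^ q := by
    intro x
    rw [← ENNReal.mul_rpow_of_nonneg _ _ (by linarith)]
    have : partialSups (fun j => P.ratio F μ j x) n ≤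
        (a * partialSups (fun j => P.ratio H ω j x) n) ^ (1 / (p - 1)) := by
      refine partialSups_le _ _ _ fun j hj => ?_
      rw [one_div, ENNReal.le_rpow_inv_iff hp1]
      refine (hpt x j hj).trans ?_
      gcongr
      exact (le_partialSups (fun j => P.ratio H ω j x) j).trans ((partialSups _).monotone hj)
    calc _ ≤ ((a * partialSups (fun j => P.ratio H ω j x) n) ^ (1 / (p - 1))) ^ p := by gcongr
      _ = _ := by rw [← ENNReal.rpow_mul, hq]; congr 1; field_simp
  calc _ ≤ ∫⁻ x, a ^ q * partialSups (fun j => P.ratio H ω j x) n ^ q ∂ω := lintegral_mono hsup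
    _ = a ^ q * ∫⁻ x, partialSups (fun j => P.ratio H ω j x) n ^ q ∂ω :=
        lintegral_const_mul _ ((measurable_partialSups_ratio H ω n).pow_const q)
    _ ≤ a ^ q * (ENNReal.ofReal (q / (q - 1)) ^ q * ∫⁻ x, (h x * G x ^ (p - 1)) ^ q ∂ω) := by
        gcongr
        exact lintegral_rpow_partialSups_le hω hω' hq1 hHm n
    -- The exponents match: `(p-1) q = p` and `h^q dω = dσ`, so Doob for `ω` in `L^q` is followed by
    -- Doob for `σ` in `L^p`.
    _ = a ^ q * (ENNReal.ofReal p ^ q * ∫⁻ x, G x ^ p ∂σ) := by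
        rw [hqq, hσh, lintegral_withDensity_eq_lintegral_mul₀ (hh.pow_const _)
          (hGm.pow_const _).aemeasurable]
        congr 3
        ext x
        rw [ENNReal.mul_rpow_of_nonneg _ _ (by linarith), ← ENNReal.rpow_mul]
        simp only [Pi.mul_apply]
        congr 2
        rw [hq]; field_simp
    _ ≤ _ := by
        gcongr
        exact lintegral_rpow_partialSups_le hσ hσ' hp hg n

end PartitionFiltration

/-! ### Shifted dyadic grids and the passage from cells to cubes. -/

namespace Muckenhoupt

variable {d : ℕ}

/-- The maximal operator on functions with values in `[0, ∞]`. -/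
noncomputable def maxOp (u : (Fin d → ℝ) → ℝ≥0∞) (x : Fin d → ℝ) : ℝ≥0∞ :=
  ⨆ (Q : Cube d) (_ : x ∈ Q.set), ⨍⁻ y in Q.set, u y ∂volume

lemma laverage_le_maxOp (u : (Fin d → ℝ) → ℝ≥0∞) {Q : Cube d} {x : Fin d → ℝ} (hx : x ∈ Q.set) :
    ⨍⁻ y in Q.set, u y ∂volume ≤ maxOp u x :=
  le_iSup₂ (f := fun (Q : Cube d) (_ : x ∈ Q.set) => ⨍⁻ y in Q.set, u y ∂volume) Q hx

lemma maxOp_le {u : (Fin d → ℝ) → ℝ≥0∞} {x : Fin d → ℝ} {a : ℝ≥0∞}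
    (h : ∀ Q : Cube d, x ∈ Q.set → ⨍⁻ y in Q.set, u y ∂volume ≤ a) : maxOp u x ≤ a :=
  iSup₂_le h

lemma maxOp_congr {u v : (Fin d → ℝ) → ℝ≥0∞} (h : u =ᵐ[volume] v) : maxOp u = maxOp v := by
  ext x
  refine iSup_congr fun Q => iSup_congr fun _ => ?_
  exact laverage_congr (ae_restrict_of_ae h)

namespace Cube

variable (Q : Cube d)

lemma measurableSet_set : MeasurableSet Q.set := measurableSet_Icc

lemma isCompact_set : IsCompact Q.set := isCompact_Icc

lemma volume_set : volume Q.set = ENNReal.ofReal Q.side ^ d := by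
  rw [Cube.set, Real.volume_Icc_pi]
  simp

lemma volume_set_ne_zero : volume Q.set ≠ 0 := by
  rw [volume_set]
  exact pow_ne_zero _ (by simpa using Q.side_pos)

lemma volume_set_ne_top : volume Q.set ≠ ∞ := by
  rw [volume_set]
  exact ENNReal.pow_ne_top ENNReal.ofReal_ne_top

lemma mem_set {x : Fin d → ℝ} : x ∈ Q.set ↔ ∀ i, Q.corner i ≤ x i ∧ x i ≤ Q.corner i + Q.side := by
  simp only [Cube.set, Set.mem_Icc, Pi.le_def, forall_and]

lemma exists_superset_of_isBounded {s : Set (Fin d → ℝ)} (hs : Bornology.IsBounded s) :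
    ∃ Q : Cube d, s ⊆ Q.set := by
  obtain ⟨r, hr⟩ := hs.subset_closedBall 0
  refine ⟨⟨fun _ => -(|r| + 1), 2 * (|r| + 1), by positivity⟩, fun x hx => ?_⟩
  have h1 : ‖x‖ ≤ |r| := (by simpa using hr hx : ‖x‖ ≤ r).trans (le_abs_self r)
  rw [mem_set]
  intro i
  have h2 := (norm_le_pi_norm x i).trans h1
  rw [Real.norm_eq_abs, abs_le] at h2
  constructor <;> simp only <;> linarith

end Cube

lemma floor_eq_floor_of_floor_two_mul {a b : ℝ} (h : ⌊2 * a⌋ = ⌊2 * b⌋) : ⌊a⌋ = ⌊b⌋ := by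
  have key : ∀ {a b : ℝ}, ⌊2 * a⌋ = ⌊2 * b⌋ → ⌊a⌋ ≤ ⌊b⌋ := by
    intro a b h
    have h1 : 2 * ⌊a⌋ ≤ ⌊2 * a⌋ := by
      rw [Int.le_floor]; push_cast; linarith [Int.floor_le a]
    rw [h, Int.le_floor] at h1
    rw [Int.le_floor]
    push_cast at h1
    linarith
  exact le_antisymm (key h) (key h.symm)

/-- The coordinate in which the cells of generation `j` of a shifted dyadic grid of top scale `2 ^ N`
are the intervals between consecutive multiples of `2 ^ (-j)`. -/
noncomputable def gridCoord (N : ℕ) (s : Bool) (t : ℝ) : ℝ := t / 2 ^ N - if s then 1 / 3 else 0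

lemma measurable_gridCoord (N : ℕ) (s : Bool) : Measurable (gridCoord N s) := by
  unfold gridCoord; fun_prop

/-- The dyadic grid of top scale `2 ^ N`, shifted by `2 ^ N / 3` in the directions that `s` selects. -/
noncomputable def shiftedGrid (N : ℕ) (s : Fin d → Bool) :
    PartitionFiltration (Fin d → ℝ) (Fin d → ℤ) where
  idx j x i := ⌊2 ^ j * gridCoord N (s i) (x i)⌋
  measurable_idx j := measurable_pi_lambda _ fun i =>
    (((measurable_gridCoord N (s i)).comp (measurable_pi_apply i)).const_mul _).floor
  idx_eq_of_succ j x y h := by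
    funext i
    refine floor_eq_floor_of_floor_two_mul ?_
    have := congrFun h i
    simpa only [pow_succ', mul_assoc] using this

/-- The cells of a shifted grid are cubes up to null sets. -/
lemma exists_cube_of_cell (N : ℕ) (s : Fin d → Bool) (j : ℕ) (x : Fin d → ℝ) :
    ∃ Q : Cube d, Q.side = 2 ^ N / 2 ^ j ∧ (shiftedGrid N s).cell j x ⊆ Q.set ∧
      (shiftedGrid N s).cell j x =ᵐ[volume] Q.set := by
  have h2N : (0 : ℝ) < 2 ^ N := by positivity
  have h2j : (0 : ℝ) < 2 ^ j := by positivity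
  set Q : Cube d := ⟨fun i => (⌊2 ^ j * gridCoord N (s i) (x i)⌋ / 2 ^ j +
    if s i then 1 / 3 else 0) * 2 ^ N, 2 ^ N / 2 ^ j, by positivity⟩ with hQ
  have hcell : (shiftedGrid N s).cell j x =
      Set.pi Set.univ fun i => Set.Ico (Q.corner i) (Q.corner i + Q.side) := by
    ext y
    simp only [PartitionFiltration.mem_cell, shiftedGrid, Set.mem_pi, Set.mem_univ, true_imp_iff,
      Set.mem_Ico, funext_iff, hQ]
    refine forall_congr' fun i => ?_
    rw [Int.floor_eq_iff]
    set k := ⌊2 ^ j * gridCoord N (s i) (x i)⌋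
    set c : ℝ := if s i then 1 / 3 else 0
    have e : gridCoord N (s i) (y i) = y i / 2 ^ N - c := rfl
    rw [e]
    refine and_congr ?_ ?_
    · rw [← le_div_iff₀ h2N, ← div_le_iff₀' h2j, le_sub_iff_add_le]
    · rw [← lt_div_iff₀' h2j, sub_lt_iff_lt_add, div_lt_iff₀ h2N]
      have : ((k : ℝ) / 2 ^ j + c) * 2 ^ N + 2 ^ N / 2 ^ j = ((k + 1) / 2 ^ j + c) * 2 ^ N := by
        ring
      rw [this]
  refine ⟨Q, rfl, ?_, ?_⟩
  · rw [hcell]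
    intro y hy
    rw [Cube.mem_set]
    exact fun i => ⟨(hy i trivial).1, (hy i trivial).2.le⟩
  · rw [hcell]
    exact Measure.univ_pi_Ico_ae_eq_Icc

/-- One of two dyadic grids, shifted by a third, contains a given short interval in a cell. -/
lemma exists_shift_floor_eq {a δ : ℝ} {j : ℕ} (hδ : 3 * δ < 1) :
    ∃ s : Bool, ∀ t t' : ℝ, a ≤ t → t ≤ a + δ → a ≤ t' → t' ≤ a + δ →
      ⌊t - 2 ^ j * if s then 1 / 3 else 0⌋ = ⌊t' - 2 ^ j * if s then (1 / 3 : ℝ) else 0⌋ := by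
  by_contra! hcon
  have key : ∀ s : Bool, ∃ m : ℤ, a < m + 2 ^ j * (if s then (1 / 3 : ℝ) else 0) ∧
      m + 2 ^ j * (if s then (1 / 3 : ℝ) else 0) ≤ a + δ := by
    intro s
    have main : ∀ t t' : ℝ, a ≤ t → t' ≤ a + δ →
        ⌊t - 2 ^ j * if s then 1 / 3 else 0⌋ < ⌊t' - 2 ^ j * if s then (1 / 3 : ℝ) else 0⌋ →
        ∃ m : ℤ, a < m + 2 ^ j * (if s then (1 / 3 : ℝ) else 0) ∧
          m + 2 ^ j * (if s then (1 / 3 : ℝ) else 0) ≤ a + δ := by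
      intro t t' ht ht' hlt
      refine ⟨⌊t' - 2 ^ j * if s then (1 / 3 : ℝ) else 0⌋, ?_, ?_⟩
      · rw [Int.floor_lt] at hlt; linarith
      · linarith [Int.floor_le (t' - 2 ^ j * if s then (1 / 3 : ℝ) else 0)]
    obtain ⟨t, t', h1, h2, h3, h4, hne⟩ := hcon s
    rcases lt_or_gt_of_ne hne with h | h
    · exact main t t' h1 h4 h
    · exact main t' t h3 h2 h
  obtain ⟨m, hm1, hm2⟩ := key false
  obtain ⟨k, hk1, hk2⟩ := key true
  simp only [Bool.false_eq_true, if_false, if_true, mul_zero, add_zero] at hm1 hm2 hk1 hk2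
  -- If both grids cut the interval, the cut points `m` and `k + 2^j/3` differ by less than `1/3`.
  -- The integer `3(m-k) - 2^j` is then zero, although `3` does not divide `2^j`.
  have h1 : (3 * (m - k) - 2 ^ j : ℝ) < 1 := by linarith
  have h2 : (-1 : ℝ) < 3 * (m - k) - 2 ^ j := by linarith
  have h1' : 3 * (m - k) - 2 ^ j < (1 : ℤ) := by exact_mod_cast h1
  have h2' : (-1 : ℤ) < 3 * (m - k) - 2 ^ j := by exact_mod_cast h2
  have h3 : (3 : ℤ) ∣ 2 ^ j := ⟨m - k, by omega⟩
  have h4 := Int.Prime.dvd_pow' (p := 3) (by norm_num) h3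
  omega

/-- The shift is chosen separately in each coordinate; this is why `2^d` grids are used. -/
lemma exists_subset_cell (Q : Cube d) {x : Fin d → ℝ} (hx : x ∈ Q.set) {N j : ℕ}
    (h : 3 * Q.side < 2 ^ N / 2 ^ j) :
    ∃ s : Fin d → Bool, Q.set ⊆ (shiftedGrid N s).cell j x := by
  have h2N : (0 : ℝ) < 2 ^ N := by positivity
  have h2j : (0 : ℝ) < 2 ^ j := by positivity
  have hδ : 3 * (2 ^ j * (Q.side / 2 ^ N)) < 1 := by
    rw [lt_div_iff₀ h2j] at h
    rw [show 3 * (2 ^ j * (Q.side / 2 ^ N)) = 3 * Q.side * 2 ^ j / 2 ^ N by ring, div_lt_one h2N]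
    exact h
  choose s hs using fun i => exists_shift_floor_eq (a := 2 ^ j * (Q.corner i / 2 ^ N)) (j := j) hδ
  refine ⟨s, fun y hy => ?_⟩
  rw [PartitionFiltration.mem_cell]
  funext i
  rw [Cube.mem_set] at hx hy
  have := hs i (2 ^ j * (y i / 2 ^ N)) (2 ^ j * (x i / 2 ^ N)) (by gcongr; exact (hy i).1)
    (by rw [← mul_add, ← add_div]; gcongr; exact (hy i).2) (by gcongr; exact (hx i).1)
    (by rw [← mul_add, ← add_div]; gcongr; exact (hx i).2)
  simpa only [shiftedGrid, gridCoord, mul_sub] using this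

/-- Exactly one power `2^{n+1}` lies in `(3ℓ, 6ℓ]`. It is the side of generation `N - (n+1)`, which
lies in `[0, 2N]` once `N ≥ |n+1|`. -/
lemma exists_scale {ℓ : ℝ} (hℓ : 0 < ℓ) :
    ∃ N₀ : ℕ, ∀ N ≥ N₀, ∃ j ≤ 2 * N, 3 * ℓ < 2 ^ N / 2 ^ j ∧ (2 : ℝ) ^ N / 2 ^ j ≤ 6 * ℓ := by
  obtain ⟨n, hn1, hn2⟩ := exists_mem_Ico_zpow (x := 3 * ℓ) (y := (2 : ℝ)) (by positivity)
    one_lt_two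
  refine ⟨(n + 1).natAbs, fun N hN => ⟨(N - (n + 1)).toNat, by omega, ?_⟩⟩
  have : (2 : ℝ) ^ N / 2 ^ (N - (n + 1)).toNat = 2 ^ (n + 1) := by
    rw [← zpow_natCast, ← zpow_natCast, ← zpow_sub₀ two_ne_zero]
    congr 1
    omega
  rw [this]
  refine ⟨hn2, ?_⟩
  rw [zpow_add_one₀ two_ne_zero]
  linarith

variable (N : ℕ) (s : Fin d → Bool) (j : ℕ) (x : Fin d → ℝ)

lemma volume_cell : volume ((shiftedGrid N s).cell j x) = ENNReal.ofReal (2 ^ N / 2 ^ j) ^ d := by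
  obtain ⟨Q, hQ, -, hQe⟩ := exists_cube_of_cell N s j x
  rw [measure_congr hQe, Q.volume_set, hQ]

lemma volume_cell_ne_zero : volume ((shiftedGrid N s).cell j x) ≠ 0 := by
  obtain ⟨Q, -, -, hQe⟩ := exists_cube_of_cell N s j x
  rw [measure_congr hQe]
  exact Q.volume_set_ne_zero

lemma volume_cell_ne_top : volume ((shiftedGrid N s).cell j x) ≠ ∞ := by
  obtain ⟨Q, -, -, hQe⟩ := exists_cube_of_cell N s j x
  rw [measure_congr hQe]
  exact Q.volume_set_ne_top

omit N s j x

lemma laverage_le_ratio (u : (Fin d → ℝ) → ℝ≥0∞) (Q : Cube d) {x : Fin d → ℝ} {N j : ℕ}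
    {s : Fin d → Bool} (hsub : Q.set ⊆ (shiftedGrid N s).cell j x)
    (hside : (2 : ℝ) ^ N / 2 ^ j ≤ 6 * Q.side) :
    ⨍⁻ y in Q.set, u y ∂volume ≤
      6 ^ d * (shiftedGrid N s).ratio (volume.withDensity u) volume j x := by
  have hvol : volume ((shiftedGrid N s).cell j x) ≤ 6 ^ d * volume Q.set := by
    rw [volume_cell, Q.volume_set, ← mul_pow]
    gcongr
    refine (ENNReal.ofReal_le_ofReal hside).trans (le_of_eq ?_)
    rw [ENNReal.ofReal_mul (by norm_num)]
    norm_num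
  rw [setLAverage_eq, PartitionFiltration.ratio,
    withDensity_apply _ (PartitionFiltration.measurableSet_cell j x)]
  have h0 := volume_cell_ne_zero N s j x
  have ht := volume_cell_ne_top N s j x
  refine ENNReal.div_le_of_le_mul ?_
  calc ∫⁻ y in Q.set, u y ≤ ∫⁻ y in (shiftedGrid N s).cell j x, u y := lintegral_mono_set hsub
    _ = (∫⁻ y in (shiftedGrid N s).cell j x, u y) / volume ((shiftedGrid N s).cell j x) *
        volume ((shiftedGrid N s).cell j x) := (ENNReal.div_mul_cancel h0 ht).symm
    _ ≤ (∫⁻ y in (shiftedGrid N s).cell j x, u y) / volume ((shiftedGrid N s).cell j x) *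
        (6 ^ d * volume Q.set) := by gcongr
    _ = _ := by ring

/-- Bounds for the maximal operators of all shifted grids give a bound for the maximal operator. -/
theorem lintegral_rpow_maxOp_le {ω : Measure (Fin d → ℝ)} {p : ℝ} (hp : 0 < p)
    {u : (Fin d → ℝ) → ℝ≥0∞} {B : ℝ≥0∞}
    (hB : ∀ (N : ℕ) (s : Fin d → Bool) (n : ℕ), ∫⁻ x, partialSups
      (fun j => (shiftedGrid N s).ratio (volume.withDensity u) volume j x) n ^ p ∂ω ≤ B) :
    ∫⁻ x, maxOp u x ^ p ∂ω ≤ (6 ^ d) ^ p * (2 ^ d * B) := by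
  set V : ℕ → (Fin d → ℝ) → ℝ≥0∞ := fun N x => (6 ^ d) ^ p * ∑ s : Fin d → Bool,
    partialSups (fun j => (shiftedGrid N s).ratio (volume.withDensity u) volume j x) (2 * N) ^ p
    with hV
  have hm : ∀ N s, Measurable fun x => partialSups (fun j =>
      (shiftedGrid (d := d) N s).ratio (volume.withDensity u) volume j x) (2 * N) ^ p :=
    fun N s => (PartitionFiltration.measurable_partialSups_ratio _ _ _).pow_const p
  have hVm : ∀ N, Measurable (V N) := fun N =>
    (Finset.measurable_fun_sum _ fun s _ => hm N s).const_mul _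
  -- A cube is captured by the grids of top scale `2^N` only when `N` is large, depending on the
  -- cube. The bound therefore holds for the lower limit, and Fatou's lemma applies. The sum over
  -- `s` avoids selecting the right shift.
  have hpt : ∀ x, maxOp u x ^ p ≤ Filter.liminf (fun N => V N x) Filter.atTop := by
    intro x
    rw [← ENNReal.le_rpow_inv_iff hp]
    refine maxOp_le fun Q hQ => ?_
    rw [ENNReal.le_rpow_inv_iff hp]
    refine Filter.le_liminf_of_le (by isBoundedDefault) ?_
    obtain ⟨N₀, hN₀⟩ := exists_scale Q.side_pos
    filter_upwards [Filter.eventually_ge_atTop N₀] with N hN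
    obtain ⟨j, hj, h3, h6⟩ := hN₀ N hN
    obtain ⟨s, hs⟩ := exists_subset_cell Q hQ h3
    calc (⨍⁻ y in Q.set, u y ∂volume) ^ p
        ≤ (6 ^ d * (shiftedGrid N s).ratio (volume.withDensity u) volume j x) ^ p := by
          gcongr
          exact laverage_le_ratio u Q hs h6
      _ ≤ (6 ^ d * partialSups (fun j =>
            (shiftedGrid N s).ratio (volume.withDensity u) volume j x) (2 * N)) ^ p := by
          gcongr
          exact le_partialSups_of_le (fun j =>
            (shiftedGrid N s).ratio (volume.withDensity u) volume j x) hj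
      _ ≤ V N x := by
          rw [ENNReal.mul_rpow_of_nonneg _ _ hp.le, hV]
          simp only
          gcongr
          exact Finset.single_le_sum (f := fun s => partialSups (fun j =>
            (shiftedGrid N s).ratio (volume.withDensity u) volume j x) (2 * N) ^ p)
            (fun _ _ => zero_le) (Finset.mem_univ s)
  calc ∫⁻ x, maxOp u x ^ p ∂ω ≤ ∫⁻ x, Filter.liminf (fun N => V N x) Filter.atTop ∂ω :=
        lintegral_mono hpt
    _ ≤ Filter.liminf (fun N => ∫⁻ x, V N x ∂ω) Filter.atTop := lintegral_liminf_le hVm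
    _ ≤ (6 ^ d) ^ p * (2 ^ d * B) := by
        refine Filter.liminf_le_of_le (by isBoundedDefault) fun b hb => ?_
        obtain ⟨N, hN⟩ := hb.exists
        refine hN.trans ?_
        rw [hV]
        simp only
        rw [lintegral_const_mul _ (Finset.measurable_fun_sum _ fun s _ => hm N s),
          lintegral_finsetSum _ fun s _ => hm N s]
        gcongr
        refine (Finset.sum_le_card_nsmul _ _ B fun s _ => hB N s (2 * N)).trans (le_of_eq ?_)
        simp

end Muckenhoupt

/-! ### Weights and the maximal theorem on `L^p(w)`. -/

namespace Muckenhoupt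

variable {d : ℕ}

lemma weightMeasure_set (w : (Fin d → ℝ) → ℝ) (Q : Cube d) :
    weightMeasure w Q.set = ∫⁻ x in Q.set, ENNReal.ofReal (w x) :=
  withDensity_apply _ Q.measurableSet_set

lemma setLIntegral_ne_zero {u : (Fin d → ℝ) → ℝ≥0∞} (hu : AEMeasurable u volume)
    (hpos : ∀ᵐ x, u x ≠ 0) (Q : Cube d) : ∫⁻ x in Q.set, u x ≠ 0 := by
  rw [Ne, lintegral_eq_zero_iff' hu.restrict]
  intro h
  have h2 := ae_restrict_of_ae (s := Q.set) hpos
  have h3 : ∀ᵐ x ∂(volume.restrict Q.set), False := by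
    filter_upwards [h, h2] with x hx hx'
    exact hx' hx
  rw [ae_iff] at h3
  simp only [not_false_eq_true, Set.ofPred_true, Measure.restrict_apply_univ] at h3
  exact Q.volume_set_ne_zero h3

/-- Local integrability can be tested on cubes. -/
lemma isWeight_of_setLIntegral_ne_top {w : (Fin d → ℝ) → ℝ} (hm : AEStronglyMeasurable w volume)
    (hpos : ∀ᵐ x, 0 < w x) (hfin : ∀ Q : Cube d, ∫⁻ x in Q.set, ENNReal.ofReal (w x) ≠ ∞) :
    IsWeight w := by
  refine ⟨?_, hpos⟩
  rw [locallyIntegrable_iff]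
  intro k hk
  obtain ⟨Q, hQ⟩ := Cube.exists_superset_of_isBounded hk.isBounded
  refine IntegrableOn.mono_set ⟨hm.restrict, ?_⟩ hQ
  rw [hasFiniteIntegral_iff_ofReal]
  · exact (hfin Q).lt_top
  · filter_upwards [ae_restrict_of_ae hpos] with x hx using hx.le

namespace IsWeight

variable {w : (Fin d → ℝ) → ℝ} (hw : IsWeight w)
include hw

lemma aemeasurable : AEMeasurable w volume := hw.1.aestronglyMeasurable.aemeasurable

lemma aemeasurable_ofReal : AEMeasurable (fun x => ENNReal.ofReal (w x)) volume :=
  hw.aemeasurable.ennreal_ofReal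

lemma ofReal_ne_zero : ∀ᵐ x, ENNReal.ofReal (w x) ≠ 0 := by
  filter_upwards [hw.2] with x hx
  simpa using hx

lemma setLIntegral_ne_top (Q : Cube d) : ∫⁻ x in Q.set, ENNReal.ofReal (w x) ≠ ∞ := by
  have h := (hw.1.integrableOn_isCompact Q.isCompact_set).2
  rw [hasFiniteIntegral_iff_ofReal] at h
  · exact h.ne
  · filter_upwards [ae_restrict_of_ae hw.2] with x hx using hx.le

lemma weightMeasure_set_ne_top (Q : Cube d) : weightMeasure w Q.set ≠ ∞ := by
  rw [weightMeasure_set]; exact hw.setLIntegral_ne_top Q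

lemma weightMeasure_set_ne_zero (Q : Cube d) : weightMeasure w Q.set ≠ 0 := by
  rw [weightMeasure_set]
  exact setLIntegral_ne_zero hw.aemeasurable_ofReal hw.ofReal_ne_zero Q

lemma volume_ac : volume ≪ weightMeasure w :=
  withDensity_absolutelyContinuous' hw.aemeasurable_ofReal hw.ofReal_ne_zero

omit hw in
lemma _root_.Muckenhoupt.weightMeasure_ac (w : (Fin d → ℝ) → ℝ) : weightMeasure w ≪ volume :=
  withDensity_absolutelyContinuous _ _

lemma lintegral_weightMeasure {u : (Fin d → ℝ) → ℝ≥0∞} (hu : AEMeasurable u volume) :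
    ∫⁻ x, u x ∂(weightMeasure w) = ∫⁻ x, ENNReal.ofReal (w x) * u x := by
  rw [weightMeasure, lintegral_withDensity_eq_lintegral_mul₀ hw.aemeasurable_ofReal hu]
  rfl

lemma aemeasurable_dualWeight (p : ℝ) : AEMeasurable (dualWeight p w) volume :=
  hw.aemeasurable.pow_const _

lemma dualWeight_pos (p : ℝ) : ∀ᵐ x, 0 < dualWeight p w x := by
  filter_upwards [hw.2] with x hx
  exact Real.rpow_pos_of_pos hx _

lemma ofReal_dualWeight (p : ℝ) : ∀ᵐ x,
    ENNReal.ofReal (dualWeight p w x) = ENNReal.ofReal (w x) ^ (-1 / (p - 1)) := by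
  filter_upwards [hw.2] with x hx
  rw [dualWeight, ENNReal.ofReal_rpow_of_pos hx]

end IsWeight

lemma apConst_le_iff {p : ℝ} {w : (Fin d → ℝ) → ℝ} {a : ℝ≥0∞} : apConst p w ≤ a ↔
    ∀ Q : Cube d, (⨍⁻ x in Q.set, ENNReal.ofReal (w x) ∂volume) *
      (⨍⁻ x in Q.set, ENNReal.ofReal (dualWeight p w x) ∂volume) ^ (p - 1) ≤ a := iSup_le_iff

lemma weightMeasure_mul_le_apConst {p : ℝ} (hp : 1 < p) (w : (Fin d → ℝ) → ℝ) (Q : Cube d) :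
    weightMeasure w Q.set * weightMeasure (dualWeight p w) Q.set ^ (p - 1) ≤
      apConst p w * volume Q.set ^ p := by
  have h := apConst_le_iff.1 (le_refl (apConst p w)) Q
  have hp1 : 0 < p - 1 := by linarith
  rw [setLAverage_eq, setLAverage_eq, ← weightMeasure_set, ← weightMeasure_set,
    ENNReal.div_rpow_of_nonneg _ _ hp1.le] at h
  have h0 := Q.volume_set_ne_zero
  have ht := Q.volume_set_ne_top
  set m := volume Q.set
  set s := weightMeasure (dualWeight p w) Q.set ^ (p - 1)
  have hm0 : m ^ (p - 1) ≠ 0 := by simp [h0, ht]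
  have hmt : m ^ (p - 1) ≠ ∞ := ENNReal.rpow_ne_top_of_nonneg hp1.le ht
  have hm : m ^ p = m ^ (p - 1) * m := by
    conv_rhs => enter [2]; rw [← ENNReal.rpow_one m]
    rw [← ENNReal.rpow_add _ _ h0 ht]; congr 1; ring
  calc weightMeasure w Q.set * s
      = (weightMeasure w Q.set / m * m) * (s / m ^ (p - 1) * m ^ (p - 1)) := by
        rw [ENNReal.div_mul_cancel h0 ht, ENNReal.div_mul_cancel hm0 hmt]
    _ = (weightMeasure w Q.set / m * (s / m ^ (p - 1))) * (m ^ (p - 1) * m) := by ring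
    _ ≤ _ := by rw [hm]; gcongr

/-- With `a = w` and `σ = w^{-1/(p-1)}` this is `σ (v/σ)^p = w v^p`, which makes the change of
density an isometry from `L^p(w)` to `L^p(σ)`. -/
lemma mul_div_rpow_eq {p : ℝ} (hp : 1 < p) {a : ℝ≥0∞} (h0 : a ≠ 0) (ht : a ≠ ∞) (v : ℝ≥0∞) :
    a ^ (-1 / (p - 1)) * (v / a ^ (-1 / (p - 1))) ^ p = a * v ^ p := by
  have hp1 : 0 < p - 1 := by linarith
  rw [ENNReal.div_rpow_of_nonneg _ _ (by linarith), div_eq_mul_inv (v ^ p),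
    ← ENNReal.rpow_mul (x := a), ← ENNReal.rpow_neg, mul_left_comm, ← ENNReal.rpow_add _ _ h0 ht, mul_comm]
  congr 1
  conv_rhs => rw [← ENNReal.rpow_one a]
  congr 1
  field_simp
  ring

lemma weightMeasure_cell_mul_le_apConst {p : ℝ} (hp : 1 < p) (w : (Fin d → ℝ) → ℝ) (N : ℕ) (s : Fin d → Bool) (j : ℕ) (x : Fin d → ℝ) :
    weightMeasure w ((shiftedGrid N s).cell j x) *
      weightMeasure (dualWeight p w) ((shiftedGrid N s).cell j x) ^ (p - 1) ≤
        apConst p w * volume ((shiftedGrid N s).cell j x) ^ p := by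
  obtain ⟨Q, -, -, hQe⟩ := exists_cube_of_cell N s j x
  rw [measure_congr hQe, measure_congr ((weightMeasure_ac w).ae_le hQe),
    measure_congr ((weightMeasure_ac (dualWeight p w)).ae_le hQe)]
  exact weightMeasure_mul_le_apConst hp w Q

namespace IsAp

variable {p : ℝ} {w : (Fin d → ℝ) → ℝ} (hw : IsAp p w) (hp : 1 < p)
include hw hp

/-- If the dual weight had infinite integral over a cube, the `A_p` product there would be infinite,
since the average of `w` is positive. -/
lemma isWeight_dualWeight : IsWeight (dualWeight p w) := by
  refine isWeight_of_setLIntegral_ne_top (hw.1.aemeasurable_dualWeight p).aestronglyMeasurable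
    (hw.1.dualWeight_pos p) fun Q hQ => ?_
  have h := apConst_le_iff.1 (le_refl (apConst p w)) Q
  rw [setLAverage_eq, setLAverage_eq, hQ, ENNReal.top_div_of_ne_top Q.volume_set_ne_top,
    ENNReal.top_rpow_of_pos (by linarith), ENNReal.mul_top] at h
  · exact absurd hw.2 (not_lt.2 h)
  · rw [Ne, ENNReal.div_eq_zero_iff, not_or]
    refine ⟨?_, Q.volume_set_ne_top⟩
    rw [← weightMeasure_set]
    exact hw.1.weightMeasure_set_ne_zero Q

/-- Change of density: averages of `u` are averages with respect to the dual weight. -/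
lemma exists_density {u : (Fin d → ℝ) → ℝ≥0∞} (hu : AEMeasurable u volume) :
    ∃ g : (Fin d → ℝ) → ℝ≥0∞, AEMeasurable g (weightMeasure (dualWeight p w)) ∧
      volume.withDensity u = (weightMeasure (dualWeight p w)).withDensity g ∧
      ∫⁻ x, g x ^ p ∂(weightMeasure (dualWeight p w)) = ∫⁻ x, u x ^ p ∂(weightMeasure w) := by
  have hσ := hw.isWeight_dualWeight hp
  have hgm : AEMeasurable (fun x => u x / ENNReal.ofReal (dualWeight p w x)) volume :=
    hu.div hσ.aemeasurable_ofReal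
  refine ⟨fun x => u x / ENNReal.ofReal (dualWeight p w x), hgm.mono_ac (weightMeasure_ac _),
    ?_, ?_⟩
  · rw [weightMeasure, ← withDensity_mul₀ hσ.aemeasurable_ofReal hgm]
    refine withDensity_congr_ae ?_
    filter_upwards [hσ.ofReal_ne_zero] with x hx
    rw [Pi.mul_apply, ENNReal.mul_div_cancel hx ENNReal.ofReal_ne_top]
  · rw [hσ.lintegral_weightMeasure (hgm.pow_const p), hw.1.lintegral_weightMeasure (hu.pow_const p)]
    refine lintegral_congr_ae ?_
    filter_upwards [hw.1.ofReal_dualWeight p, hw.1.ofReal_ne_zero] with x hx hx0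
    rw [hx]
    exact mul_div_rpow_eq hp hx0 ENNReal.ofReal_ne_top (u x)

end IsAp

lemma IsWeight.weightMeasure_cell_ne {w : (Fin d → ℝ) → ℝ} (hw : IsWeight w) (N : ℕ)
    (s : Fin d → Bool) (j : ℕ) (x : Fin d → ℝ) :
    weightMeasure w ((shiftedGrid N s).cell j x) ≠ 0 ∧
      weightMeasure w ((shiftedGrid N s).cell j x) ≠ ∞ := by
  obtain ⟨Q, -, -, hQe⟩ := exists_cube_of_cell N s j x
  rw [measure_congr ((weightMeasure_ac w).ae_le hQe)]
  exact ⟨hw.weightMeasure_set_ne_zero Q, hw.weightMeasure_set_ne_top Q⟩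

/-- Cells of generation at least `i` through a point of the given cell stay inside it. Up to null
sets they are cubes, so their averages of `v` are dominated by `M(v χ_Q)`. -/
lemma IsWeight.setLIntegral_sup_ratio_le {v : (Fin d → ℝ) → ℝ} (hv : IsWeight v) (N : ℕ)
    (s : Fin d → Bool) {i n : ℕ} (x : Fin d → ℝ) :
    ∫⁻ y in (shiftedGrid N s).cell i x, (Finset.Icc i n).sup
      (fun l => (shiftedGrid N s).ratio (weightMeasure v) volume l y) ≤
      aInftyConst' v * weightMeasure v ((shiftedGrid N s).cell i x) := by
  obtain ⟨Q, -, hQs, hQe⟩ := exists_cube_of_cell N s i x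
  have hcm : MeasurableSet ((shiftedGrid N s).cell i x) :=
    PartitionFiltration.measurableSet_cell i x
  rw [measure_congr ((weightMeasure_ac v).ae_le hQe)]
  have hK : (∫⁻ x in Q.set, maximalFn (Q.set.indicator v) x ∂volume) ≤
      aInftyConst' v * weightMeasure v Q.set := by
    rw [← ENNReal.div_le_iff (hv.weightMeasure_set_ne_zero Q) (hv.weightMeasure_set_ne_top Q)]
    exact le_iSup (fun Q : Cube d => (∫⁻ x in Q.set, maximalFn (Q.set.indicator v) x ∂volume) /
      weightMeasure v Q.set) Q
  refine le_trans ?_ ((lintegral_mono_set hQs).trans hK)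
  refine lintegral_mono_ae ?_
  filter_upwards [ae_restrict_mem hcm] with y hy
  refine Finset.sup_le fun l hl => ?_
  obtain ⟨R, -, hRs, hRe⟩ := exists_cube_of_cell N s l y
  refine le_trans ?_ (laverage_le_maxOp _ (hRs (PartitionFiltration.mem_cell_self l y)))
  have hsub : (shiftedGrid N s).cell l y ⊆ Q.set := by
    intro z hz
    refine hQs ?_
    rw [PartitionFiltration.mem_cell] at hz hy ⊢
    exact (PartitionFiltration.idx_eq_of_le (Finset.mem_Icc.1 hl).1 hz).trans hy
  rw [PartitionFiltration.ratio, setLAverage_eq, measure_congr hRe]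
  gcongr
  rw [weightMeasure, withDensity_apply _ (PartitionFiltration.measurableSet_cell l y)]
  refine le_trans ?_ (lintegral_mono_set hRs)
  refine lintegral_mono_ae ?_
  filter_upwards [ae_restrict_mem (PartitionFiltration.measurableSet_cell l y)] with z hz
  rw [Set.indicator_of_mem (hsub hz)]
  exact Real.ofReal_le_enorm (v z)

namespace IsAp

variable {p : ℝ} {w : (Fin d → ℝ) → ℝ} (hw : IsAp p w) (hp : 1 < p)
include hw hp

/-- The maximal theorem with the mixed `A_p`-`A_∞` bound. -/
theorem lintegral_rpow_maxOp_le {u : (Fin d → ℝ) → ℝ≥0∞} (hu : AEMeasurable u volume) :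
    ∫⁻ x, maxOp u x ^ p ∂(weightMeasure w) ≤
      (6 ^ d) ^ p * (2 ^ d * (2 ^ p * (apConst p w * (2 * aInftyConst' (dualWeight p w)) *
        (ENNReal.ofReal (p / (p - 1)) ^ p * ∫⁻ x, u x ^ p ∂(weightMeasure w))))) := by
  have hσ := hw.isWeight_dualWeight hp
  obtain ⟨g, hg, hgu, hgi⟩ := hw.exists_density hp hu
  refine Muckenhoupt.lintegral_rpow_maxOp_le (by linarith) fun N s n => ?_
  rw [hgu, ← hgi]
  exact PartitionFiltration.lintegral_rpow_partialSups_ratio_le hp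
    (volume_cell_ne_zero N s) (volume_cell_ne_top N s)
    (fun j x => (hσ.weightMeasure_cell_ne N s j x).1)
    (fun j x => (hσ.weightMeasure_cell_ne N s j x).2)
    (weightMeasure_cell_mul_le_apConst hp w N s) (fun i _ x => hσ.setLIntegral_sup_ratio_le N s x) hg

/-- Muckenhoupt's theorem. -/
theorem exists_lintegral_rpow_maxOp_le : ∃ B : ℝ≥0∞, B ≠ ∞ ∧
    ∀ u : (Fin d → ℝ) → ℝ≥0∞, AEMeasurable u volume →
      ∫⁻ x, maxOp u x ^ p ∂(weightMeasure w) ≤ B * ∫⁻ x, u x ^ p ∂(weightMeasure w) := by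
  have hp1 : 0 < p - 1 := by linarith
  have hσ := hw.isWeight_dualWeight hp
  -- This constant involves only `[w]_{A_p}`, so it is finite before anything is known about
  -- `[σ]'_{A_∞}`.
  refine ⟨(6 ^ d) ^ p * (2 ^ d * (apConst p w ^ (p / (p - 1)) *
    (ENNReal.ofReal p ^ (p / (p - 1)) * ENNReal.ofReal (p / (p - 1)) ^ p))), ?_, fun u hu => ?_⟩
  · have := hw.2.ne
    finiteness
  obtain ⟨g, hg, hgu, hgi⟩ := hw.exists_density hp hu
  have hUm := hw.1.aemeasurable_ofReal
  have hUi : AEMeasurable (fun x => (ENNReal.ofReal (w x))⁻¹) volume := hUm.inv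
  have hmain := Muckenhoupt.lintegral_rpow_maxOp_le (ω := weightMeasure w) (u := u) (p := p)
    (by linarith) (B := apConst p w ^ (p / (p - 1)) * (ENNReal.ofReal p ^ (p / (p - 1)) *
      (ENNReal.ofReal (p / (p - 1)) ^ p * ∫⁻ x, u x ^ p ∂(weightMeasure w)))) fun N s n => by
    rw [hgu, ← hgi]
    refine PartitionFiltration.lintegral_rpow_partialSups_ratio_le_of_density hp
      (volume_cell_ne_zero N s) (volume_cell_ne_top N s)
      (fun j x => (hσ.weightMeasure_cell_ne N s j x).1)
      (fun j x => (hσ.weightMeasure_cell_ne N s j x).2)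
      (fun j x => (hw.1.weightMeasure_cell_ne N s j x).1)
      (fun j x => (hw.1.weightMeasure_cell_ne N s j x).2)
      (weightMeasure_cell_mul_le_apConst hp w N s) (h := fun x => (ENNReal.ofReal (w x))⁻¹)
      (hUi.mono_ac (weightMeasure_ac _)) ?_ ?_ hg n
    -- The density of Lebesgue measure with respect to `w dx` is `w⁻¹`, and `w · w^{-p/(p-1)} =
    -- w^{-1/(p-1)}` is the dual weight.
    · rw [weightMeasure, ← withDensity_mul₀ hUm hUi]
      conv_lhs => rw [← withDensity_one (μ := (volume : Measure (Fin d → ℝ)))]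
      refine withDensity_congr_ae ?_
      filter_upwards [hw.1.ofReal_ne_zero] with x hx
      simp [ENNReal.mul_inv_cancel hx ENNReal.ofReal_ne_top]
    · rw [weightMeasure, weightMeasure, ← withDensity_mul₀ hUm (hUi.pow_const _)]
      refine withDensity_congr_ae ?_
      filter_upwards [hw.1.ofReal_ne_zero, hw.1.ofReal_dualWeight p] with x hx hx'
      rw [hx', Pi.mul_apply, ENNReal.inv_rpow, ← ENNReal.rpow_neg]
      conv_rhs => enter [1]; rw [← ENNReal.rpow_one (ENNReal.ofReal (w x))]
      rw [← ENNReal.rpow_add _ _ hx ENNReal.ofReal_ne_top]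
      congr 1
      field_simp
      ring
  refine hmain.trans (le_of_eq ?_)
  ring

end IsAp
end Muckenhoupt

/-! ### The norm of the maximal operator. -/

namespace Muckenhoupt

variable {d : ℕ}

/-- A slightly enlarged cube also contains the nearby points, and its average still exceeds `a`
because its volume depends continuously on the side. This yields measurability of `M u` without any
assumption on `u`. -/
lemma isOpen_lt_maxOp (u : (Fin d → ℝ) → ℝ≥0∞) (a : ℝ≥0∞) : IsOpen {x | a < maxOp u x} := by
  rw [Metric.isOpen_iff]
  intro x hx
  obtain ⟨Q, hQ, haQ⟩ : ∃ Q : Cube d, x ∈ Q.set ∧ a < ⨍⁻ y in Q.set, u y ∂volume := by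
    simpa only [maxOp, Set.mem_ofPred_eq, lt_iSup_iff, exists_prop] using hx
  rw [setLAverage_eq, Q.volume_set] at haQ
  have hlim : Filter.Tendsto
      (fun ε : ℝ => (∫⁻ y in Q.set, u y) / ENNReal.ofReal (Q.side + 2 * ε) ^ d)
      (nhdsWithin 0 (Set.Ioi 0)) (nhds ((∫⁻ y in Q.set, u y) / ENNReal.ofReal Q.side ^ d)) := by
    refine ENNReal.Tendsto.const_div ?_ (Or.inl (ENNReal.pow_ne_top ENNReal.ofReal_ne_top))
    refine ENNReal.Tendsto.pow (ENNReal.tendsto_ofReal ?_)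
    refine tendsto_nhdsWithin_of_tendsto_nhds ?_
    have : Continuous fun ε : ℝ => Q.side + 2 * ε := by fun_prop
    simpa using this.tendsto 0
  obtain ⟨ε, haε, hε⟩ := ((hlim.eventually_const_lt haQ).and self_mem_nhdsWithin).exists
  refine ⟨ε, hε, fun y hy => ?_⟩
  replace hε : 0 < ε := hε
  set R : Cube d := ⟨fun i => Q.corner i - ε, Q.side + 2 * ε, by linarith [Q.side_pos]⟩ with hR
  have hQR : Q.set ⊆ R.set := by
    intro z hz
    rw [Cube.mem_set] at hz ⊢
    intro i
    simp only [hR]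
    constructor <;> linarith [(hz i).1, (hz i).2]
  have hyR : y ∈ R.set := by
    rw [Cube.mem_set] at hQ ⊢
    intro i
    have h1 : |y i - x i| < ε := by
      rw [← Real.dist_eq]
      exact (dist_le_pi_dist y x i).trans_lt hy
    rw [abs_lt] at h1
    simp only [hR]
    constructor <;> linarith [(hQ i).1, (hQ i).2]
  refine haε.trans_le (le_trans ?_ (laverage_le_maxOp u hyR))
  rw [setLAverage_eq, R.volume_set]
  gcongr

lemma measurable_maxOp (u : (Fin d → ℝ) → ℝ≥0∞) : Measurable (maxOp u) :=
  measurable_of_Ioi fun a => (isOpen_lt_maxOp u a).measurableSet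

lemma eLpNorm_ofReal {ε : Type*} [TopologicalSpace ε] [ContinuousENorm ε] {p : ℝ} (hp : 1 < p)
    (f : (Fin d → ℝ) → ε)
    (ν : Measure (Fin d → ℝ)) :
    eLpNorm f (ENNReal.ofReal p) ν = (∫⁻ x, ‖f x‖ₑ ^ p ∂ν) ^ (1 / p) := by
  have hp0 : 0 < p := by linarith
  rw [eLpNorm_eq_lintegral_rpow_enorm_toReal (by simpa using hp0) ENNReal.ofReal_ne_top,
    ENNReal.toReal_ofReal hp0.le]

section
variable {p : ℝ} {w : (Fin d → ℝ) → ℝ}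

lemma maximalNorm_le (hp : 1 < p) (hw : IsWeight w) {B : ℝ≥0∞}
    (h : ∀ u : (Fin d → ℝ) → ℝ≥0∞, AEMeasurable u volume →
      ∫⁻ x, maxOp u x ^ p ∂(weightMeasure w) ≤ B * ∫⁻ x, u x ^ p ∂(weightMeasure w)) :
    maximalNorm p w ≤ B ^ (1 / p) := by
  have hp0 : 0 < p := by linarith
  refine iSup_le fun f => iSup₂_le fun hf hf0 => ?_
  refine ENNReal.div_le_of_le_mul ?_
  rw [eLpNorm_ofReal hp, eLpNorm_ofReal hp, ← ENNReal.mul_rpow_of_nonneg _ _ (by positivity)]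
  gcongr
  exact h _ (hf.1.mono_ac hw.volume_ac).enorm

/-- `maximalNorm` is tested on complex functions of finite nonzero norm. Finiteness of the integral
makes `u` finite a.e., so that it is the modulus of such a function; a null `u` has `M u = 0`. -/
lemma lintegral_rpow_maxOp_le_maximalNorm (hp : 1 < p) (hw : IsWeight w)
    {u : (Fin d → ℝ) → ℝ≥0∞} (hu : AEMeasurable u volume)
    (hfin : ∫⁻ x, u x ^ p ∂(weightMeasure w) ≠ ∞) :
    ∫⁻ x, maxOp u x ^ p ∂(weightMeasure w) ≤
      maximalNorm p w ^ p * ∫⁻ x, u x ^ p ∂(weightMeasure w) := by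
  have hp0 : 0 < p := by linarith
  have huw : AEMeasurable u (weightMeasure w) := hu.mono_ac (weightMeasure_ac w)
  have hut : ∀ᵐ x ∂(weightMeasure w), u x ≠ ∞ := by
    filter_upwards [ae_lt_top' (huw.pow_const p) hfin] with x hx hx'
    rw [hx', ENNReal.top_rpow_of_pos hp0] at hx
    exact lt_irrefl _ hx
  set f : (Fin d → ℝ) → ℂ := fun x => ((u x).toReal : ℂ) with hf
  have hfu : ∀ᵐ x ∂(weightMeasure w), ‖f x‖ₑ = u x := by
    filter_upwards [hut] with x hx
    rw [hf]
    simp only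
    rw [← ofReal_norm, Complex.norm_real, Real.norm_of_nonneg ENNReal.toReal_nonneg,
      ENNReal.ofReal_toReal hx]
  have hmax : maximalFn f = maxOp u := maxOp_congr (hw.volume_ac.ae_le hfu)
  have hfI : ∫⁻ x, ‖f x‖ₑ ^ p ∂(weightMeasure w) = ∫⁻ x, u x ^ p ∂(weightMeasure w) :=
    lintegral_congr_ae (by filter_upwards [hfu] with x hx using by rw [hx])
  have hfm : AEStronglyMeasurable f (weightMeasure w) :=
    (Complex.measurable_ofReal.comp_aemeasurable huw.ennreal_toReal).aestronglyMeasurable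
  have hfL : MemLp f (ENNReal.ofReal p) (weightMeasure w) := by
    refine ⟨hfm, ?_⟩
    rw [eLpNorm_ofReal hp, hfI]
    exact ENNReal.rpow_lt_top_of_nonneg (by positivity) hfin
  by_cases h0 : eLpNorm f (ENNReal.ofReal p) (weightMeasure w) = 0
  · have hu0 : u =ᵐ[volume] fun _ => 0 := by
      rw [eLpNorm_ofReal hp, hfI, ENNReal.rpow_eq_zero_iff] at h0
      have h1 : ∫⁻ x, u x ^ p ∂(weightMeasure w) = 0 := by
        rcases h0 with h | h
        · exact h.1
        · exact absurd h.1 hfin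
      rw [lintegral_eq_zero_iff' (huw.pow_const p)] at h1
      refine hw.volume_ac.ae_le ?_
      filter_upwards [h1] with x hx
      simpa [hp0, hp0.le, hp0.not_gt] using hx
    have : maxOp u = fun _ => 0 := by
      rw [maxOp_congr hu0]
      ext x
      simp [maxOp]
    simp [this, hp0]
  · have hM : eLpNorm (maximalFn f) (ENNReal.ofReal p) (weightMeasure w) /
        eLpNorm f (ENNReal.ofReal p) (weightMeasure w) ≤ maximalNorm p w := by
      refine le_iSup_of_le f ?_
      exact le_iSup₂_of_le hfL h0 le_rfl
    rw [ENNReal.div_le_iff h0 hfL.2.ne, eLpNorm_ofReal hp, eLpNorm_ofReal hp, hfI, hmax,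
      one_div, ENNReal.rpow_inv_le_iff hp0, ENNReal.mul_rpow_of_nonneg _ _ hp0.le,
      ← ENNReal.rpow_mul, inv_mul_cancel₀ hp0.ne', ENNReal.rpow_one] at hM
    exact hM

/-- The test function is the indicator of a cube, which its maximal function dominates. -/
lemma one_le_maximalNorm (hp : 1 < p) (hw : IsWeight w) : 1 ≤ maximalNorm p w := by
  have hp0 : 0 < p := by linarith
  let Q : Cube d := ⟨fun _ => 0, 1, one_pos⟩
  set f : (Fin d → ℝ) → ℂ := Q.set.indicator fun _ => 1 with hf
  have hfL : MemLp f (ENNReal.ofReal p) (weightMeasure w) :=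
    memLp_indicator_const _ Q.measurableSet_set _ (Or.inr (hw.weightMeasure_set_ne_top Q))
  have hle : ∀ x, ‖f x‖ₑ ≤ maximalFn f x := by
    intro x
    by_cases hx : x ∈ Q.set
    · refine le_trans ?_ (laverage_le_maxOp _ hx)
      rw [setLAverage_eq, setLIntegral_congr_fun (g := fun _ => 1) Q.measurableSet_set
        (fun y hy => by simp [hf, hy])]
      simp [hf, hx, ENNReal.div_self Q.volume_set_ne_zero Q.volume_set_ne_top]
    · simp [hf, hx]
  have h0 : eLpNorm f (ENNReal.ofReal p) (weightMeasure w) ≠ 0 := by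
    intro h
    rw [hf, eLpNorm_indicator_const Q.measurableSet_set (by simpa using hp0)
      ENNReal.ofReal_ne_top] at h
    simp [hw.weightMeasure_set_ne_zero Q, hw.weightMeasure_set_ne_top Q] at h
  have hM : eLpNorm (maximalFn f) (ENNReal.ofReal p) (weightMeasure w) /
        eLpNorm f (ENNReal.ofReal p) (weightMeasure w) ≤ maximalNorm p w := by
    refine le_iSup_of_le f ?_
    exact le_iSup₂_of_le hfL h0 le_rfl
  refine le_trans ?_ hM
  rw [ENNReal.le_div_iff_mul_le (Or.inl h0) (Or.inl hfL.2.ne), one_mul, eLpNorm_ofReal hp,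
    eLpNorm_ofReal hp]
  gcongr with x
  exact hle x

namespace IsAp

variable (hw : IsAp p w) (hp : 1 < p)
include hw hp

lemma maximalNorm_lt_top : maximalNorm p w < ∞ := by
  obtain ⟨B, hB, h⟩ := hw.exists_lintegral_rpow_maxOp_le hp
  exact (maximalNorm_le hp hw.1 h).trans_lt
    (ENNReal.rpow_lt_top_of_nonneg (by positivity) hB)

/-- The mixed bound for the norm of the maximal operator. -/
lemma maximalNorm_le_mixed : maximalNorm p w ≤ 4 * 12 ^ d * ENNReal.ofReal (p / (p - 1)) *
    (apConst p w * aInftyConst' (dualWeight p w)) ^ (1 / p) := by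
  have hp0 : 0 < p := by linarith
  set a := apConst p w
  set K := aInftyConst' (dualWeight p w)
  set q := ENNReal.ofReal (p / (p - 1))
  have h := maximalNorm_le hp hw.1 (B := (6 ^ d) ^ p * (2 ^ d * (2 ^ p * (a * (2 * K) * q ^ p))))
    fun u hu => (hw.lintegral_rpow_maxOp_le hp hu).trans (le_of_eq (by ring))
  refine h.trans ?_
  rw [one_div, ENNReal.rpow_inv_le_iff hp0]
  -- Replacing `2^d` and `2` by their `p`-th powers makes the constant independent of `p` after the
  -- root: `6^d · 2^d · 2 · 2 = 4 · 12^d`.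
  have hself : ∀ b : ℝ≥0∞, 1 ≤ b → b ≤ b ^ p := fun b hb => by
    conv_lhs => rw [← ENNReal.rpow_one b]
    exact ENNReal.rpow_le_rpow_of_exponent_le hb hp.le
  calc (6 ^ d) ^ p * (2 ^ d * (2 ^ p * (a * (2 * K) * q ^ p)))
      = (6 ^ d) ^ p * (2 ^ d * (2 ^ p * (2 * (a * K) * q ^ p))) := by ring
    _ ≤ (6 ^ d) ^ p * ((2 ^ d) ^ p * (2 ^ p * (2 ^ p * (a * K) * q ^ p))) := by
        gcongr
        · exact hself _ (one_le_pow₀ one_le_two)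
        · exact hself _ one_le_two
    _ = (6 ^ d * (2 ^ d * (2 * (2 * (a * K) ^ p⁻¹ * q)))) ^ p := by
        simp only [ENNReal.mul_rpow_of_nonneg _ _ hp0.le]
        rw [← ENNReal.rpow_mul,
          inv_mul_cancel₀ hp0.ne', ENNReal.rpow_one]
    _ = (4 * 12 ^ d * q * (a * K) ^ p⁻¹) ^ p := by
        congr 1
        rw [show (12 : ℝ≥0∞) = 6 * 2 by norm_num, mul_pow, show (4 : ℝ≥0∞) = 2 * 2 by norm_num]
        ring

/-- Hölder's inequality between an `A_p` weight and its dual weight. -/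
lemma setLIntegral_le {v : (Fin d → ℝ) → ℝ≥0∞} (hv : AEMeasurable v volume) (Q : Cube d) :
    ∫⁻ x in Q.set, v x ≤ (∫⁻ x, v x ^ p ∂(weightMeasure w)) ^ (1 / p) *
      weightMeasure (dualWeight p w) Q.set ^ (1 - 1 / p) := by
  have hp0 : 0 < p := by linarith
  have hp1 : 0 < p - 1 := by linarith
  have hpq := Real.HolderConjugate.conjExponent hp
  have hUm := hw.1.aemeasurable_ofReal
  calc ∫⁻ x in Q.set, v x
      = ∫⁻ x in Q.set, ((fun x => ENNReal.ofReal (w x) ^ (1 / p) * v x) *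
          fun x => ENNReal.ofReal (w x) ^ (-(1 / p))) x := by
        refine lintegral_congr_ae ?_
        filter_upwards [ae_restrict_of_ae hw.1.ofReal_ne_zero] with x hx
        simp only [Pi.mul_apply]
        rw [mul_right_comm, ← ENNReal.rpow_add _ _ hx ENNReal.ofReal_ne_top]
        simp
    _ ≤ _ := ENNReal.lintegral_mul_le_Lp_mul_Lq _ hpq ((hUm.pow_const _).mul hv).restrict
        (hUm.pow_const _).restrict
    _ ≤ _ := by
        gcongr ?_ ^ (1 / p) * ?_
        · rw [hw.1.lintegral_weightMeasure (hv.pow_const p)]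
          refine (setLIntegral_le_lintegral _ _).trans (le_of_eq ?_)
          refine lintegral_congr fun x => ?_
          rw [ENNReal.mul_rpow_of_nonneg _ _ hp0.le, ← ENNReal.rpow_mul, one_div,
            inv_mul_cancel₀ hp0.ne', ENNReal.rpow_one]
        · rw [weightMeasure_set, show 1 / p.conjExponent = 1 - 1 / p by
            rw [Real.conjExponent]; field_simp]
          refine le_of_eq ?_
          congr 1
          refine lintegral_congr_ae ?_
          filter_upwards [ae_restrict_of_ae (hw.1.ofReal_dualWeight p)] with x hx
          rw [hx, ← ENNReal.rpow_mul]
          congr 1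
          rw [Real.conjExponent]; field_simp

/-- Since `σ^p w = σ`, the function `σχ_Q` has `L^p(w)` norm `σ(Q)^{1/p}`. Hölder against
`σ(Q)^{1-1/p}` bounds the integral of `M(σχ_Q)` over `Q` by `‖M‖ σ(Q)`. -/
lemma aInftyConst'_dualWeight_le : aInftyConst' (dualWeight p w) ≤ maximalNorm p w := by
  have hp0 : 0 < p := by linarith
  have hp1 : 0 < p - 1 := by linarith
  have hσ := hw.isWeight_dualWeight hp
  refine iSup_le fun Q => ENNReal.div_le_of_le_mul ?_
  set σ := dualWeight p w with hσdef
  set u : (Fin d → ℝ) → ℝ≥0∞ := fun x => ‖Q.set.indicator σ x‖ₑ with hu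
  have hum : AEMeasurable u volume := (hσ.aemeasurable.indicator Q.measurableSet_set).enorm
  have hS0 := hσ.weightMeasure_set_ne_zero Q
  have hSt := hσ.weightMeasure_set_ne_top Q
  have hI : ∫⁻ x, u x ^ p ∂(weightMeasure w) = weightMeasure σ Q.set := by
    rw [hw.1.lintegral_weightMeasure (hum.pow_const p), weightMeasure_set,
      ← lintegral_indicator Q.measurableSet_set]
    refine lintegral_congr_ae ?_
    filter_upwards [hw.1.ofReal_ne_zero, hw.1.ofReal_dualWeight p, hw.1.dualWeight_pos p]
      with x hx hx' hx''
    by_cases hxQ : x ∈ Q.set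
    · simp only [hu, Set.indicator_of_mem hxQ]
      rw [Real.enorm_of_nonneg hx''.le, hx', ← ENNReal.rpow_mul]
      conv_lhs => enter [1]; rw [← ENNReal.rpow_one (ENNReal.ofReal (w x))]
      rw [← ENNReal.rpow_add _ _ hx ENNReal.ofReal_ne_top]
      congr 1
      field_simp
      ring
    · simp [hu, hxQ, hp0]
  calc ∫⁻ x in Q.set, maxOp u x
      ≤ (∫⁻ x, maxOp u x ^ p ∂(weightMeasure w)) ^ (1 / p) * weightMeasure σ Q.set ^ (1 - 1 / p) :=
        hw.setLIntegral_le hp (measurable_maxOp u).aemeasurable Q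
    _ ≤ (maximalNorm p w ^ p * weightMeasure σ Q.set) ^ (1 / p) *
          weightMeasure σ Q.set ^ (1 - 1 / p) := by
        gcongr
        rw [← hI]
        exact lintegral_rpow_maxOp_le_maximalNorm hp hw.1 hum (by rwa [hI])
    _ = maximalNorm p w * weightMeasure σ Q.set := by
        rw [ENNReal.mul_rpow_of_nonneg _ _ (by positivity), ← ENNReal.rpow_mul,
          mul_one_div_cancel hp0.ne', ENNReal.rpow_one, mul_assoc, ← ENNReal.rpow_add _ _ hS0 hSt]
        simp

end IsAp
end
end Muckenhoupt

/-! ### The Rubio de Francia iteration. -/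

/-- Minkowski's inequality for series. -/
lemma lintegral_rpow_tsum_le {X : Type*} [MeasurableSpace X] {ν : Measure X} {p : ℝ} (hp : 1 ≤ p)
    {v : ℕ → X → ℝ≥0∞} (hv : ∀ n, AEMeasurable (v n) ν) :
    (∫⁻ x, (∑' n, v n x) ^ p ∂ν) ^ (1 / p) ≤ ∑' n, (∫⁻ x, v n x ^ p ∂ν) ^ (1 / p) := by
  have hp0 : 0 < p := by linarith
  have hsm : ∀ n, AEMeasurable (fun x => ∑ i ∈ Finset.range n, v i x) ν := fun n =>
    Finset.aemeasurable_fun_sum _ fun i _ => hv i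
  have hfin : ∀ n, (∫⁻ x, (∑ i ∈ Finset.range n, v i x) ^ p ∂ν) ^ (1 / p) ≤
      ∑ i ∈ Finset.range n, (∫⁻ x, v i x ^ p ∂ν) ^ (1 / p) := by
    intro n
    induction n with
    | zero => simp [hp0]
    | succ n ih =>
      simp only [Finset.sum_range_succ]
      refine (ENNReal.lintegral_Lp_add_le (hsm n) (hv n) hp).trans ?_
      gcongr
  have hsup : ∫⁻ x, (∑' n, v n x) ^ p ∂ν = ⨆ n, ∫⁻ x, (∑ i ∈ Finset.range n, v i x) ^ p ∂ν := by
    rw [← lintegral_iSup' (fun n => (hsm n).pow_const p)]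
    · refine lintegral_congr fun x => ?_
      rw [ENNReal.tsum_eq_iSup_nat]
      exact (ENNReal.orderIsoRpow p hp0).map_iSup _
    · refine Filter.Eventually.of_forall fun x m n hmn => ?_
      refine ENNReal.rpow_le_rpow ?_ hp0.le
      exact Finset.sum_le_sum_of_subset (Finset.range_mono hmn)
  rw [hsup, one_div, ENNReal.rpow_inv_le_iff hp0]
  refine iSup_le fun n => ?_
  rw [← ENNReal.rpow_inv_le_iff hp0, ← one_div]
  exact (hfin n).trans (ENNReal.sum_le_tsum _)

namespace Muckenhoupt

variable {d : ℕ} {p : ℝ} {w : (Fin d → ℝ) → ℝ}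

lemma maxOp_tsum_le {v : ℕ → (Fin d → ℝ) → ℝ≥0∞} (hv : ∀ n, AEMeasurable (v n) volume)
    (x : Fin d → ℝ) : maxOp (fun y => ∑' n, v n y) x ≤ ∑' n, maxOp (v n) x := by
  refine maxOp_le fun Q hQ => ?_
  rw [setLAverage_eq, lintegral_tsum fun n => (hv n).restrict, div_eq_mul_inv,
    ← ENNReal.tsum_mul_right]
  refine ENNReal.tsum_le_tsum fun n => ?_
  rw [← div_eq_mul_inv, ← setLAverage_eq]
  exact laverage_le_maxOp _ hQ

lemma maxOp_const_mul_le {c : ℝ≥0∞} (hc : c ≠ ∞) (u : (Fin d → ℝ) → ℝ≥0∞) (x : Fin d → ℝ) :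
    maxOp (fun y => c * u y) x ≤ c * maxOp u x := by
  refine maxOp_le fun Q hQ => ?_
  rw [setLAverage_eq, lintegral_const_mul' _ _ hc, mul_div_assoc, ← setLAverage_eq]
  gcongr
  exact laverage_le_maxOp _ hQ

/-- The iteration algorithm of Rubio de Francia. -/
theorem exists_maxOp_le_mul (hp : 1 < p) (hw : IsWeight w) (hM : maximalNorm p w ≠ ∞)
    {u : (Fin d → ℝ) → ℝ≥0∞} (hu : AEMeasurable u volume)
    (hfin : ∫⁻ x, u x ^ p ∂(weightMeasure w) ≠ ∞) :
    ∃ R : (Fin d → ℝ) → ℝ≥0∞, AEMeasurable R volume ∧ u ≤ R ∧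
      (∀ x, maxOp R x ≤ 2 * maximalNorm p w * R x) ∧
      (∫⁻ x, R x ^ p ∂(weightMeasure w)) ^ (1 / p) ≤
        2 * (∫⁻ x, u x ^ p ∂(weightMeasure w)) ^ (1 / p) := by
  have hp0 : 0 < p := by linarith
  set M := maximalNorm p w with hMdef
  have hM0 : M ≠ 0 := (one_pos.trans_le (one_le_maximalNorm hp hw)).ne'
  set c := 2 * M with hc
  have hc0 : c ≠ 0 := mul_ne_zero two_ne_zero hM0
  have hct : c ≠ ∞ := ENNReal.mul_ne_top ENNReal.ofNat_ne_top hM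
  set v : ℕ → (Fin d → ℝ) → ℝ≥0∞ := fun n => maxOp^[n] u with hv
  have hvs : ∀ n, v (n + 1) = maxOp (v n) := fun n => Function.iterate_succ_apply' _ _ _
  have hvm : ∀ n, AEMeasurable (v n) volume := by
    intro n
    cases n with
    | zero => exact hu
    | succ n => rw [hvs]; exact (measurable_maxOp _).aemeasurable
  have hvI : ∀ n, ∫⁻ x, v n x ^ p ∂(weightMeasure w) ≤
      (M ^ n) ^ p * ∫⁻ x, u x ^ p ∂(weightMeasure w) := by
    intro n
    induction n with
    | zero => simp [hv]
    | succ n ih =>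
      rw [hvs]
      refine (lintegral_rpow_maxOp_le_maximalNorm hp hw (hvm n) ?_).trans ?_
      · refine ne_top_of_le_ne_top ?_ ih
        exact ENNReal.mul_ne_top (ENNReal.rpow_ne_top_of_nonneg hp0.le (ENNReal.pow_ne_top hM)) hfin
      · rw [pow_succ', ENNReal.mul_rpow_of_nonneg _ _ hp0.le, mul_assoc]
        gcongr
  -- As `c` is twice the norm of `M`, the `n`-th term has norm at most `2^{-n}` times that of `u`,
  -- and the norms sum to `2`. Applying `M` to the `n`-th term yields at most `c` times the next
  -- one.
  set t : ℕ → (Fin d → ℝ) → ℝ≥0∞ := fun n x => c⁻¹ ^ n * v n x with ht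
  have htm : ∀ n, AEMeasurable (t n) volume := fun n => (hvm n).const_mul _
  refine ⟨fun x => ∑' n, t n x, AEMeasurable.tsum htm, fun x => ?_, fun x => ?_, ?_⟩
  · refine le_trans (le_of_eq ?_) (ENNReal.le_tsum 0)
    simp [ht, hv]
  · calc maxOp (fun y => ∑' n, t n y) x ≤ ∑' n, maxOp (t n) x := maxOp_tsum_le htm x
      _ ≤ ∑' n, c * t (n + 1) x := by
          refine ENNReal.tsum_le_tsum fun n => ?_
          refine (maxOp_const_mul_le
            (ENNReal.pow_ne_top (ENNReal.inv_ne_top.2 hc0)) (v n) x).trans (le_of_eq ?_)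
          rw [ht]
          simp only
          rw [hvs, pow_succ', ← mul_assoc, ← mul_assoc, ENNReal.mul_inv_cancel hc0 hct, one_mul]
      _ = c * ∑' n, t (n + 1) x := ENNReal.tsum_mul_left
      _ ≤ c * ∑' n, t n x := by
          exact mul_le_mul_right (ENNReal.tsum_comp_le_tsum_of_injective (add_left_injective 1)
            fun n => t n x) c
  · refine (lintegral_rpow_tsum_le hp.le fun n => (htm n).mono_ac (weightMeasure_ac w)).trans ?_
    calc ∑' n, (∫⁻ x, t n x ^ p ∂(weightMeasure w)) ^ (1 / p)
        ≤ ∑' n, 2⁻¹ ^ n * (∫⁻ x, u x ^ p ∂(weightMeasure w)) ^ (1 / p) := by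
          refine ENNReal.tsum_le_tsum fun n => ?_
          rw [one_div, ENNReal.rpow_inv_le_iff hp0, ENNReal.mul_rpow_of_nonneg _ _ hp0.le,
            ← ENNReal.rpow_mul, inv_mul_cancel₀ hp0.ne', ENNReal.rpow_one]
          calc ∫⁻ x, t n x ^ p ∂(weightMeasure w)
              = (c⁻¹ ^ n) ^ p * ∫⁻ x, v n x ^ p ∂(weightMeasure w) := by
                rw [← lintegral_const_mul'' _
                  (((hvm n).mono_ac (weightMeasure_ac w)).pow_const p)]
                refine lintegral_congr fun x => ?_
                rw [ht]
                exact ENNReal.mul_rpow_of_nonneg _ _ hp0.le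
            _ ≤ (c⁻¹ ^ n) ^ p * ((M ^ n) ^ p * ∫⁻ x, u x ^ p ∂(weightMeasure w)) := by
                gcongr
                exact hvI n
            _ = _ := by
                rw [← mul_assoc, ← ENNReal.mul_rpow_of_nonneg _ _ hp0.le, ← mul_pow]
                congr 3
                rw [hc, ENNReal.mul_inv (Or.inl two_ne_zero) (Or.inl ENNReal.ofNat_ne_top),
                  mul_assoc, ENNReal.inv_mul_cancel hM0 hM, mul_one]
      _ = _ := by
          rw [ENNReal.tsum_mul_right, ENNReal.tsum_geometric]
          congr 1
          rw [ENNReal.one_sub_inv_two, inv_inv]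

end Muckenhoupt

/-! ### Logarithmic averages and the `A_∞` constants. -/

section probability

variable {X : Type*} [MeasurableSpace X] {ν : Measure X}

/-- Both parts of the logarithm are dominated: `log h ≤ h` and `-log h ≤ h^{-s} / s`. -/
lemma integrable_log_of_lintegral_ne_top {h : X → ℝ} (hm : AEMeasurable h ν)
    (hpos : ∀ᵐ x ∂ν, 0 < h x) {s : ℝ} (hs : 0 < s) (h₁ : ∫⁻ x, ENNReal.ofReal (h x) ∂ν ≠ ∞)
    (h₂ : ∫⁻ x, ENNReal.ofReal (h x ^ (-s)) ∂ν ≠ ∞) : Integrable (fun x => Real.log (h x)) ν := by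
  have i₁ : Integrable h ν := by
    refine ⟨hm.aestronglyMeasurable, ?_⟩
    rw [hasFiniteIntegral_iff_ofReal]
    · exact h₁.lt_top
    · filter_upwards [hpos] with x hx using hx.le
  have i₂ : Integrable (fun x => h x ^ (-s)) ν := by
    refine ⟨(hm.pow_const _).aestronglyMeasurable, ?_⟩
    rw [hasFiniteIntegral_iff_ofReal]
    · exact h₂.lt_top
    · filter_upwards [hpos] with x hx using Real.rpow_nonneg hx.le _
  refine (i₁.add (i₂.const_mul s⁻¹)).mono' hm.log.aestronglyMeasurable ?_
  filter_upwards [hpos] with x hx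
  have hx' : 0 < h x ^ (-s) := Real.rpow_pos_of_pos hx _
  have e₁ := Real.log_le_sub_one_of_pos hx
  have e₂ := Real.log_le_sub_one_of_pos hx'
  rw [Real.log_rpow hx] at e₂
  have e₃ : -Real.log (h x) ≤ s⁻¹ * h x ^ (-s) := by
    rw [inv_mul_eq_div, le_div_iff₀ hs]
    linarith
  have e₄ : 0 ≤ s⁻¹ * h x ^ (-s) := by positivity
  simp only [Pi.add_apply, Real.norm_eq_abs, abs_le]
  constructor <;> linarith

/-- Hölder with the weights `(p-1)/(r-1)` and `(r-p)/(r-1)`, which add up to `1`, raised to the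
power `r-1`. It is applied with `u` the dual weight of `w` and `v = R`. -/
lemma lintegral_rpow_mul_rpow_le {u v : X → ℝ≥0∞} (hu : AEMeasurable u ν) (hv : AEMeasurable v ν)
    {p r : ℝ} (hp : 1 < p) (hpr : p < r) :
    (∫⁻ x, u x ^ ((p - 1) / (r - 1)) * v x ^ ((r - p) / (r - 1)) ∂ν) ^ (r - 1) ≤
      (∫⁻ x, u x ∂ν) ^ (p - 1) * (∫⁻ x, v x ∂ν) ^ (r - p) := by
  have hr1 : 0 < r - 1 := by linarith
  have h := ENNReal.lintegral_mul_norm_pow_le hu hv (p := (p - 1) / (r - 1))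
    (q := (r - p) / (r - 1)) (div_nonneg (by linarith) hr1.le) (div_nonneg (by linarith) hr1.le)
    (by field_simp; ring)
  calc _ ≤ ((∫⁻ x, u x ∂ν) ^ ((p - 1) / (r - 1)) * (∫⁻ x, v x ∂ν) ^ ((r - p) / (r - 1))) ^
        (r - 1) := by gcongr
    _ = _ := by
      rw [ENNReal.mul_rpow_of_nonneg _ _ hr1.le, ← ENNReal.rpow_mul, ← ENNReal.rpow_mul,
        div_mul_cancel₀ _ hr1.ne', div_mul_cancel₀ _ hr1.ne']

variable [IsProbabilityMeasure ν]

lemma ofReal_exp_integral_log_le {h : X → ℝ} (hpos : ∀ᵐ x ∂ν, 0 < h x)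
    (hm : AEMeasurable h ν) (hl : Integrable (fun x => Real.log (h x)) ν) :
    ENNReal.ofReal (Real.exp (∫ x, Real.log (h x) ∂ν)) ≤ ∫⁻ x, ENNReal.ofReal (h x) ∂ν := by
  by_cases hfin : ∫⁻ x, ENNReal.ofReal (h x) ∂ν = ∞
  · rw [hfin]; exact le_top
  have hint : Integrable h ν := by
    refine ⟨hm.aestronglyMeasurable, ?_⟩
    rw [hasFiniteIntegral_iff_ofReal]
    · exact lt_top_iff_ne_top.2 hfin
    · filter_upwards [hpos] with x hx using hx.le
  have hexp : (fun x => Real.exp (Real.log (h x))) =ᵐ[ν] h := by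
    filter_upwards [hpos] with x hx using Real.exp_log hx
  have hj := convexOn_exp.map_integral_le (μ := ν) Real.continuous_exp.continuousOn isClosed_univ
    (Filter.Eventually.of_forall fun x => Set.mem_univ _) hl (hint.congr hexp.symm)
  rw [← ofReal_integral_eq_lintegral_ofReal hint (by filter_upwards [hpos] with x hx using hx.le)]
  refine ENNReal.ofReal_le_ofReal (hj.trans (le_of_eq ?_))
  exact integral_congr_ae hexp

end probability

lemma ofReal_exp_rpow (a q : ℝ) :
    ENNReal.ofReal (Real.exp a) ^ q = ENNReal.ofReal (Real.exp (a * q)) := by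
  rw [ENNReal.ofReal_rpow_of_pos (Real.exp_pos a), ← Real.exp_mul]

namespace Muckenhoupt

variable {d : ℕ}

/-- The normalized Lebesgue measure on a cube. -/
noncomputable def Cube.avg (Q : Cube d) : Measure (Fin d → ℝ) :=
  (volume.restrict Q.set Set.univ)⁻¹ • volume.restrict Q.set

lemma laverage_eq_lintegral_avg (Q : Cube d) (u : (Fin d → ℝ) → ℝ≥0∞) :
    ⨍⁻ x in Q.set, u x ∂volume = ∫⁻ x, u x ∂Q.avg := rfl

instance (Q : Cube d) : IsProbabilityMeasure Q.avg := by
  refine ⟨?_⟩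
  rw [Cube.avg, Measure.smul_apply, Measure.restrict_apply_univ, smul_eq_mul,
    ENNReal.inv_mul_cancel Q.volume_set_ne_zero Q.volume_set_ne_top]

lemma Cube.avg_ac (Q : Cube d) : Q.avg ≪ volume :=
  Measure.AbsolutelyContinuous.smul_left Measure.absolutelyContinuous_restrict _

lemma Cube.ae_mem_avg (Q : Cube d) : ∀ᵐ x ∂Q.avg, x ∈ Q.set :=
  (Measure.AbsolutelyContinuous.smul_left (Measure.AbsolutelyContinuous.refl _) _).ae_le
    (ae_restrict_mem Q.measurableSet_set)

lemma integrable_avg_iff (Q : Cube d) {f : (Fin d → ℝ) → ℝ} :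
    Integrable f Q.avg ↔ IntegrableOn f Q.set volume := by
  rw [Cube.avg, integrable_smul_measure]
  · rfl
  · simp [Q.volume_set_ne_top]
  · simp [Q.volume_set_ne_zero]

lemma expMeanLogInv_eq {w : (Fin d → ℝ) → ℝ} {Q : Cube d}
    (h : Integrable (fun x => Real.log (w x)) Q.avg) :
    expMeanLogInv w Q = ENNReal.ofReal (Real.exp (-∫ x, Real.log (w x) ∂Q.avg)) := by
  have h' : IntegrableOn (fun x => Real.log (w x)⁻¹) Q.set volume := by
    simp only [Real.log_inv]
    exact ((integrable_avg_iff Q).1 h).neg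
  rw [expMeanLogInv, if_pos h', ← integral_neg]
  simp only [Real.log_inv]
  rfl

lemma lintegral_avg (Q : Cube d) (u : (Fin d → ℝ) → ℝ≥0∞) :
    ∫⁻ x, u x ∂Q.avg = (∫⁻ x in Q.set, u x) / volume Q.set := by
  rw [← laverage_eq_lintegral_avg, setLAverage_eq]

lemma lintegral_avg_ne_top {Q : Cube d} {u : (Fin d → ℝ) → ℝ≥0∞} (h : ∫⁻ x in Q.set, u x ≠ ∞) :
    ∫⁻ x, u x ∂Q.avg ≠ ∞ := by
  rw [lintegral_avg]
  exact (ENNReal.div_lt_top h Q.volume_set_ne_zero).ne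

lemma lintegral_avg_ne_zero {Q : Cube d} {u : (Fin d → ℝ) → ℝ≥0∞} (h : ∫⁻ x in Q.set, u x ≠ 0) :
    ∫⁻ x, u x ∂Q.avg ≠ 0 := by
  rw [lintegral_avg]
  exact ENNReal.div_ne_zero.2 ⟨h, Q.volume_set_ne_top⟩

/-- Jensen on a single cube; if `log w` is not integrable there, the product is infinite. The bound
places the arguments of `φ` in `[1, ∞)`, where monotonicity is assumed. -/
lemma one_le_aInftyConst {w : (Fin d → ℝ) → ℝ} (hw : IsWeight w) : 1 ≤ aInftyConst w := by
  let Q : Cube d := ⟨fun _ => 0, 1, one_pos⟩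
  refine le_trans ?_ (le_iSup (fun Q : Cube d =>
    (⨍⁻ x in Q.set, ENNReal.ofReal (w x) ∂volume) * expMeanLogInv w Q) Q)
  rw [laverage_eq_lintegral_avg]
  by_cases hi : Integrable (fun x => Real.log (w x)) Q.avg
  · rw [expMeanLogInv_eq hi]
    have hj := ofReal_exp_integral_log_le (Q.avg_ac.ae_le hw.2)
      (hw.aemeasurable.mono_ac Q.avg_ac) hi
    calc (1 : ℝ≥0∞) = ENNReal.ofReal (Real.exp (∫ x, Real.log (w x) ∂Q.avg)) *
          ENNReal.ofReal (Real.exp (-∫ x, Real.log (w x) ∂Q.avg)) := by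
          rw [← ENNReal.ofReal_mul (Real.exp_nonneg _), ← Real.exp_add]
          simp
      _ ≤ _ := by gcongr
  · have h' : ¬IntegrableOn (fun x => Real.log (w x)⁻¹) Q.set volume := by
      simp only [Real.log_inv]
      intro h
      refine hi ((integrable_avg_iff Q).2 ?_)
      simpa using h.neg
    rw [expMeanLogInv, if_neg h', ENNReal.mul_top]
    · exact le_top
    · refine lintegral_avg_ne_zero ?_
      rw [← weightMeasure_set]
      exact hw.weightMeasure_set_ne_zero Q

lemma IsWeight.log_dualWeight {w : (Fin d → ℝ) → ℝ} (hw : IsWeight w) (p : ℝ) (Q : Cube d) : (fun x => Real.log (dualWeight p w x)) =ᵐ[Q.avg]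
    fun x => -1 / (p - 1) * Real.log (w x) := by
  filter_upwards [Q.avg_ac.ae_le hw.2] with x hx
  rw [dualWeight, Real.log_rpow hx]

lemma IsWeight.integral_log_dualWeight {w : (Fin d → ℝ) → ℝ} (hw : IsWeight w) (p : ℝ)
    (Q : Cube d) :
    ∫ x, Real.log (dualWeight p w x) ∂Q.avg = -1 / (p - 1) * ∫ x, Real.log (w x) ∂Q.avg := by
  rw [integral_congr_ae (hw.log_dualWeight p Q), integral_const_mul]

namespace IsAp

variable {p : ℝ} {w : (Fin d → ℝ) → ℝ} (hw : IsAp p w) (hp : 1 < p)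
include hw hp

lemma integrable_log (Q : Cube d) : Integrable (fun x => Real.log (w x)) Q.avg := by
  have hp1 : 0 < p - 1 := by linarith
  refine integrable_log_of_lintegral_ne_top (hw.1.aemeasurable.mono_ac Q.avg_ac)
    (Q.avg_ac.ae_le hw.1.2) (s := 1 / (p - 1)) (by positivity)
    (lintegral_avg_ne_top (hw.1.setLIntegral_ne_top Q)) ?_
  rw [← neg_div]
  exact lintegral_avg_ne_top ((hw.isWeight_dualWeight hp).setLIntegral_ne_top Q)

lemma expMeanLogInv_eq (Q : Cube d) :
    expMeanLogInv w Q = ENNReal.ofReal (Real.exp (-∫ x, Real.log (w x) ∂Q.avg)) :=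
  Muckenhoupt.expMeanLogInv_eq (hw.integrable_log hp Q)

lemma integrable_log_dualWeight (Q : Cube d) :
    Integrable (fun x => Real.log (dualWeight p w x)) Q.avg :=
  ((hw.integrable_log hp Q).const_mul _).congr (hw.1.log_dualWeight p Q).symm

/-- The exponent `p-1` undoes the factor in `log σ⁻¹ = (log w)/(p-1)`. -/
lemma expMeanLogInv_dualWeight_rpow (Q : Cube d) : expMeanLogInv (dualWeight p w) Q ^ (p - 1) =
    ENNReal.ofReal (Real.exp (∫ x, Real.log (w x) ∂Q.avg)) := by
  have hp1 : 0 < p - 1 := by linarith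
  rw [Muckenhoupt.expMeanLogInv_eq (hw.integrable_log_dualWeight hp Q),
    hw.1.integral_log_dualWeight p, ofReal_exp_rpow]
  congr 2
  field_simp

/-- Jensen for the dual weight on each cube. -/
lemma aInftyConst_le_apConst : aInftyConst w ≤ apConst p w := by
  have hp1 : 0 < p - 1 := by linarith
  have hσ := hw.isWeight_dualWeight hp
  refine iSup_le fun Q => le_trans ?_ (apConst_le_iff.1 le_rfl Q)
  gcongr
  rw [laverage_eq_lintegral_avg, hw.expMeanLogInv_eq hp]
  have hj := ofReal_exp_integral_log_le (Q.avg_ac.ae_le hσ.2)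
    (hσ.aemeasurable.mono_ac Q.avg_ac) (hw.integrable_log_dualWeight hp Q)
  refine le_trans (le_of_eq ?_) (ENNReal.rpow_le_rpow hj hp1.le)
  rw [ofReal_exp_rpow, hw.1.integral_log_dualWeight p]
  congr 2
  field_simp

lemma aInftyConst_dualWeight_rpow_le_iff {a : ℝ≥0∞} :
    aInftyConst (dualWeight p w) ^ (p - 1) ≤ a ↔ ∀ Q : Cube d,
      (∫⁻ x, ENNReal.ofReal (dualWeight p w x) ∂Q.avg) ^ (p - 1) *
        ENNReal.ofReal (Real.exp (∫ x, Real.log (w x) ∂Q.avg)) ≤ a := by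
  have hp1 : 0 < p - 1 := by linarith
  rw [← ENNReal.le_rpow_inv_iff hp1, aInftyConst, iSup_le_iff]
  refine forall_congr' fun Q => ?_
  rw [ENNReal.le_rpow_inv_iff hp1, ENNReal.mul_rpow_of_nonneg _ _ hp1.le,
    hw.expMeanLogInv_dualWeight_rpow hp, laverage_eq_lintegral_avg]

/-- Jensen for `w` on each cube, now replacing the other factor of the `A_p` product. -/
lemma aInftyConst_dualWeight_rpow_le_apConst :
    aInftyConst (dualWeight p w) ^ (p - 1) ≤ apConst p w := by
  rw [hw.aInftyConst_dualWeight_rpow_le_iff hp]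
  intro Q
  refine le_trans ?_ (apConst_le_iff.1 le_rfl Q)
  rw [laverage_eq_lintegral_avg, laverage_eq_lintegral_avg, mul_comm]
  gcongr
  exact ofReal_exp_integral_log_le (Q.avg_ac.ae_le hw.1.2)
    (hw.1.aemeasurable.mono_ac Q.avg_ac) (hw.integrable_log hp Q)

lemma aInftyConst_dualWeight_lt_top : aInftyConst (dualWeight p w) < ∞ := by
  have hp1 : 0 < p - 1 := by linarith
  have h := (hw.aInftyConst_dualWeight_rpow_le_apConst hp).trans_lt hw.2
  rwa [ENNReal.rpow_lt_top_iff_of_pos hp1] at h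

end IsAp
end Muckenhoupt

/-! ### The weight `w R^{p-r}` and its three constants. -/

namespace Muckenhoupt

variable {d : ℕ}

/-- The weight `w R ^ (p - r)`. -/
noncomputable def extrapolationWeight (p r : ℝ) (w : (Fin d → ℝ) → ℝ)
    (R : (Fin d → ℝ) → ℝ≥0∞) (x : Fin d → ℝ) : ℝ :=
  w x * (R x).toReal ^ (p - r)

/-- Locally integrable functions `R` with `M R ≤ c R`. -/
structure IsAOne (c : ℝ≥0∞) (R : (Fin d → ℝ) → ℝ≥0∞) : Prop where
  aemeasurable : AEMeasurable R volume
  const_ne_top : c ≠ ∞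
  maxOp_le : ∀ x, maxOp R x ≤ c * R x
  setLIntegral_ne_zero : ∀ Q : Cube d, ∫⁻ x in Q.set, R x ≠ 0
  setLIntegral_ne_top : ∀ Q : Cube d, ∫⁻ x in Q.set, R x ≠ ∞
  ae_ne_top : ∀ᵐ x, R x ≠ ∞

namespace IsAOne

variable {c : ℝ≥0∞} {R : (Fin d → ℝ) → ℝ≥0∞} (hR : IsAOne c R)
include hR

lemma lintegral_avg_ne_zero (Q : Cube d) : ∫⁻ x, R x ∂Q.avg ≠ 0 :=
  Muckenhoupt.lintegral_avg_ne_zero (hR.setLIntegral_ne_zero Q)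

lemma lintegral_avg_ne_top (Q : Cube d) : ∫⁻ x, R x ∂Q.avg ≠ ∞ :=
  Muckenhoupt.lintegral_avg_ne_top (hR.setLIntegral_ne_top Q)

lemma lintegral_avg_le {Q : Cube d} {x : Fin d → ℝ} (hx : x ∈ Q.set) :
    ∫⁻ y, R y ∂Q.avg ≤ c * R x := by
  rw [← laverage_eq_lintegral_avg]
  exact (laverage_le_maxOp R hx).trans (hR.maxOp_le x)

/-- Every point lies in a cube, whose positive average of `R` is at most `c R x`. So `R` vanishes
nowhere. -/
lemma mul_ne_zero (x : Fin d → ℝ) : c * R x ≠ 0 := by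
  obtain ⟨Q, hQ⟩ := Cube.exists_superset_of_isBounded (Bornology.isBounded_singleton (x := x))
  intro h
  have := hR.lintegral_avg_le (hQ rfl)
  rw [h, nonpos_iff_eq_zero] at this
  exact hR.lintegral_avg_ne_zero Q this

lemma ne_zero (x : Fin d → ℝ) : R x ≠ 0 := right_ne_zero_of_mul (hR.mul_ne_zero x)

lemma const_ne_zero : c ≠ 0 := left_ne_zero_of_mul (hR.mul_ne_zero 0)

lemma div_le {Q : Cube d} {x : Fin d → ℝ} (hx : x ∈ Q.set) :
    (∫⁻ y, R y ∂Q.avg) / c ≤ R x :=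
  ENNReal.div_le_of_le_mul' (hR.lintegral_avg_le hx)

lemma div_ne_zero (Q : Cube d) : (∫⁻ y, R y ∂Q.avg) / c ≠ 0 :=
  ENNReal.div_ne_zero.2 ⟨hR.lintegral_avg_ne_zero Q, hR.const_ne_top⟩

lemma div_ne_top (Q : Cube d) : (∫⁻ y, R y ∂Q.avg) / c ≠ ∞ :=
  (ENNReal.div_lt_top (hR.lintegral_avg_ne_top Q) hR.const_ne_zero).ne

/-- The cancellation behind all three estimates: with `q = r - p` it produces the factor `c^{r-p}`.
-/
lemma div_rpow_neg_mul (Q : Cube d) {q : ℝ} (hq : 0 ≤ q) :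
    ((∫⁻ y, R y ∂Q.avg) / c) ^ (-q) * (∫⁻ y, R y ∂Q.avg) ^ q = c ^ q := by
  conv_lhs =>
    enter [2, 1]; rw [← ENNReal.div_mul_cancel (a := c) (b := ∫⁻ y, R y ∂Q.avg)
      hR.const_ne_zero hR.const_ne_top]
  rw [ENNReal.mul_rpow_of_nonneg _ _ hq, ← mul_assoc,
    ← ENNReal.rpow_add _ _ (hR.div_ne_zero Q) (hR.div_ne_top Q)]
  simp

lemma toReal_pos : ∀ᵐ x, 0 < (R x).toReal := by
  filter_upwards [hR.ae_ne_top] with x hx using ENNReal.toReal_pos (hR.ne_zero x) hx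

variable {p r : ℝ} {w : (Fin d → ℝ) → ℝ}

lemma ofReal_extrapolationWeight (hw : IsWeight w) :
    ∀ᵐ x, ENNReal.ofReal (extrapolationWeight p r w R x) =
      ENNReal.ofReal (w x) * R x ^ (-(r - p)) := by
  filter_upwards [hw.2, hR.toReal_pos, hR.ae_ne_top] with x hx hRx hRt
  rw [extrapolationWeight, ENNReal.ofReal_mul hx.le, ← ENNReal.ofReal_rpow_of_pos hRx,
    ENNReal.ofReal_toReal hRt, neg_sub]

lemma extrapolationWeight_pos (hw : IsWeight w) : ∀ᵐ x, 0 < extrapolationWeight p r w R x := by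
  filter_upwards [hw.2, hR.toReal_pos] with x hx hRx
  exact mul_pos hx (Real.rpow_pos_of_pos hRx _)

/-- The exponent of `R` is negative, so the lower bound `R ≥ ⟨R⟩_Q / c` on `Q` bounds the weight
from above. -/
lemma lintegral_extrapolationWeight_le (hw : IsWeight w) (hpr : p < r) (Q : Cube d) :
    ∫⁻ x, ENNReal.ofReal (extrapolationWeight p r w R x) ∂Q.avg ≤
      (∫⁻ x, ENNReal.ofReal (w x) ∂Q.avg) * ((∫⁻ y, R y ∂Q.avg) / c) ^ (-(r - p)) := by
  rw [← lintegral_mul_const'' _ (hw.aemeasurable_ofReal.mono_ac Q.avg_ac)]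
  refine lintegral_mono_ae ?_
  filter_upwards [Q.avg_ac.ae_le (hR.ofReal_extrapolationWeight (p := p) (r := r) hw),
    Q.ae_mem_avg] with x hx hxQ
  rw [hx, ENNReal.rpow_neg, ENNReal.rpow_neg]
  gcongr
  exact hR.div_le hxQ

lemma isWeight_extrapolationWeight (hw : IsWeight w) (hpr : p < r) :
    IsWeight (extrapolationWeight p r w R) := by
  refine isWeight_of_setLIntegral_ne_top ?_ (hR.extrapolationWeight_pos hw) fun Q h => ?_
  · exact (hw.aemeasurable.mul (hR.aemeasurable.ennreal_toReal.pow_const _)).aestronglyMeasurable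
  · have h1 := hR.lintegral_extrapolationWeight_le hw hpr Q
    rw [lintegral_avg, h, ENNReal.top_div_of_ne_top Q.volume_set_ne_top, top_le_iff] at h1
    refine ENNReal.mul_ne_top (Muckenhoupt.lintegral_avg_ne_top (hw.setLIntegral_ne_top Q)) ?_ h1
    exact ENNReal.rpow_ne_top_of_ne_zero (hR.div_ne_zero Q) (hR.div_ne_top Q)

/-- The dual weight factors as `W^{-1/(r-1)} = σ^{(p-1)/(r-1)} R^{(r-p)/(r-1)}`, the product to
which Hölder applies. -/
lemma lintegral_dualWeight_extrapolationWeight_rpow_le (hw : IsAp p w) (hp : 1 < p) (hpr : p < r)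
    (Q : Cube d) :
    (∫⁻ x, ENNReal.ofReal (dualWeight r (extrapolationWeight p r w R) x) ∂Q.avg) ^ (r - 1) ≤
      (∫⁻ x, ENNReal.ofReal (dualWeight p w x) ∂Q.avg) ^ (p - 1) *
        (∫⁻ x, R x ∂Q.avg) ^ (r - p) := by
  have hr1 : 0 < r - 1 := by linarith
  have hp1 : 0 < p - 1 := by linarith
  have hσ := hw.isWeight_dualWeight hp
  refine le_trans ?_ (lintegral_rpow_mul_rpow_le (hσ.aemeasurable_ofReal.mono_ac Q.avg_ac)
    (hR.aemeasurable.mono_ac Q.avg_ac) hp hpr)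
  refine le_of_eq ?_
  congr 1
  refine lintegral_congr_ae (Q.avg_ac.ae_le ?_)
  filter_upwards [(hR.isWeight_extrapolationWeight hw.1 hpr).ofReal_dualWeight r,
    hR.ofReal_extrapolationWeight (p := p) (r := r) hw.1, hw.1.ofReal_dualWeight p,
    hw.1.ofReal_ne_zero, hR.ae_ne_top] with x h1 h2 h3 h4 h5
  rw [h1, h2, h3, ENNReal.mul_rpow_of_ne_top ENNReal.ofReal_ne_top
    (ENNReal.rpow_ne_top_of_ne_zero (hR.ne_zero x) h5), ← ENNReal.rpow_mul, ← ENNReal.rpow_mul]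
  congr 2
  · field_simp
  · field_simp

lemma apConst_extrapolationWeight_le (hw : IsAp p w) (hp : 1 < p) (hpr : p < r) :
    apConst r (extrapolationWeight p r w R) ≤ c ^ (r - p) * apConst p w := by
  rw [apConst_le_iff]
  intro Q
  simp only [laverage_eq_lintegral_avg]
  calc _ ≤ (∫⁻ x, ENNReal.ofReal (w x) ∂Q.avg) * ((∫⁻ y, R y ∂Q.avg) / c) ^ (-(r - p)) *
        ((∫⁻ x, ENNReal.ofReal (dualWeight p w x) ∂Q.avg) ^ (p - 1) *
          (∫⁻ x, R x ∂Q.avg) ^ (r - p)) := by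
        gcongr
        · exact hR.lintegral_extrapolationWeight_le hw.1 hpr Q
        · exact hR.lintegral_dualWeight_extrapolationWeight_rpow_le hw hp hpr Q
    _ = ((∫⁻ y, R y ∂Q.avg) / c) ^ (-(r - p)) * (∫⁻ x, R x ∂Q.avg) ^ (r - p) *
        ((∫⁻ x, ENNReal.ofReal (w x) ∂Q.avg) *
          (∫⁻ x, ENNReal.ofReal (dualWeight p w x) ∂Q.avg) ^ (p - 1)) := by ring
    _ ≤ c ^ (r - p) * apConst p w := by
        rw [hR.div_rpow_neg_mul Q (by linarith)]
        gcongr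
        exact apConst_le_iff.1 le_rfl Q

lemma isAp_extrapolationWeight (hw : IsAp p w) (hp : 1 < p) (hpr : p < r) :
    IsAp r (extrapolationWeight p r w R) :=
  ⟨hR.isWeight_extrapolationWeight hw.1 hpr, (hR.apConst_extrapolationWeight_le hw hp hpr).trans_lt
    (ENNReal.mul_lt_top
      (ENNReal.rpow_lt_top_of_nonneg (by linarith) hR.const_ne_top) hw.2)⟩

lemma log_extrapolationWeight (hw : IsWeight w) :
    ∀ᵐ x, Real.log (extrapolationWeight p r w R x) =
      Real.log (w x) - (r - p) * Real.log (R x).toReal := by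
  filter_upwards [hw.2, hR.toReal_pos] with x hx hRx
  rw [extrapolationWeight, Real.log_mul hx.ne' (Real.rpow_pos_of_pos hRx _).ne',
    Real.log_rpow hRx]
  ring

/-- `log R` is a multiple of `log w - log W`, and both logarithms are integrable because both
weights are Muckenhoupt weights. -/
lemma integrable_log (hw : IsAp p w) (hp : 1 < p) (hpr : p < r) (Q : Cube d) :
    Integrable (fun x => Real.log (R x).toReal) Q.avg := by
  have h1 := hw.integrable_log hp Q
  have h2 := (hR.isAp_extrapolationWeight hw hp hpr).integrable_log (by linarith) Q
  refine ((h1.sub h2).const_mul (r - p)⁻¹).congr ?_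
  filter_upwards [Q.avg_ac.ae_le (hR.log_extrapolationWeight (p := p) (r := r) hw.1)] with x hx
  have : r - p ≠ 0 := by linarith
  rw [Pi.sub_apply, hx]
  field_simp
  ring

lemma integral_log_extrapolationWeight (hw : IsAp p w) (hp : 1 < p) (hpr : p < r) (Q : Cube d) :
    ∫ x, Real.log (extrapolationWeight p r w R x) ∂Q.avg =
      ∫ x, Real.log (w x) ∂Q.avg - (r - p) * ∫ x, Real.log (R x).toReal ∂Q.avg := by
  rw [integral_congr_ae (Q.avg_ac.ae_le (hR.log_extrapolationWeight (p := p) (r := r) hw.1)),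
    integral_sub (hw.integrable_log hp Q) ((hR.integrable_log hw hp hpr Q).const_mul _),
    integral_const_mul]

lemma ofReal_exp_integral_log_le {Q : Cube d}
    (hi : Integrable (fun x => Real.log (R x).toReal) Q.avg) :
    ENNReal.ofReal (Real.exp (∫ x, Real.log (R x).toReal ∂Q.avg)) ≤ ∫⁻ x, R x ∂Q.avg := by
  refine (_root_.ofReal_exp_integral_log_le (Q.avg_ac.ae_le hR.toReal_pos)
    (hR.aemeasurable.mono_ac Q.avg_ac).ennreal_toReal hi).trans (le_of_eq ?_)
  refine lintegral_congr_ae ?_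
  filter_upwards [Q.avg_ac.ae_le hR.ae_ne_top] with x hx using ENNReal.ofReal_toReal hx

/-- A reverse Jensen inequality, obtained by averaging the logarithm of `R ≥ ⟨R⟩_Q / c`. -/
lemma div_le_ofReal_exp_integral_log {Q : Cube d}
    (hi : Integrable (fun x => Real.log (R x).toReal) Q.avg) :
    (∫⁻ y, R y ∂Q.avg) / c ≤ ENNReal.ofReal (Real.exp (∫ x, Real.log (R x).toReal ∂Q.avg)) := by
  have hpos := ENNReal.toReal_pos (hR.div_ne_zero Q) (hR.div_ne_top Q)
  rw [← ENNReal.ofReal_toReal (hR.div_ne_top Q)]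
  refine ENNReal.ofReal_le_ofReal ?_
  rw [← Real.log_le_iff_le_exp hpos]
  calc Real.log ((∫⁻ y, R y ∂Q.avg) / c).toReal
      = ∫ _, Real.log ((∫⁻ y, R y ∂Q.avg) / c).toReal ∂Q.avg := by simp
    _ ≤ _ := by
      refine integral_mono_ae (integrable_const _) hi ?_
      filter_upwards [Q.ae_mem_avg, Q.avg_ac.ae_le hR.ae_ne_top] with x hx hxt
      exact Real.log_le_log hpos (ENNReal.toReal_mono hxt (hR.div_le hx))

/-- Here `log W⁻¹ = log w⁻¹ + (r-p) log R`, so the geometric mean of `R` enters with a positive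
power and Jensen bounds it by `⟨R⟩_Q`. -/
lemma aInftyConst_extrapolationWeight_le (hw : IsAp p w) (hp : 1 < p) (hpr : p < r) :
    aInftyConst (extrapolationWeight p r w R) ≤ c ^ (r - p) * aInftyConst w := by
  refine iSup_le fun Q => ?_
  have hi := hR.integrable_log hw hp hpr Q
  have hrp : 0 ≤ r - p := by linarith
  rw [laverage_eq_lintegral_avg,
    (hR.isAp_extrapolationWeight hw hp hpr).expMeanLogInv_eq (by linarith),
    hR.integral_log_extrapolationWeight hw hp hpr]
  set lR := ∫ x, Real.log (R x).toReal ∂Q.avg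
  set lw := ∫ x, Real.log (w x) ∂Q.avg with hlw
  have hexp : ENNReal.ofReal (Real.exp (-(lw - (r - p) * lR))) =
      ENNReal.ofReal (Real.exp (-lw)) * ENNReal.ofReal (Real.exp lR) ^ (r - p) := by
    rw [ofReal_exp_rpow, ← ENNReal.ofReal_mul (Real.exp_nonneg _), ← Real.exp_add]
    congr 2; ring
  calc _ ≤ (∫⁻ x, ENNReal.ofReal (w x) ∂Q.avg) * ((∫⁻ y, R y ∂Q.avg) / c) ^ (-(r - p)) *
        (ENNReal.ofReal (Real.exp (-lw)) * (∫⁻ x, R x ∂Q.avg) ^ (r - p)) := by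
        rw [hexp]
        gcongr
        · exact hR.lintegral_extrapolationWeight_le hw.1 hpr Q
        · exact hR.ofReal_exp_integral_log_le hi
    _ = ((∫⁻ y, R y ∂Q.avg) / c) ^ (-(r - p)) * (∫⁻ x, R x ∂Q.avg) ^ (r - p) *
        ((∫⁻ x, ENNReal.ofReal (w x) ∂Q.avg) * expMeanLogInv w Q) := by
        rw [hw.expMeanLogInv_eq hp]; ring
    _ ≤ _ := by
        rw [hR.div_rpow_neg_mul Q hrp]
        gcongr
        exact le_iSup (fun Q : Cube d =>
          (⨍⁻ x in Q.set, ENNReal.ofReal (w x) ∂volume) * expMeanLogInv w Q) Q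

/-- The roles are exchanged: Hölder for the dual weight gives `⟨R⟩_Q^{r-p}`, and the geometric mean
of `R` enters with a negative power, where the reverse Jensen inequality is used. -/
lemma aInftyConst_dualWeight_extrapolationWeight_le (hw : IsAp p w) (hp : 1 < p) (hpr : p < r) :
    aInftyConst (dualWeight r (extrapolationWeight p r w R)) ^ (r - 1) ≤
      c ^ (r - p) * aInftyConst (dualWeight p w) ^ (p - 1) := by
  rw [(hR.isAp_extrapolationWeight hw hp hpr).aInftyConst_dualWeight_rpow_le_iff (by linarith)]
  intro Q
  have hi := hR.integrable_log hw hp hpr Q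
  have hrp : 0 ≤ r - p := by linarith
  rw [hR.integral_log_extrapolationWeight hw hp hpr]
  set lR := ∫ x, Real.log (R x).toReal ∂Q.avg
  set lw := ∫ x, Real.log (w x) ∂Q.avg with hlw
  have hexp : ENNReal.ofReal (Real.exp (lw - (r - p) * lR)) =
      ENNReal.ofReal (Real.exp lw) * ENNReal.ofReal (Real.exp lR) ^ (-(r - p)) := by
    rw [ofReal_exp_rpow, ← ENNReal.ofReal_mul (Real.exp_nonneg _), ← Real.exp_add]
    congr 2; ring
  calc _ ≤ (∫⁻ x, ENNReal.ofReal (dualWeight p w x) ∂Q.avg) ^ (p - 1) *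
          (∫⁻ x, R x ∂Q.avg) ^ (r - p) * (ENNReal.ofReal (Real.exp lw) *
            ((∫⁻ y, R y ∂Q.avg) / c) ^ (-(r - p))) := by
        rw [hexp, ENNReal.rpow_neg, ENNReal.rpow_neg]
        gcongr
        · exact hR.lintegral_dualWeight_extrapolationWeight_rpow_le hw hp hpr Q
        · exact hR.div_le_ofReal_exp_integral_log hi
    _ = ((∫⁻ y, R y ∂Q.avg) / c) ^ (-(r - p)) * (∫⁻ x, R x ∂Q.avg) ^ (r - p) *
        ((∫⁻ x, ENNReal.ofReal (dualWeight p w x) ∂Q.avg) ^ (p - 1) *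
          ENNReal.ofReal (Real.exp lw)) := by ring
    _ ≤ _ := by
        rw [hR.div_rpow_neg_mul Q hrp]
        gcongr
        exact (hw.aInftyConst_dualWeight_rpow_le_iff hp).1 le_rfl Q

end IsAOne
end Muckenhoupt

/-! ### The extrapolation argument. -/

namespace Muckenhoupt

variable {d : ℕ} {p r : ℝ} {w : (Fin d → ℝ) → ℝ}

namespace IsAOne

variable {c : ℝ≥0∞} {R : (Fin d → ℝ) → ℝ≥0∞} (hR : IsAOne c R)
include hR

lemma lintegral_extrapolationWeight (hw : IsWeight w) (hpr : p < r) {v : (Fin d → ℝ) → ℝ≥0∞}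
    (hv : AEMeasurable v volume) :
    ∫⁻ x, v x ∂(weightMeasure (extrapolationWeight p r w R)) =
      ∫⁻ x, v x * R x ^ (-(r - p)) ∂(weightMeasure w) := by
  rw [(hR.isWeight_extrapolationWeight hw hpr).lintegral_weightMeasure hv,
    hw.lintegral_weightMeasure (hv.fun_mul (hR.aemeasurable.pow_const _))]
  refine lintegral_congr_ae ?_
  filter_upwards [hR.ofReal_extrapolationWeight (p := p) (r := r) hw] with x hx
  rw [hx]
  ring

/-- Pointwise `u^r R^{p-r} ≤ u^p`, because `u ≤ R` and `r > p`. -/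
lemma lintegral_rpow_extrapolationWeight_le (hw : IsWeight w) (hp : 1 < p) (hpr : p < r)
    {u : (Fin d → ℝ) → ℝ≥0∞} (hu : AEMeasurable u volume) (huR : u ≤ R) :
    ∫⁻ x, u x ^ r ∂(weightMeasure (extrapolationWeight p r w R)) ≤
      ∫⁻ x, u x ^ p ∂(weightMeasure w) := by
  rw [hR.lintegral_extrapolationWeight hw hpr (hu.pow_const r)]
  refine lintegral_mono_ae ?_
  filter_upwards [(weightMeasure_ac w).ae_le hR.ae_ne_top] with x hx
  calc u x ^ r * R x ^ (-(r - p)) = u x ^ p * u x ^ (r - p) * R x ^ (-(r - p)) := by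
        rw [← ENNReal.rpow_add_of_nonneg _ _ (by linarith) (by linarith)]
        congr 2; ring
    _ ≤ u x ^ p * R x ^ (r - p) * R x ^ (-(r - p)) := by
        gcongr
        exact huR x
    _ = u x ^ p := by
        rw [mul_assoc, ← ENNReal.rpow_add _ _ (hR.ne_zero x) hx]
        simp

/-- Hölder for the factorization `v^p = (v^r R^{-(r-p)})^{p/r} (R^p)^{(r-p)/r}`. -/
lemma lintegral_rpow_le_mul (hw : IsWeight w) (hp : 1 < p) (hpr : p < r)
    {v : (Fin d → ℝ) → ℝ≥0∞} (hv : AEMeasurable v volume) :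
    ∫⁻ x, v x ^ p ∂(weightMeasure w) ≤
      (∫⁻ x, v x ^ r ∂(weightMeasure (extrapolationWeight p r w R))) ^ (p / r) *
        (∫⁻ x, R x ^ p ∂(weightMeasure w)) ^ ((r - p) / r) := by
  have hp0 : 0 < p := by linarith
  have hr0 : 0 < r := by linarith
  rw [hR.lintegral_extrapolationWeight hw hpr (hv.pow_const r)]
  have hvw := hv.mono_ac (weightMeasure_ac w)
  have hRw := hR.aemeasurable.mono_ac (weightMeasure_ac w)
  refine le_trans ?_ (ENNReal.lintegral_mul_norm_pow_le
    ((hvw.pow_const r).fun_mul (hRw.pow_const (-(r - p)))) (hRw.pow_const p)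
    (p := p / r) (q := (r - p) / r) (by positivity) (div_nonneg (by linarith) hr0.le)
    (by field_simp; ring))
  refine le_of_eq (lintegral_congr_ae ?_)
  filter_upwards [(weightMeasure_ac w).ae_le hR.ae_ne_top] with x hx
  rw [ENNReal.mul_rpow_of_nonneg _ _ (by positivity), ← ENNReal.rpow_mul, ← ENNReal.rpow_mul,
    ← ENNReal.rpow_mul, mul_assoc, ← ENNReal.rpow_add _ _ (hR.ne_zero x) hx,
    show -(r - p) * (p / r) + p * ((r - p) / r) = 0 by ring, ENNReal.rpow_zero, mul_one,
    mul_div_cancel₀ _ hr0.ne']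

end IsAOne

lemma exists_setLIntegral_ne_zero {u : (Fin d → ℝ) → ℝ≥0∞} (hu : AEMeasurable u volume)
    (h : ¬u =ᵐ[volume] 0) : ∃ Q : Cube d, ∫⁻ x in Q.set, u x ≠ 0 := by
  by_contra! hcon
  refine h ?_
  rw [← Measure.restrict_univ (μ := volume), ← Metric.iUnion_closedBall_nat (0 : Fin d → ℝ),
    Filter.EventuallyEq, ae_restrict_iUnion_iff]
  intro n
  obtain ⟨Q, hQ⟩ := Cube.exists_superset_of_isBounded
    (Metric.isBounded_closedBall (x := (0 : Fin d → ℝ)) (r := n))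
  exact ae_restrict_of_ae_restrict_of_subset hQ ((lintegral_eq_zero_iff' hu.restrict).1 (hcon Q))

/-- A majorant of Rubio de Francia type for a nonzero function in `L^p(w)`. -/
lemma IsAp.exists_isAOne (hw : IsAp p w) (hp : 1 < p) {u : (Fin d → ℝ) → ℝ≥0∞}
    (hu : AEMeasurable u volume) (hu0 : ¬u =ᵐ[volume] 0)
    (hfin : ∫⁻ x, u x ^ p ∂(weightMeasure w) ≠ ∞) :
    ∃ R : (Fin d → ℝ) → ℝ≥0∞, IsAOne (2 * maximalNorm p w) R ∧ u ≤ R ∧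
      (∫⁻ x, R x ^ p ∂(weightMeasure w)) ^ (1 / p) ≤
        2 * (∫⁻ x, u x ^ p ∂(weightMeasure w)) ^ (1 / p) := by
  have hp0 : 0 < p := by linarith
  have hM := (hw.maximalNorm_lt_top hp).ne
  obtain ⟨R, hRm, huR, hmax, hint⟩ := exists_maxOp_le_mul hp hw.1 hM hu hfin
  have hc : 2 * maximalNorm p w ≠ ∞ := ENNReal.mul_ne_top ENNReal.ofNat_ne_top hM
  have hRI : (∫⁻ x, R x ^ p ∂(weightMeasure w)) ^ (1 / p) ≠ ∞ := by
    refine ne_top_of_le_ne_top ?_ hint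
    exact ENNReal.mul_ne_top ENNReal.ofNat_ne_top
      (ENNReal.rpow_ne_top_of_nonneg (by positivity) hfin)
  have hRI' : ∫⁻ x, R x ^ p ∂(weightMeasure w) ≠ ∞ := by
    intro h
    rw [h, ENNReal.top_rpow_of_pos (by positivity)] at hRI
    exact hRI rfl
  -- A zero of `R` would force `M R = 0` there, hence a zero integral of `R ≥ u` over a cube that
  -- also contains a cube on which `u` has positive integral.
  have hRpos : ∀ x, R x ≠ 0 := by
    intro x hx
    obtain ⟨Q₀, hQ₀⟩ := exists_setLIntegral_ne_zero hu hu0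
    obtain ⟨Q, hQ⟩ := Cube.exists_superset_of_isBounded
      ((Q₀.isCompact_set.isBounded).union (Bornology.isBounded_singleton (x := x)))
    have h1 := (laverage_le_maxOp R (hQ (Or.inr rfl))).trans (hmax x)
    rw [hx, mul_zero, nonpos_iff_eq_zero, setLAverage_eq, ENNReal.div_eq_zero_iff] at h1
    rcases h1 with h1 | h1
    · refine hQ₀ (le_antisymm ?_ zero_le)
      rw [← h1]
      exact (lintegral_mono_set (Set.subset_union_left.trans hQ)).trans (lintegral_mono huR)
    · exact Q.volume_set_ne_top h1
  refine ⟨R, ⟨hRm, hc, hmax, fun Q => ?_, fun Q => ?_, ?_⟩, huR, hint⟩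
  · exact setLIntegral_ne_zero hRm (Filter.Eventually.of_forall hRpos) Q
  · refine ne_top_of_le_ne_top ?_ (hw.setLIntegral_le hp hRm Q)
    refine ENNReal.mul_ne_top hRI (ENNReal.rpow_ne_top_of_nonneg ?_
      ((hw.isWeight_dualWeight hp).weightMeasure_set_ne_top Q))
    rw [sub_nonneg, div_le_one hp0]
    exact hp.le
  · refine hw.1.volume_ac.ae_le ?_
    filter_upwards [ae_lt_top' ((hRm.mono_ac (weightMeasure_ac w)).pow_const p) hRI'] with x hx h
    rw [h, ENNReal.top_rpow_of_pos hp0] at hx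
    exact lt_irrefl _ hx

/-- The admissible weight for the zero function, for which no majorant `R` is available. -/
lemma isAp_one (r : ℝ) : IsAp r (fun _ : Fin d → ℝ => (1 : ℝ)) := by
  refine ⟨⟨locallyIntegrable_const 1, Filter.Eventually.of_forall fun _ => one_pos⟩, ?_⟩
  refine lt_of_le_of_lt (b := 1) (apConst_le_iff.2 fun Q => ?_) ENNReal.one_lt_top
  simp [laverage_eq_lintegral_avg, dualWeight]

/-- The extrapolation argument for one function. -/
lemma IsAp.eLpNorm_le_of_eLpNorm_le (hw : IsAp p w) (hp : 1 < p) (hpr : p < r)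
    {T : ((Fin d → ℝ) → ℂ) → ((Fin d → ℝ) → ℂ)} {f : (Fin d → ℝ) → ℂ}
    (hf : MemLp f (ENNReal.ofReal p) (weightMeasure w)) {B : ℝ≥0∞}
    {C : ((Fin d → ℝ) → ℝ) → ℝ≥0∞}
    (hT : ∀ v : (Fin d → ℝ) → ℝ, IsAp r v → MemLp f (ENNReal.ofReal r) (weightMeasure v) →
      AEStronglyMeasurable (T f) volume ∧ eLpNorm (T f) (ENNReal.ofReal r) (weightMeasure v) ≤
        C v * eLpNorm f (ENNReal.ofReal r) (weightMeasure v))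
    (hB : ∀ R : (Fin d → ℝ) → ℝ≥0∞, IsAOne (2 * maximalNorm p w) R →
      C (extrapolationWeight p r w R) ≤ B) :
    AEStronglyMeasurable (T f) volume ∧ eLpNorm (T f) (ENNReal.ofReal p) (weightMeasure w) ≤
      2 * B * eLpNorm f (ENNReal.ofReal p) (weightMeasure w) := by
  have hp0 : 0 < p := by linarith
  have hr0 : 0 < r := by linarith
  have hr1 : 1 < r := by linarith
  have hfm : AEStronglyMeasurable f volume := hf.1.mono_ac hw.1.volume_ac
  have hum : AEMeasurable (fun x => ‖f x‖ₑ) volume := hfm.enorm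
  -- For `f = 0` the iteration degenerates, and `T` is not assumed to map `0` to `0`. The hypothesis
  -- with the weight `1` shows that `T f` vanishes a.e.
  by_cases hf0 : (fun x => ‖f x‖ₑ) =ᵐ[volume] 0
  · have hfz : f =ᵐ[volume] 0 := by
      filter_upwards [hf0] with x hx
      simpa using hx
    have h1 := isAp_one (d := d) r
    have hfr : eLpNorm f (ENNReal.ofReal r) (weightMeasure fun _ => 1) = 0 := by
      rw [eLpNorm_congr_ae ((weightMeasure_ac _).ae_le hfz)]
      exact eLpNorm_zero
    obtain ⟨hTm, hTb⟩ := hT _ h1 ⟨hfm.mono_ac (weightMeasure_ac _), by rw [hfr]; simp⟩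
    refine ⟨hTm, ?_⟩
    rw [hfr, mul_zero, nonpos_iff_eq_zero, eLpNorm_eq_zero_iff
      (hTm.mono_ac (weightMeasure_ac _)) (by simpa using hr0)] at hTb
    rw [eLpNorm_congr_ae ((weightMeasure_ac w).ae_le (h1.1.volume_ac.ae_le hTb)), eLpNorm_zero]
    exact zero_le
  have hI : ∫⁻ x, ‖f x‖ₑ ^ p ∂(weightMeasure w) ≠ ∞ := by
    have := hf.2
    rw [eLpNorm_ofReal hp, ENNReal.rpow_lt_top_iff_of_pos (by positivity)] at this
    exact this.ne
  obtain ⟨R, hR, huR, hRint⟩ := hw.exists_isAOne hp hum hf0 hI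
  have hfW := hR.lintegral_rpow_extrapolationWeight_le hw.1 hp hpr hum huR
  set W := extrapolationWeight p r w R
  set I := ∫⁻ x, ‖f x‖ₑ ^ p ∂(weightMeasure w)
  obtain ⟨hTm, hTb⟩ := hT W (hR.isAp_extrapolationWeight hw hp hpr)
    ⟨hfm.mono_ac (weightMeasure_ac _), by
      rw [eLpNorm_ofReal hr1]
      exact ENNReal.rpow_lt_top_of_nonneg (by positivity) (ne_top_of_le_ne_top hI hfW)⟩
  refine ⟨hTm, ?_⟩
  rw [eLpNorm_ofReal hr1, eLpNorm_ofReal hr1] at hTb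
  have hθ : 0 ≤ (r - p) / r := div_nonneg (by linarith) hr0.le
  rw [eLpNorm_ofReal hp, eLpNorm_ofReal hp]
  calc (∫⁻ x, ‖T f x‖ₑ ^ p ∂(weightMeasure w)) ^ (1 / p)
      ≤ ((∫⁻ x, ‖T f x‖ₑ ^ r ∂(weightMeasure W)) ^ (p / r) *
          (∫⁻ x, R x ^ p ∂(weightMeasure w)) ^ ((r - p) / r)) ^ (1 / p) := by
        gcongr
        exact hR.lintegral_rpow_le_mul hw.1 hp hpr hTm.enorm
    _ = (∫⁻ x, ‖T f x‖ₑ ^ r ∂(weightMeasure W)) ^ (1 / r) *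
          ((∫⁻ x, R x ^ p ∂(weightMeasure w)) ^ (1 / p)) ^ ((r - p) / r) := by
        rw [ENNReal.mul_rpow_of_nonneg _ _ (by positivity), ← ENNReal.rpow_mul,
          ← ENNReal.rpow_mul, ← ENNReal.rpow_mul, mul_comm (1 / p) ((r - p) / r)]
        congr 2
        field_simp
    _ ≤ (B * I ^ (1 / r)) * (2 * I ^ (1 / p)) ^ ((r - p) / r) := by
        gcongr
        refine hTb.trans ?_
        gcongr
        exact hB R hR
    -- The factor `2` in the norm bound for `R` appears with an exponent at most `1`.
    _ ≤ (B * I ^ (1 / r)) * (2 * (I ^ (1 / p)) ^ ((r - p) / r)) := by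
        rw [ENNReal.mul_rpow_of_nonneg _ _ hθ]
        gcongr
        conv_rhs => rw [← ENNReal.rpow_one 2]
        refine ENNReal.rpow_le_rpow_of_exponent_le one_le_two ?_
        rw [div_le_one hr0]
        linarith
    _ = 2 * B * (I ^ (1 / r) * I ^ (1 / p * ((r - p) / r))) := by
        rw [← ENNReal.rpow_mul]; ring
    _ = 2 * B * I ^ (1 / p) := by
        rw [← ENNReal.rpow_add_of_nonneg _ _ (by positivity) (by positivity)]
        congr 2
        field_simp
        ring

lemma monotoneOn₃_le {φ : ℝ → ℝ → ℝ → ℝ≥0}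
    (h₁ : ∀ y ∈ Set.Ici (1 : ℝ), ∀ z ∈ Set.Ici (1 : ℝ),
      MonotoneOn (fun x => φ x y z) (Set.Ici 1))
    (h₂ : ∀ x ∈ Set.Ici (1 : ℝ), ∀ z ∈ Set.Ici (1 : ℝ),
      MonotoneOn (fun y => φ x y z) (Set.Ici 1))
    (h₃ : ∀ x ∈ Set.Ici (1 : ℝ), ∀ y ∈ Set.Ici (1 : ℝ),
      MonotoneOn (fun z => φ x y z) (Set.Ici 1))
    {x x' y y' z z' : ℝ} (hx : 1 ≤ x) (hy : 1 ≤ y) (hz : 1 ≤ z) (hxx : x ≤ x') (hyy : y ≤ y')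
    (hzz : z ≤ z') : φ x y z ≤ φ x' y' z' :=
  (h₁ y hy z hz hx (hx.trans hxx) hxx).trans <|
    (h₂ x' (hx.trans hxx) z hz hy (hy.trans hyy) hyy).trans <|
      h₃ x' (hx.trans hxx) y' (hy.trans hyy) hz (hz.trans hzz) hzz

lemma one_le_toReal {a : ℝ≥0∞} (h : 1 ≤ a) (ha : a ≠ ∞) : 1 ≤ a.toReal := by
  simpa using ENNReal.toReal_mono ha h

lemma toReal_le_rpow_mul_toReal {a b c : ℝ≥0∞} {q : ℝ} (h : a ≤ (2 * c) ^ q * b) (hb : b ≠ ∞)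
    (hc : c ≠ ∞) (hq : 0 ≤ q) : a.toReal ≤ (2 * c.toReal) ^ q * b.toReal := by
  have := ENNReal.toReal_mono (ENNReal.mul_ne_top (ENNReal.rpow_ne_top_of_nonneg hq
    (ENNReal.mul_ne_top ENNReal.ofNat_ne_top hc)) hb) h
  simpa [ENNReal.toReal_mul, ← ENNReal.toReal_rpow] using this

end Muckenhoupt

/-! ### Assembly of the two bounds. -/

theorem theorem1p5 (d : ℕ) (hd : 0 < d) :
    -- a constant that depends only on the dimension
    ∃ c : ℝ, 0 < c ∧
    ∀ (r : ℝ), 1 < r →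
    -- `φ` matters only on `[1, ∞)^3`, where it is increasing in each variable
    ∀ (φ : ℝ → ℝ → ℝ → ℝ≥0),
      (∀ y ∈ Set.Ici (1 : ℝ), ∀ z ∈ Set.Ici (1 : ℝ),
        MonotoneOn (fun x => φ x y z) (Set.Ici 1)) →
      (∀ x ∈ Set.Ici (1 : ℝ), ∀ z ∈ Set.Ici (1 : ℝ),
        MonotoneOn (fun y => φ x y z) (Set.Ici 1)) →
      (∀ x ∈ Set.Ici (1 : ℝ), ∀ y ∈ Set.Ici (1 : ℝ),
        MonotoneOn (fun z => φ x y z) (Set.Ici 1)) →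
    -- an arbitrary operator, not assumed linear; only its values on `⋃ L^r(w)` matter
    ∀ (T : ((Fin d → ℝ) → ℂ) → ((Fin d → ℝ) → ℂ)),
      (∀ w : (Fin d → ℝ) → ℝ, IsAp r w →
        ∀ f : (Fin d → ℝ) → ℂ, MemLp f (ENNReal.ofReal r) (weightMeasure w) →
          AEStronglyMeasurable (T f) volume ∧
          eLpNorm (T f) (ENNReal.ofReal r) (weightMeasure w) ≤
            (φ (apConst r w).toReal (aInftyConst w).toReal
              ((aInftyConst (dualWeight r w)).toReal ^ (r - 1)) : ℝ≥0∞) *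
            eLpNorm f (ENNReal.ofReal r) (weightMeasure w)) →
    ∀ (p : ℝ), 1 < p → p < r →
    ∀ w : (Fin d → ℝ) → ℝ, IsAp p w →
      -- all the quantities that enter the bounds are finite
      maximalNorm p w < ∞ ∧ aInftyConst w < ∞ ∧
      aInftyConst (dualWeight p w) < ∞ ∧ aInftyConst' (dualWeight p w) < ∞ ∧
      -- the bound in terms of the norm of the maximal operator
      (∀ f : (Fin d → ℝ) → ℂ, MemLp f (ENNReal.ofReal p) (weightMeasure w) →
        AEStronglyMeasurable (T f) volume ∧
        eLpNorm (T f) (ENNReal.ofReal p) (weightMeasure w) ≤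
          2 * (φ
            ((2 * (maximalNorm p w).toReal) ^ (r - p) * (apConst p w).toReal)
            ((2 * (maximalNorm p w).toReal) ^ (r - p) * (aInftyConst w).toReal)
            ((2 * (maximalNorm p w).toReal) ^ (r - p) *
              (aInftyConst (dualWeight p w)).toReal ^ (p - 1)) : ℝ≥0∞) *
          eLpNorm f (ENNReal.ofReal p) (weightMeasure w)) ∧
      -- the explicit bound in terms of the weight constants
      2 * φ
          ((2 * (maximalNorm p w).toReal) ^ (r - p) * (apConst p w).toReal)
          ((2 * (maximalNorm p w).toReal) ^ (r - p) * (aInftyConst w).toReal)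
          ((2 * (maximalNorm p w).toReal) ^ (r - p) *
            (aInftyConst (dualWeight p w)).toReal ^ (p - 1)) ≤
        2 * φ
          ((c * (p / (p - 1)) * ((apConst p w).toReal *
              (aInftyConst' (dualWeight p w)).toReal) ^ (1 / p)) ^ (r - p) *
            (apConst p w).toReal)
          ((c * (p / (p - 1)) * ((apConst p w).toReal *
              (aInftyConst' (dualWeight p w)).toReal) ^ (1 / p)) ^ (r - p) *
            (aInftyConst w).toReal)
          ((c * (p / (p - 1)) * ((apConst p w).toReal *
              (aInftyConst' (dualWeight p w)).toReal) ^ (1 / p)) ^ (r - p) *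
            (aInftyConst (dualWeight p w)).toReal ^ (p - 1)) := by
  -- Twice the constant of the mixed bound, because the estimate involves `2‖M‖`.
  refine ⟨2 * (4 * 12 ^ d), by positivity, ?_⟩
  intro r hr φ h₁ h₂ h₃ T hT p hp hpr w hw
  have hp0 : 0 < p := by linarith
  have hp1 : 0 < p - 1 := by linarith
  have hr1 : 0 < r - 1 := by linarith
  have hrp : 0 ≤ r - p := by linarith
  have hσ := hw.isWeight_dualWeight hp
  have hM := hw.maximalNorm_lt_top hp
  have hA := (hw.aInftyConst_le_apConst hp).trans_lt hw.2
  have hAσ := hw.aInftyConst_dualWeight_lt_top hp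
  have hAσ' := (hw.aInftyConst'_dualWeight_le hp).trans_lt hM
  have hM1 := one_le_toReal (one_le_maximalNorm hp hw.1) hM.ne
  have hA1 := one_le_toReal (one_le_aInftyConst hw.1) hA.ne
  have hap1 := one_le_toReal ((one_le_aInftyConst hw.1).trans (hw.aInftyConst_le_apConst hp)) hw.2.ne
  have hAσ1 := Real.one_le_rpow (one_le_toReal (one_le_aInftyConst hσ) hAσ.ne) hp1.le
  refine ⟨hM, hA, hAσ, hAσ', fun f hf => ?_, ?_⟩
  · refine hw.eLpNorm_le_of_eLpNorm_le hp hpr hf (C := fun v => (φ (apConst r v).toReal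
      (aInftyConst v).toReal ((aInftyConst (dualWeight r v)).toReal ^ (r - 1)) : ℝ≥0∞))
      (fun v hv => hT v hv f) fun R hR => ?_
    have hW := hR.isAp_extrapolationWeight hw hp hpr
    have hWσ := hW.isWeight_dualWeight hr
    have hWA := (hW.aInftyConst_le_apConst hr).trans_lt hW.2
    have hWAσ := hW.aInftyConst_dualWeight_lt_top hr
    have h1 := one_le_aInftyConst hW.1
    refine ENNReal.coe_le_coe.2 (monotoneOn₃_le h₁ h₂ h₃
      (one_le_toReal (h1.trans (hW.aInftyConst_le_apConst hr)) hW.2.ne) (one_le_toReal h1 hWA.ne)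
      (Real.one_le_rpow (one_le_toReal (one_le_aInftyConst hWσ) hWAσ.ne) hr1.le) ?_ ?_ ?_)
    · exact toReal_le_rpow_mul_toReal (hR.apConst_extrapolationWeight_le hw hp hpr) hw.2.ne
        hM.ne hrp
    · exact toReal_le_rpow_mul_toReal (hR.aInftyConst_extrapolationWeight_le hw hp hpr) hA.ne
        hM.ne hrp
    -- The third entry is compared with its powers already taken, since only `[σ]^{p-1}` scales by
    -- `c^{r-p}`.
    · rw [ENNReal.toReal_rpow, ENNReal.toReal_rpow]
      exact toReal_le_rpow_mul_toReal (hR.aInftyConst_dualWeight_extrapolationWeight_le hw hp hpr)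
        (ENNReal.rpow_ne_top_of_nonneg hp1.le hAσ.ne) hM.ne hrp
  · have hmixed : 2 * (maximalNorm p w).toReal ≤ 2 * (4 * 12 ^ d) * (p / (p - 1)) *
        ((apConst p w).toReal * (aInftyConst' (dualWeight p w)).toReal) ^ (1 / p) := by
      have h := ENNReal.toReal_mono (by
        have := hw.2.ne
        have := hAσ'.ne
        finiteness) (hw.maximalNorm_le_mixed hp)
      rw [ENNReal.toReal_mul, ← ENNReal.toReal_rpow, ENNReal.toReal_mul, ENNReal.toReal_mul,
        ENNReal.toReal_mul, ENNReal.toReal_ofReal (by positivity)] at h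
      simp only [ENNReal.toReal_ofNat, ENNReal.toReal_pow] at h
      linarith
    have hpow := Real.rpow_le_rpow (by positivity) hmixed hrp
    -- The scalar is at least `1` since `‖M‖ ≥ 1`, so the smaller arguments already lie in the
    -- region where `φ` is increasing.
    have hone : 1 ≤ (2 * (maximalNorm p w).toReal) ^ (r - p) :=
      Real.one_le_rpow (by linarith) hrp
    gcongr 2 * ?_
    exact monotoneOn₃_le h₁ h₂ h₃ (one_le_mul_of_one_le_of_one_le hone hap1)
      (one_le_mul_of_one_le_of_one_le hone hA1) (one_le_mul_of_one_le_of_one_le hone hAσ1)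
      (by gcongr) (by gcongr) (by gcongr)
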